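/- Let $K$ be a non-archimedean local field with ring of integers $\mathcal{O}_K$ and residue field $\mathbb{F}_q$, and let $B$ be an $n^2$-dimensional central division algebra over $K$. For a finite-dimensional division $K$-algebra $D$ let $\mathcal{O}_D$ be its ring of integers (the elements integral over $\mathcal{O}_K$) and $\mathfrak{m}_D$ the maximal ideal of $\mathcal{O}_D$. The Bruhat–Tits tree $\mathfrak{T}(D)$ is the graph whose vertices are the maximal $\mathcal{O}_K$-orders of $\mathbb{M}_2(D)$, two distinct orders being neighbours if they are the endomorphism rings of right $\mathcal{O}_D$-lattices $M,M'$ in the column space $D^2$ with $M\mathfrak{m}_D\subseteq M'\subseteq M$. Let $L\subseteq B$ be a simple $K$-subalgebra, $C\subseteq B$ its centralizer, $e=e(L/K)$ the ramification index (the index of the value group of $K$ in that of $L$), and $f=f(L/K)=[\mathcal{O}_L/\mathfrak{m}_L:\mathcal{O}_K/\mathfrak{m}_K]$ the residual degree. Then $e$ divides $n$; put $e'=n/e$. Let the branch $\mathfrak{S}(\mathcal{O}_L)$ be the full subgraph of $\mathfrak{T}(B)$ on the maximal orders of $\mathbb{M}_2(B)$ that contain all scalar matrices $\begin{pmatrix}\lambda&0\\0&\lambda\end{pmatrix}$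 with $\lambda\in\mathcal{O}_L$. For integers $t,r\ge 0$, a $(t,r)$-rose is a tree with a distinguished vertex (its center) of valency $t$ such that every path starting at the center has length at most $r$; attaching it to a vertex $v$ of a graph means identifying its center with $v$ in the disjoint union. A node of a graph is a vertex of valency at least $3$. For a graph $\Gamma$ and $f\ge1$, the $f$-th subdivision $\Gamma/f$ is obtained by replacing every edge of $\Gamma$ by a path of length $f$. Then there is a $(q^n-q^{e'},e')$-rose $\mathfrak{Z}$ such that $\mathfrak{S}(\mathcal{O}_L)$ is isomorphic, as a graph, to the graph obtained from $\mathfrak{T}(C)/f$ by attaching a copy of $\mathfrak{Z}$ to every node of $\mathfrak{T}(C)/f$. -/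

import Mathlib

open ValuativeRel

namespace BranchTree

/-! ### Integers of a finite-dimensional division algebra over a local field

A finite-dimensional division algebra `D` over `K` enters as a ring without zero divisors that is
finite-dimensional over `K`, so that subalgebras are covered as they stand. -/

section Integers

open Polynomial

theorem isIntegral_one_add {R A : Type*} [CommRing R] [Ring A] [Algebra R A] {z : A}
    (hz : IsIntegral R z) : IsIntegral R (1 + z) := by
  obtain ⟨p, hp, h⟩ := hz
  refine ⟨p.comp (X - C 1), hp.comp_X_sub_C 1, ?_⟩
  change aeval (1 + z) (p.comp (X - C 1)) = 0
  rw [Polynomial.aeval_comp]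
  simpa [aeval_def] using h

theorem exists_mul_eq (k : Type*) {A : Type*} [Field k] [Ring A] [IsDomain A] [Algebra k A]
    [FiniteDimensional k A] (x y : A) (hy : y ≠ 0) : ∃ z : A, x = z * y := by
  obtain ⟨z, hz⟩ := (LinearMap.injective_iff_surjective
    (f := LinearMap.mulRight k y)).1 (mul_left_injective₀ hy) x
  exact ⟨z, hz.symm⟩

variable {K : Type*} [Field K] [ValuativeRel K] [TopologicalSpace K]
  [IsNonarchimedeanLocalField K]

theorem coeff_int {F : Type*} [Field F] [Algebra K F] [FiniteDimensional K F] (y : F)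
    (h : valuation K ((minpoly K y).coeff 0) ≤ 1) (i : ℕ) :
    valuation K ((minpoly K y).coeff i) ≤ 1 := by
  let := IsTopologicalAddGroup.rightUniformSpace K
  have := isUniformAddGroup_of_addCommGroup (G := K)
  let : (Valued.v (R := K)).RankOne :=
  { hom' := IsRankLeOne.nonempty.some.emb (R := K).comp MonoidWithZeroHom.ValueGroup₀.embedding
    strictMono' := IsRankLeOne.nonempty.some.strictMono.comp
        MonoidWithZeroHom.ValueGroup₀.embedding_strictMono }
  open scoped Valued in
  have key : ∀ a : K, ‖a‖ ≤ 1 ↔ valuation K a ≤ 1 := fun a =>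
    Valued.toNormedField.norm_le_one_iff
  rw [← key] at h ⊢
  have hm := minpoly.monic (Algebra.IsIntegral.isIntegral (R := K) y)
  refine (spectralValue_le_one_iff hm).1 ?_ i
  change spectralNorm K F y ≤ 1
  rw [spectralNorm.spectralNorm_eq_norm_coeff_zero_rpow]
  exact Real.rpow_le_one (norm_nonneg _) h (by positivity)

theorem isIntegral_field_iff {F : Type*} [Field F] [Algebra K F] [FiniteDimensional K F] (y : F) :
    IsIntegral 𝒪[K] y ↔ valuation K ((minpoly K y).coeff 0) ≤ 1 := by
  constructor
  · intro h
    rw [minpoly.isIntegrallyClosed_eq_field_fractions' K h, coeff_map]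
    exact ((minpoly 𝒪[K] y).coeff 0).2
  · intro h
    have hm := minpoly.monic (Algebra.IsIntegral.isIntegral (R := K) y)
    have hl : minpoly K y ∈ Polynomial.lifts (algebraMap 𝒪[K] K) := by
      rw [Polynomial.lifts_iff_coeff_lifts]
      exact fun i => ⟨⟨_, coeff_int y h i⟩, rfl⟩
    obtain ⟨p, hp, -, hpm⟩ := Polynomial.lifts_and_natDegree_eq_and_monic hl hm
    refine ⟨p, hpm, ?_⟩
    rw [IsScalarTower.algebraMap_eq 𝒪[K] K F, ← Polynomial.eval₂_map, hp]
    exact minpoly.aeval K y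

theorem isIntegral_iff_norm_aux {D F : Type*} [Ring D] [IsDomain D] [Algebra K D]
    [FiniteDimensional K D] [Field F] [Algebra K F] (φ : F →ₐ[K] D) (pb : PowerBasis K F) :
    IsIntegral 𝒪[K] (φ pb.gen) ↔ valuation K (Algebra.norm K (φ pb.gen)) ≤ 1 := by
  have : FiniteDimensional K F := pb.finite
  have hinj : Function.Injective φ := φ.toRingHom.injective
  have h1 : IsIntegral 𝒪[K] (φ pb.gen) ↔ IsIntegral 𝒪[K] pb.gen :=
    isIntegral_algHom_iff (φ.restrictScalars 𝒪[K]) hinj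
  rw [h1, isIntegral_field_iff]
  let : Module F D := Module.compHom D φ.toRingHom
  have hsm (a : F) (d : D) : a • d = φ a * d := rfl
  have : IsScalarTower K F D := ⟨fun a b c => by simp [hsm]⟩
  have : FiniteDimensional F D := FiniteDimensional.right K F D
  have h2 : Algebra.norm K (φ pb.gen) = Algebra.norm K pb.gen ^ Module.finrank F D := by
    have h := LinearMap.det_restrictScalars (R := K) (f := pb.gen • (LinearMap.id : D →ₗ[F] D))
    rw [LinearMap.det_smul, LinearMap.det_id, mul_one, map_pow] at h
    rw [← h, Algebra.norm_apply]
    congr 1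
  rw [h2, Algebra.PowerBasis.norm_gen_eq_coeff_zero_minpoly, map_pow, map_mul, map_pow,
    Valuation.map_neg, map_one, one_pow, one_mul, pow_le_one_iff Module.finrank_pos.ne']

/-- Integrality over `𝒪[K]` in a finite-dimensional division algebra is detected by the norm. -/
theorem isIntegral_iff_norm {D : Type*} [Ring D] [IsDomain D] [Algebra K D]
    [FiniteDimensional K D] (x : D) :
    IsIntegral 𝒪[K] x ↔ valuation K (Algebra.norm K x) ≤ 1 := by
  have hirr : Irreducible (minpoly K x) :=
    minpoly.irreducible (Algebra.IsIntegral.isIntegral (R := K) x)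
  have : Fact (Irreducible (minpoly K x)) := ⟨hirr⟩
  let φ : AdjoinRoot (minpoly K x) →ₐ[K] D :=
    Ideal.Quotient.liftₐ (Ideal.span {minpoly K x}) (aeval x) (by
      intro a ha
      obtain ⟨b, rfl⟩ := Ideal.mem_span_singleton'.1 ha
      simp)
  have hφ : φ (AdjoinRoot.powerBasis hirr.ne_zero).gen = x := aeval_X x
  have h := isIntegral_iff_norm_aux φ (AdjoinRoot.powerBasis hirr.ne_zero)
  rwa [hφ] at h

variable {D : Type*} [Ring D] [IsDomain D] [Algebra K D] [FiniteDimensional K D]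

theorem isIntegral_mul {x y : D} (hx : IsIntegral 𝒪[K] x) (hy : IsIntegral 𝒪[K] y) :
    IsIntegral 𝒪[K] (x * y) := by
  rw [isIntegral_iff_norm] at *
  rw [map_mul, map_mul]
  exact mul_le_one' hx hy

theorem exists_integral_mul_eq {x y : D} (hy0 : y ≠ 0)
    (h : valuation K (Algebra.norm K x) ≤ valuation K (Algebra.norm K y)) :
    ∃ z : D, IsIntegral 𝒪[K] z ∧ x = z * y := by
  obtain ⟨z, rfl⟩ := exists_mul_eq K x y hy0
  refine ⟨z, ?_, rfl⟩
  have hn : 0 < valuation K (Algebra.norm K y) := by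
    rw [Valuation.pos_iff]
    exact Algebra.norm_ne_zero_iff.2 hy0
  rw [isIntegral_iff_norm]
  rw [map_mul, map_mul] at h
  exact le_of_mul_le_mul_right (by simpa using h) hn

theorem isIntegral_add {x y : D} (hx : IsIntegral 𝒪[K] x) (hy : IsIntegral 𝒪[K] y) :
    IsIntegral 𝒪[K] (x + y) := by
  wlog h : valuation K (Algebra.norm K x) ≤ valuation K (Algebra.norm K y) generalizing x y
  · rw [add_comm]
    exact this hy hx (le_of_not_ge h)
  by_cases hy0 : y = 0
  · simpa [hy0] using hx
  obtain ⟨z, hz, rfl⟩ := exists_integral_mul_eq hy0 h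
  have : z * y + y = (1 + z) * y := by rw [add_mul, one_mul, add_comm]
  rw [this]
  exact isIntegral_mul (isIntegral_one_add hz) hy

theorem norm_add_lt {x y : D} (hx : valuation K (Algebra.norm K x) < 1)
    (hy : valuation K (Algebra.norm K y) < 1) : valuation K (Algebra.norm K (x + y)) < 1 := by
  wlog h : valuation K (Algebra.norm K x) ≤ valuation K (Algebra.norm K y) generalizing x y
  · rw [add_comm]
    exact this hy hx (le_of_not_ge h)
  by_cases hy0 : y = 0
  · simpa [hy0] using hx
  obtain ⟨z, hz, rfl⟩ := exists_integral_mul_eq hy0 h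
  have : z * y + y = (1 + z) * y := by rw [add_mul, one_mul, add_comm]
  rw [this, map_mul, map_mul]
  exact (mul_le_of_le_one_left' ((isIntegral_iff_norm _).1 (isIntegral_one_add hz))).trans_lt hy

variable (K D)

/-- The ring of integers `𝒪_D`: the elements of `D` that are integral over `𝒪[K]`. -/
def integers : Subalgebra 𝒪[K] D where
  carrier := {x | IsIntegral 𝒪[K] x}
  mul_mem' := isIntegral_mul
  add_mem' := isIntegral_add
  algebraMap_mem' _ := isIntegral_algebraMap

variable {K D}

theorem isUnit_integers_iff (x : integers K D) :
    IsUnit x ↔ ¬ valuation K (Algebra.norm K (x : D)) < 1 := by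
  have hle (y : integers K D) := (isIntegral_iff_norm (y : D)).1 y.2
  constructor
  · rintro ⟨u, rfl⟩ h
    have h1 : ((u : integers K D) : D) * ((u⁻¹ : (integers K D)ˣ) : integers K D) = 1 := by
      rw [← MulMemClass.coe_mul, u.mul_inv]
      rfl
    have h2 := mul_lt_one_of_lt_of_le h (hle ((u⁻¹ : (integers K D)ˣ) : integers K D))
    rw [← map_mul, ← map_mul, h1] at h2
    simp at h2
  · intro h
    have hx0 : (x : D) ≠ 0 := by
      intro h0
      simp [h0] at h
    obtain ⟨z, hz, hzx⟩ := exists_integral_mul_eq (K := K) (x := 1) hx0 (by simpa using h)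
    have hxz : (x : D) * z = 1 := by
      apply mul_right_cancel₀ hx0
      rw [mul_assoc, ← hzx, mul_one, one_mul]
    exact ⟨⟨x, ⟨z, hz⟩, Subtype.ext hxz, Subtype.ext hzx.symm⟩, rfl⟩

variable (K D)

/-- The maximal ideal `𝔪_D` of `𝒪_D`: the non-units. -/
def maxIdeal : Ideal (integers K D) where
  carrier := {x | ¬ IsUnit x}
  zero_mem' := not_isUnit_zero
  add_mem' {x y} hx hy := by
    simp only [Set.mem_ofPred_eq, isUnit_integers_iff, not_not] at *
    exact norm_add_lt hx hy
  smul_mem' a x hx := by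
    simp only [Set.mem_ofPred_eq, isUnit_integers_iff, not_not, smul_eq_mul,
      MulMemClass.coe_mul, map_mul] at *
    exact (mul_le_of_le_one_left' ((isIntegral_iff_norm _).1 a.2)).trans_lt hx

theorem residue_torsion :
    Module.IsTorsionBySet 𝒪[K] (integers K D ⧸ maxIdeal K D) (𝓂[K] : Set 𝒪[K]) := by
  rintro x ⟨a, ha⟩
  obtain ⟨x, rfl⟩ := Submodule.Quotient.mk_surjective _ x
  rw [← Submodule.Quotient.mk_smul, Submodule.Quotient.mk_eq_zero]
  change ¬ IsUnit (a • x)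
  have ha' : valuation K (a : K) < 1 := by
    refine lt_of_le_of_ne a.2 fun h => ?_
    have ha0 : (a : K) ≠ 0 := fun h0 => by simp [h0] at h
    exact (IsLocalRing.mem_maximalIdeal a).1 ha (Valuation.Integers.isUnit_of_one
      (Valuation.integer.integers _) ha0.isUnit h)
  rw [isUnit_integers_iff, not_not]
  have : ((a • x : integers K D) : D) = algebraMap K D a * x := by
    rw [← Algebra.smul_def]; rfl
  rw [this, map_mul, map_mul, Algebra.norm_algebraMap, map_pow]
  exact mul_lt_one_of_lt_of_le (pow_lt_one₀ zero_le ha' Module.finrank_pos.ne')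
    ((isIntegral_iff_norm _).1 x.2)

/-- The residual degree `f(D/K)`: the dimension of `𝒪_D / 𝔪_D` over the residue field of `K`. -/
noncomputable def residualDegree : ℕ :=
  @Module.finrank 𝓀[K] (integers K D ⧸ maxIdeal K D) _ _
    (residue_torsion K D).module

/-- `x ↦ |N_{D/K}(x)|`, which is the `[D : K]`-th power of the absolute value of `D`
that extends the one of `K`. -/
noncomputable def absNorm : Dˣ →* (ValueGroupWithZero K)ˣ :=
  Units.map ((valuation K : K →* ValueGroupWithZero K).comp (Algebra.norm K))

/-- The ramification index `e(D/K)`: the index of the value group of `K` in that of `D`. -/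
noncomputable def ramificationIndex : ℕ :=
  ((Units.map (algebraMap K D : K →* D)).range.map (absNorm K D)).relIndex (absNorm K D).range

end Integers

/-! ### The Bruhat–Tits tree and branches -/

section Tree

variable (K : Type*) [Field K] [ValuativeRel K] [TopologicalSpace K]
  [IsNonarchimedeanLocalField K]

/-- Full `𝒪[K]`-orders in a `K`-algebra. -/
def IsOrder {A : Type*} [Ring A] [Algebra K A] (Λ : Subalgebra 𝒪[K] A) : Prop :=
  (Subalgebra.toSubmodule Λ).FG ∧ Submodule.span K (Λ : Set A) = ⊤

variable (D : Type*) [Ring D] [IsDomain D] [Algebra K D] [FiniteDimensional K D]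

/-- The maximal orders of `M₂(D)`. -/
abbrev MaximalOrder : Type _ :=
  {Λ : Subalgebra 𝒪[K] (Matrix (Fin 2) (Fin 2) D) // Maximal (IsOrder K) Λ}

variable {K D}

/-- `𝒪_D`-lattices in the column space `D²`, on which scalars act from the right. -/
def IsLattice (M : Submodule 𝒪[K] (Fin 2 → D)) : Prop :=
  M.FG ∧ Submodule.span K (M : Set (Fin 2 → D)) = ⊤ ∧
    ∀ v ∈ M, ∀ a : integers K D, (fun i => v i * (a : D)) ∈ M

/-- `Λ` is the endomorphism ring of the lattice `M`. -/
def IsEndRing (Λ : MaximalOrder K D) (M : Submodule 𝒪[K] (Fin 2 → D)) : Prop :=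
  ∀ A : Matrix (Fin 2) (Fin 2) D, A ∈ Λ.1 ↔ ∀ v ∈ M, A.mulVec v ∈ M

variable (K D)

/-- The Bruhat–Tits tree `𝔗(D)`: distinct maximal orders are neighbours if they are the
endomorphism rings of lattices `M`, `M'` with `M 𝔪_D ⊆ M' ⊆ M`. -/
def tree : SimpleGraph (MaximalOrder K D) :=
  SimpleGraph.fromRel fun Λ Λ' =>
    ∃ M M' : Submodule 𝒪[K] (Fin 2 → D), IsLattice M ∧ IsLattice M' ∧
      IsEndRing Λ M ∧ IsEndRing Λ' M' ∧ M' ≤ M ∧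
      ∀ v ∈ M, ∀ a ∈ maxIdeal K D, (fun i => v i * (a : D)) ∈ M'

/-- The branch `𝔖(H)`: the full subgraph of the tree on the maximal orders containing `H`. -/
def branch (H : Set (Matrix (Fin 2) (Fin 2) D)) :
    SimpleGraph {Λ : MaximalOrder K D | H ⊆ (Λ.1 : Set (Matrix (Fin 2) (Fin 2) D))} :=
  (tree K D).induce _

variable {D}

/-- The ring of integers `𝒪_L` of a subalgebra `L ⊆ D`, as scalar matrices in `M₂(D)`. -/
def scalarIntegers (L : Subalgebra K D) : Set (Matrix (Fin 2) (Fin 2) D) :=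
  {A | ∃ x ∈ integers K L, A = Matrix.scalar (Fin 2) (x : D)}

end Tree

/-! ### Subdivisions, roses and gluing -/

section Graphs

variable {V : Type*} (G : SimpleGraph V)

/-- Nodes: vertices of valency at least three. -/
def nodes : Set V := {v | 3 ≤ (G.neighborSet v).encard}

/-- The new vertices of the `n`-th subdivision: pairs `(a, k)` of an oriented edge `a` and
`0 < k < n`, where `(a, k)` and `(a⁻¹, n - k)` are identified. -/
abbrev InnerVertex (n : ℕ) : Type _ :=
  Quot fun p r : G.Dart × {k : ℕ // 0 < k ∧ k < n} =>
    r.1 = p.1.symm ∧ (p.2 : ℕ) + (r.2 : ℕ) = n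

/-- The `k`-th point, `0 ≤ k ≤ n`, on the oriented edge `a` cut into `n` pieces. -/
def edgePoint (n : ℕ) (a : G.Dart) (k : ℕ) : V ⊕ InnerVertex G n :=
  if h : 0 < k ∧ k < n then .inr (Quot.mk _ (a, ⟨k, h⟩))
  else if k = 0 then .inl a.fst else .inl a.snd

/-- The `n`-th subdivision `G/n` (for `n ≥ 1`). -/
def subdivision (n : ℕ) : SimpleGraph (V ⊕ InnerVertex G n) :=
  SimpleGraph.fromRel fun x y =>
    ∃ (a : G.Dart) (k : ℕ), k < n ∧ x = edgePoint G n a k ∧ y = edgePoint G n a (k + 1)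

/-- `(t, r)`-roses with center `c`. -/
structure IsRose {Z : Type*} (R : SimpleGraph Z) (c : Z) (t r : ℕ) : Prop where
  isTree : R.IsTree
  valency : (R.neighborSet c).encard = t
  length_le : ∀ (z : Z) (p : R.Walk c z), p.IsPath → p.length ≤ r

open Classical in
/-- The vertex `z` in the copy of `Z` that is attached to `v ∈ N` by its center `c`. -/
noncomputable def rosePoint {Z : Type*} (c : Z) {N : Set V} (v : N) (z : Z) :
    V ⊕ N × {z : Z // z ≠ c} :=
  if h : z = c then .inl v else .inr (v, ⟨z, h⟩)

/-- The graph obtained from `G` by attaching a copy of `R` to every vertex in `N`, its center `c`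
being identified with that vertex. -/
def attach (N : Set V) {Z : Type*} (R : SimpleGraph Z) (c : Z) :
    SimpleGraph (V ⊕ N × {z : Z // z ≠ c}) :=
  SimpleGraph.fromRel fun x y =>
    (∃ u w : V, G.Adj u w ∧ x = .inl u ∧ y = .inl w) ∨
    ∃ (v : N) (z z' : Z), R.Adj z z' ∧ x = rosePoint c v z ∧ y = rosePoint c v z'

end Graphs

end BranchTree

universe u v

/-! A vertex of the tree of `B` is a lattice `g 𝒪²` up to homothety. Up to exchanging the
coordinates it is given by a matrix `low b r`, with `b` integral and relevant only modulo order `r`.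
Conjugating a scalar matrix by `low b r` shows that this vertex lies in the branch of `𝒪_L` exactly
when all commutators of `b` with `𝒪_L` have order at least `r` (`vertex_low_mem_iff`). So the
theorem is about how well an element that nearly commutes with `𝒪_L` is approximated by the
centralizer `C`.

The arithmetic is as follows. The residue field `k` of `B` has degree `n` over `𝔽_q`, and
conjugation by a uniformizer induces an automorphism `σ` of `k` of order `n` (`orderOf_conj_eq`). A
uniformizer of `L` has order `e' = n/e` in `B` and commutes with `C`, so `σ ^ e'` fixes the residue
field of `C` and `f(C/K) ≤ e'`. By symmetry `f(L/K) ≤ e(B/C)`. The inequality `[B : K] ≤ [C : K] [L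
: K]` turns both into equalities (`residualDegree_centralizer`).

Since `e(B/C) = f`, an edge of the tree of `C` becomes a path of length `f` in the tree of `B`, and
`𝔗(C)/f` embeds in the branch (`branchEmbedding`). Three facts describe what hangs off it. (1) At an
old vertex all `q ^ n + 1` neighbours lie in the branch, because `k` is commutative, and `q ^ e' +
1` of them lie on `𝔗(C)/f`. This leaves `q ^ n - q ^ e'` others (`encard_neighborSet_center`). (2)
At a new vertex nothing hangs, because `πⁱ` with `0 < i < f` acts nontrivially on the residue field
of `L` (`mem_range_of_adj_inner`). (3) Successive approximation finds an element of `C` that agrees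
with `b` up to order `r - e'`, so the branch stays within distance `e'` of `𝔗(C)/f`
(`exists_near_centralizer`, `exists_walk_branch`).

The group `GL₂(C)` preserves the branch and `𝔗(C)/f` and is transitive on old vertices, which are
exactly the nodes. Hence all hanging trees are copies of one rose, and `nonempty_iso_attach` glues
them. -/

namespace BranchTree

/-! ### Independence over centralizers and dimension bounds -/

section Centralizers

/-- The shortest-relation argument of Dedekind and Artin. Normalize a relation so that one
coefficient is `1`. Multiplying it by `l'` on the left and subtracting its instance at `l' * l`
gives a shorter relation with coefficients `l' * b i - b i * l'`. These vanish by induction, so the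
`b i` centralize `H`, and the case `l = 1` contradicts independence of the `x i` over the
centralizer. -/
theorem eq_zero_of_forall_sum_mul_mul_eq_zero {B ι : Type*} [DivisionRing B] (H : Submonoid B)
    (x : ι → B) (s : Finset ι)
    (hx : ∀ b : ι → B, (∀ i ∈ s, ∀ l ∈ H, l * b i = b i * l) → ∑ i ∈ s, b i * x i = 0 →
      ∀ i ∈ s, b i = 0)
    (b : ι → B) (hb : ∀ l ∈ H, ∑ i ∈ s, b i * l * x i = 0) : ∀ i ∈ s, b i = 0 := by
  classical
  induction s using Finset.induction_on generalizing b with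
  | empty => simp
  | insert j t hj ih =>
    have hx' : ∀ b : ι → B, (∀ i ∈ t, ∀ l ∈ H, l * b i = b i * l) → ∑ i ∈ t, b i * x i = 0 →
        ∀ i ∈ t, b i = 0 := by
      intro b hb h0 i hi
      have hne : ∀ i ∈ t, i ≠ j := fun i hi h => hj (h ▸ hi)
      have := hx (Function.update b j 0) (fun i hi l hl => ?_) ?_ i (Finset.mem_insert_of_mem hi)
      · rwa [Function.update_of_ne (hne i hi)] at this
      · rcases Finset.mem_insert.1 hi with rfl | hi
        · simp
        · rw [Function.update_of_ne (hne i hi)]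
          exact hb i hi l hl
      · rw [Finset.sum_insert hj, Function.update_self, zero_mul, zero_add, ← h0]
        exact Finset.sum_congr rfl fun i hi => by rw [Function.update_of_ne (hne i hi)]
    by_cases hbj : b j = 0
    · have := ih hx' b fun l hl => by
        have := hb l hl
        rwa [Finset.sum_insert hj, hbj, zero_mul, zero_mul, zero_add] at this
      intro i hi
      rcases Finset.mem_insert.1 hi with rfl | hi
      · exact hbj
      · exact this i hi
    · exfalso
      set b' : ι → B := fun i => (b j)⁻¹ * b i with hb'
      have hj1 : b' j = 1 := inv_mul_cancel₀ hbj
      have hrel : ∀ l ∈ H, ∑ i ∈ insert j t, b' i * l * x i = 0 := by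
        intro l hl
        have := congrArg ((b j)⁻¹ * ·) (hb l hl)
        simpa [Finset.mul_sum, hb', mul_assoc] using this
      have hcomm : ∀ i ∈ insert j t, ∀ l ∈ H, l * b' i = b' i * l := by
        intro i hi l' hl'
        rcases Finset.mem_insert.1 hi with rfl | hi
        · rw [hj1, mul_one, one_mul]
        · have := ih hx' (fun i => l' * b' i - b' i * l') (fun l hl => ?_) i hi
          · exact sub_eq_zero.1 this
          · have h1 := congrArg (l' * ·) (hrel l hl)
            have h2 := hrel (l' * l) (H.mul_mem hl' hl)
            simp only [Finset.mul_sum, mul_zero] at h1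
            have h3 := congrArg₂ (· - ·) h1 h2
            simp only [← Finset.sum_sub_distrib, sub_zero] at h3
            rw [Finset.sum_insert hj, hj1] at h3
            simp only [one_mul, ← mul_assoc, sub_self, zero_add] at h3
            rw [← h3]
            exact Finset.sum_congr rfl fun i _ => by simp only [sub_mul, mul_assoc]
      have := hx b' hcomm (by simpa using hrel 1 H.one_mem) j (Finset.mem_insert_self _ _)
      rw [hj1] at this
      exact one_ne_zero this

variable {K B : Type*} [Field K] [DivisionRing B] [Algebra K B] [FiniteDimensional K B]

/-- A subalgebra and its centralizer cannot both be small. -/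
theorem finrank_le_finrank_mul_finrank_centralizer {L C : Type*} [Ring L] [Algebra K L]
    [FiniteDimensional K L] [DivisionRing C] [Algebra K C] [FiniteDimensional K C]
    (ψ : L →ₐ[K] B) (φ : C →ₐ[K] B)
    (hC : ∀ b : B, (∀ l, ψ l * b = b * ψ l) → ∃ c, φ c = b) :
    Module.finrank K B ≤ Module.finrank K C * Module.finrank K L := by
  let : Module C B := Module.compHom B φ.toRingHom
  have hsm (a : C) (d : B) : a • d = φ a * d := rfl
  have : IsScalarTower K C B := ⟨fun a b c => by simp [hsm]⟩
  have : FiniteDimensional C B := FiniteDimensional.right K C B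
  rw [← Module.finrank_mul_finrank K C B]
  refine Nat.mul_le_mul_left _ ?_
  let x := Module.finBasis C B
  let l := Module.finBasis K L
  -- Injectivity of this left `B`-linear map is the independence of a `C`-basis of `B` tested on a
  -- `K`-basis of `L`. It gives `[B : C] ≤ [L : K]`.
  let T : (Fin (Module.finrank C B) → B) →ₗ[B] (Fin (Module.finrank K L) → B) :=
    { toFun := fun b j => ∑ i, b i * ψ (l j) * x i
      map_add' := fun b b' => by ext j; simp [add_mul, Finset.sum_add_distrib]
      map_smul' := fun a b => by ext j; simp [Finset.mul_sum, mul_assoc] }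
  have hT : Function.Injective T := by
    rw [injective_iff_map_eq_zero]
    intro b hb
    have h0 (l' : L) : ∑ i, b i * ψ l' * x i = 0 := by
      rw [← l.sum_repr l']
      simp only [map_sum, map_smul, Finset.mul_sum, Finset.sum_mul]
      rw [Finset.sum_comm]
      refine Finset.sum_eq_zero fun j _ => ?_
      have := congrArg (l.repr l' j • ·) (congrFun hb j)
      simpa [T, Finset.smul_sum] using this
    have := eq_zero_of_forall_sum_mul_mul_eq_zero (MonoidHom.mrange (ψ : L →* B)) x Finset.univ
      (fun b hb h0 i _ => ?_) b (by rintro _ ⟨l', rfl⟩; exact h0 l')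
    · ext i
      exact this i (Finset.mem_univ i)
    · choose c hc using fun i => hC (b i) fun l => hb i (Finset.mem_univ i) _ ⟨l, rfl⟩
      have := Fintype.linearIndependent_iff.1 x.linearIndependent c
        (by simpa [hsm, hc] using h0) i
      rw [← hc, this, map_zero]
  simpa using card_le_of_injective B T hT

/-- Commutative subalgebras of an `n²`-dimensional central division algebra have dimension at
most `n`. -/
theorem finrank_sq_le_of_comm [Algebra.IsCentral K B] {E : Type*} [Field E] [Algebra K E]
    [FiniteDimensional K E] (χ : E →ₐ[K] B) :
    Module.finrank K E ^ 2 ≤ Module.finrank K B := by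
  -- `E` acts from the right, so that the map `T` below can be linear over `B` acting from the left.
  let : Module E B :=
    { smul := fun a b => b * χ a
      one_smul := fun b => by change b * χ 1 = b; simp
      mul_smul := fun a a' b => by
        change b * χ (a * a') = b * χ a' * χ a
        rw [mul_comm a a', map_mul, mul_assoc]
      smul_zero := fun a => zero_mul _
      smul_add := fun a b b' => add_mul _ _ _
      add_smul := fun a a' b => by
        change b * χ (a + a') = b * χ a + b * χ a'
        rw [map_add, mul_add]
      zero_smul := fun b => by change b * χ 0 = 0; simp }
  have hsm (a : E) (d : B) : a • d = d * χ a := rfl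
  have : IsScalarTower K E B := ⟨fun a b c => by simp [hsm]⟩
  have : FiniteDimensional E B := FiniteDimensional.right K E B
  rw [← Module.finrank_mul_finrank K E B, sq]
  refine Nat.mul_le_mul_left _ ?_
  let x := Module.finBasis E B
  let l := Module.finBasis K E
  let T : (Fin (Module.finrank K E) → B) →ₗ[B] (Fin (Module.finrank E B) → B) :=
    { toFun := fun b j => ∑ i, b i * x j * χ (l i)
      map_add' := fun b b' => by ext j; simp [add_mul, Finset.sum_add_distrib]
      map_smul' := fun a b => by ext j; simp [Finset.mul_sum, mul_assoc] }
  have hT : Function.Injective T := by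
    rw [injective_iff_map_eq_zero]
    intro b hb
    have h0 (y : B) : ∑ i, b i * y * χ (l i) = 0 := by
      rw [← x.sum_repr y]
      simp only [Finset.mul_sum, Finset.sum_mul, hsm]
      rw [Finset.sum_comm]
      refine Finset.sum_eq_zero fun j _ => ?_
      have := congrArg (· * χ (x.repr y j)) (congrFun hb j)
      simp only [T, LinearMap.coe_mk, AddHom.coe_mk, Finset.sum_mul, Pi.zero_apply,
        zero_mul] at this
      rw [← this]
      refine Finset.sum_congr rfl fun i _ => ?_
      simp only [mul_assoc, ← map_mul, mul_comm]
    -- The submonoid is all of `B`, whose centralizer is the centre `K`, and the `χ (l i)` are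
    -- independent over `K`.
    have := eq_zero_of_forall_sum_mul_mul_eq_zero ⊤ (fun i => χ (l i)) Finset.univ
      (fun b hb h0 i _ => ?_) b (fun y _ => h0 y)
    · ext i
      exact this i (Finset.mem_univ i)
    · have hcen (i) : ∃ a : K, algebraMap K B a = b i := by
        have : b i ∈ Subalgebra.center K B :=
          Subalgebra.mem_center_iff.2 fun y => hb i (Finset.mem_univ i) y trivial
        rw [Algebra.IsCentral.center_eq_bot] at this
        exact Algebra.mem_bot.1 this
      choose c hc using hcen
      have h1 : χ (∑ i, c i • l i) = 0 := by
        simpa [Algebra.smul_def, hc] using h0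
      have := Fintype.linearIndependent_iff.1 l.linearIndependent c
        ((map_eq_zero χ).1 h1) i
      rw [← hc, this, map_zero]
  simpa using card_le_of_injective B T hT

end Centralizers

/-! ### Acyclic graphs, subdivisions and gluing -/

section GraphLemmas

variable {V W : Type*}

/-- A graph is acyclic if, for some height function, every vertex has at most one neighbour that
is not higher. -/
theorem isAcyclic_of_height {G : SimpleGraph V} (d : V → ℕ)
    (h : ∀ v w w', G.Adj v w → G.Adj v w' → d w ≤ d v → d w' ≤ d v → w = w') :
    G.IsAcyclic := by
  classical
  intro u c hc
  obtain ⟨v, hv, hmax⟩ := Finset.exists_max_image c.support.toFinset d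
    ⟨u, by simp⟩
  have hv' : v ∈ c.support := by simpa using hv
  have hc' := hc.rotate hv'
  have hle (w) (hw : w ∈ (c.rotate v hv').support) : d w ≤ d v := by
    have : w ∈ c.support := by
      rwa [SimpleGraph.Walk.mem_support_rotate_iff] at hw
    exact hmax w (by simpa using this)
  refine hc'.snd_ne_penultimate (h v _ _ ((c.rotate v hv').adj_snd hc'.not_nil)
    ((c.rotate v hv').adj_penultimate hc'.not_nil).symm (hle _ ?_) (hle _ ?_))
  · exact SimpleGraph.Walk.getVert_mem_support _ _
  · exact SimpleGraph.Walk.getVert_mem_support _ _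

/-- An injective homomorphism from a connected graph to an acyclic one is an embedding. -/
theorem adj_of_adj_map {G : SimpleGraph W} {S : SimpleGraph V} (hS : S.IsAcyclic)
    (hG : G.Preconnected) (ι : G →g S) (hι : Function.Injective ι) {x y : W}
    (h : S.Adj (ι x) (ι y)) : G.Adj x y := by
  classical
  obtain ⟨p, hp⟩ := (hG x y).exists_isPath
  -- The image of a path of `G` is the unique path between two adjacent vertices, which is a single
  -- edge.
  have := (hS.subsingleton_path _ _).elim ⟨p.map ι, hp.map hι⟩ (SimpleGraph.Path.singleton h)
  have h1 : (p.map ι).length = 1 := by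
    have := congrArg (fun q : S.Path _ _ => q.1.length) this
    simpa using this
  exact SimpleGraph.Walk.adj_of_length_eq_one (by simpa using h1)

/-! ### Points and edges of a subdivision -/

section Subdivision

variable (G : SimpleGraph V) {n : ℕ}

theorem edgePoint_zero (a : G.Dart) : edgePoint G n a 0 = .inl a.fst := by
  simp [edgePoint]

theorem edgePoint_self (hn : 0 < n) (a : G.Dart) : edgePoint G n a n = .inl a.snd := by
  simp [edgePoint, hn.ne']

theorem edgePoint_of_lt (a : G.Dart) {k : ℕ} (h : 0 < k ∧ k < n) :
    edgePoint G n a k = .inr (Quot.mk _ (a, ⟨k, h⟩)) := by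
  simp [edgePoint, h]

theorem edgePoint_symm (hn : 0 < n) (a : G.Dart) {k : ℕ} (hk : k ≤ n) :
    edgePoint G n a.symm k = edgePoint G n a (n - k) := by
  rcases Nat.eq_zero_or_pos k with rfl | h0
  · rw [edgePoint_zero G, Nat.sub_zero, edgePoint_self G hn]; rfl
  rcases hk.eq_or_lt with rfl | h1
  · rw [Nat.sub_self, edgePoint_zero G, edgePoint_self G hn]; rfl
  rw [edgePoint_of_lt G _ ⟨h0, h1⟩, edgePoint_of_lt G _ (k := n - k) ⟨by omega, by omega⟩]
  refine congrArg _ (Quot.sound ⟨?_, ?_⟩)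
  · exact (SimpleGraph.Dart.symm_symm a).symm
  · simp; omega

/-- The relation that is divided out comes from an involution, so its classes have at most two
elements. -/
theorem eq_or_eq_symm_of_quot_mk_eq {p r : G.Dart × {k : ℕ // 0 < k ∧ k < n}}
    (h : (Quot.mk _ p : InnerVertex G n) = Quot.mk _ r) :
    r = p ∨ (r.1 = p.1.symm ∧ (p.2 : ℕ) + (r.2 : ℕ) = n) := by
  rw [Quot.eq] at h
  induction h with
  | rel _ _ h => exact Or.inr h
  | refl => exact Or.inl rfl
  | symm _ _ _ ih =>
    rcases ih with rfl | ⟨h1, h2⟩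
    · exact Or.inl rfl
    · exact Or.inr ⟨by rw [h1, SimpleGraph.Dart.symm_symm], by omega⟩
  | trans p q r _ _ ih1 ih2 =>
    rcases ih1 with rfl | ⟨h1, h2⟩
    · exact ih2
    · rcases ih2 with rfl | ⟨h3, h4⟩
      · exact Or.inr ⟨h1, h2⟩
      · refine Or.inl (Prod.ext ?_ (Subtype.ext ?_))
        · rw [h3, h1, SimpleGraph.Dart.symm_symm]
        · omega

theorem exists_edgePoint_inr (z : InnerVertex G n) :
    ∃ (a : G.Dart) (k : ℕ) (h : 0 < k ∧ k < n), z = Quot.mk _ (a, ⟨k, h⟩) := by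
  obtain ⟨⟨a, k, h⟩, rfl⟩ := Quot.exists_rep z
  exact ⟨a, k, h, rfl⟩

theorem edgePoint_ne_succ (hn : 0 < n) (a : G.Dart) {k : ℕ} (hk : k < n) :
    edgePoint G n a k ≠ edgePoint G n a (k + 1) := by
  rcases Nat.eq_zero_or_pos k with rfl | h0
  · rcases (Nat.succ_le_of_lt hk).eq_or_lt with h1 | h1
    · rw [edgePoint_zero G]
      subst h1
      rw [edgePoint_self G hn]
      simp [a.fst_ne_snd]
    · rw [edgePoint_zero G, edgePoint_of_lt G _ ⟨by omega, h1⟩]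
      simp
  · rw [edgePoint_of_lt G _ ⟨h0, hk⟩]
    rcases (Nat.succ_le_of_lt hk).eq_or_lt with h1 | h1
    · rw [show k + 1 = n from h1, edgePoint_self G hn]
      simp
    · rw [edgePoint_of_lt G _ (k := k + 1) ⟨by omega, h1⟩]
      intro h
      rcases eq_or_eq_symm_of_quot_mk_eq G (Sum.inr_injective h) with h | h
      · have := congrArg (fun p => (p.2 : ℕ)) h
        simp at this
      · exact a.symm_ne h.1.symm

theorem subdivision_adj_edgePoint (hn : 0 < n) (a : G.Dart) {k : ℕ} (hk : k < n) :
    (subdivision G n).Adj (edgePoint G n a k) (edgePoint G n a (k + 1)) :=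
  ⟨edgePoint_ne_succ G hn a hk, Or.inl ⟨a, k, hk, rfl, rfl⟩⟩

theorem subdivision_reachable_edgePoint (hn : 0 < n) (a : G.Dart) {k : ℕ} (hk : k ≤ n) :
    (subdivision G n).Reachable (.inl a.fst) (edgePoint G n a k) := by
  induction k with
  | zero => rw [edgePoint_zero G]
  | succ k ih => exact (ih (by omega)).trans (subdivision_adj_edgePoint G hn a hk).reachable

theorem subdivision_preconnected (hn : 0 < n) (hG : G.Preconnected) :
    (subdivision G n).Preconnected := by
  have h1 (u w : V) : (subdivision G n).Reachable (.inl u) (.inl w) := by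
    obtain ⟨p⟩ := hG u w
    induction p with
    | nil => rfl
    | cons h _ ih =>
      refine SimpleGraph.Reachable.trans ?_ ih
      have := subdivision_reachable_edgePoint G hn ⟨(_, _), h⟩ le_rfl
      rwa [edgePoint_self G hn] at this
  have h2 (x : V ⊕ InnerVertex G n) : ∃ u, (subdivision G n).Reachable (.inl u) x := by
    rcases x with u | z
    · exact ⟨u, .rfl⟩
    · obtain ⟨a, k, h, rfl⟩ := exists_edgePoint_inr G z
      rw [← edgePoint_of_lt]
      exact ⟨_, subdivision_reachable_edgePoint G hn a h.2.le⟩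
  intro x y
  obtain ⟨u, hu⟩ := h2 x
  obtain ⟨w, hw⟩ := h2 y
  exact hu.symm.trans ((h1 u w).trans hw)

theorem exists_edgePoint_of_subdivision_adj (hn : 0 < n) {x y : V ⊕ InnerVertex G n}
    (h : (subdivision G n).Adj x y) :
    ∃ (a : G.Dart) (k : ℕ), k < n ∧ x = edgePoint G n a k ∧ y = edgePoint G n a (k + 1) := by
  rcases h with ⟨-, ⟨a, k, hk, hx, hy⟩ | ⟨a, k, hk, hy, hx⟩⟩
  · exact ⟨a, k, hk, hx, hy⟩
  · refine ⟨a.symm, n - (k + 1), by omega, ?_, ?_⟩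
    · rw [edgePoint_symm G hn a (by omega), hx]
      congr 1; omega
    · rw [edgePoint_symm G hn a (by omega), hy]
      congr 1; omega

theorem exists_edgePoint_one_of_adj_inl (hn : 0 < n) {u : V} {y : V ⊕ InnerVertex G n}
    (h : (subdivision G n).Adj (.inl u) y) :
    ∃ a : G.Dart, a.fst = u ∧ y = edgePoint G n a 1 := by
  obtain ⟨a, k, hk, hx, hy⟩ := exists_edgePoint_of_subdivision_adj G hn h
  rcases Nat.eq_zero_or_pos k with rfl | h0
  · rw [edgePoint_zero G] at hx
    exact ⟨a, (Sum.inl_injective hx).symm, hy⟩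
  · rw [edgePoint_of_lt G a ⟨h0, hk⟩] at hx
    simp at hx

theorem eq_or_eq_of_adj_inner (hn : 0 < n) (a : G.Dart) {k : ℕ} (hk : 0 < k ∧ k < n)
    {y : V ⊕ InnerVertex G n} (h : (subdivision G n).Adj (edgePoint G n a k) y) :
    y = edgePoint G n a (k - 1) ∨ y = edgePoint G n a (k + 1) := by
  obtain ⟨a', k', hk', hx, rfl⟩ := exists_edgePoint_of_subdivision_adj G hn h
  rcases Nat.eq_zero_or_pos k' with rfl | h0
  · rw [edgePoint_zero G, edgePoint_of_lt G a hk] at hx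
    simp at hx
  rw [edgePoint_of_lt G a hk, edgePoint_of_lt G a' ⟨h0, hk'⟩] at hx
  rcases eq_or_eq_symm_of_quot_mk_eq G (Sum.inr_injective hx) with h | ⟨h1, h2⟩
  · obtain ⟨rfl, h⟩ := Prod.mk.inj h
    obtain rfl : k' = k := congrArg Subtype.val (by assumption)
    exact Or.inr rfl
  · dsimp only at h1 h2
    subst h1
    left
    rw [edgePoint_symm G hn a (by omega)]
    congr 1; omega

/-- New vertices of a subdivision are not nodes. -/
theorem inr_notMem_nodes_subdivision (hn : 0 < n) (z : InnerVertex G n) :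
    Sum.inr z ∉ nodes (subdivision G n) := by
  obtain ⟨a, k, h, rfl⟩ := exists_edgePoint_inr G z
  rw [← edgePoint_of_lt]
  intro h3
  have hsub : (subdivision G n).neighborSet (edgePoint G n a k) ⊆
      {edgePoint G n a (k - 1), edgePoint G n a (k + 1)} :=
    fun y hy => eq_or_eq_of_adj_inner G hn a h hy
  have := (h3.trans (Set.encard_le_encard hsub)).trans (Set.encard_insert_le _ _)
  rw [Set.encard_singleton] at this
  exact absurd this (by decide)

end Subdivision

/-! ### Parts hanging off a subtree -/

section Attach

variable (S : SimpleGraph V) (I : Set V)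

/-- The graph `S` without the edges inside `I`. -/
def offGraph : SimpleGraph V where
  Adj u v := S.Adj u v ∧ ¬ (u ∈ I ∧ v ∈ I)
  symm := ⟨fun _ _ h => ⟨h.1.symm, fun h' => h.2 h'.symm⟩⟩
  loopless := ⟨fun _ h => S.loopless.irrefl _ h.1⟩

theorem offGraph_le : offGraph S I ≤ S := fun _ _ h => h.1

/-- The part of `S` that hangs off `I` at `v`. -/
abbrev hangingTree (v : V) : SimpleGraph {u // (offGraph S I).Reachable v u} :=
  (offGraph S I).comap Subtype.val

theorem hangingTree_isTree (hS : S.IsAcyclic) (v : V) : (hangingTree S I v).IsTree := by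
  have hac : (offGraph S I).IsAcyclic := hS.anti (offGraph_le S I)
  have : Nonempty {u // (offGraph S I).Reachable v u} := ⟨⟨v, .rfl⟩⟩
  refine ⟨⟨?_⟩, hac.comap ⟨Subtype.val, fun h => h⟩ Subtype.val_injective⟩
  have key : ∀ (u : V) (p : (offGraph S I).Walk v u),
      (hangingTree S I v).Reachable ⟨v, .rfl⟩ ⟨u, ⟨p⟩⟩ := by
    intro u p
    induction p using SimpleGraph.Walk.concatRec with
    | Hnil => rfl
    | Hconcat p h ih =>
      refine (ih this).trans (SimpleGraph.Adj.reachable ?_)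
      exact h
  rintro ⟨u, ⟨p⟩⟩ ⟨w, ⟨r⟩⟩
  exact (key u p).symm.trans (key w r)

variable {S}

/-- The path of `S` between two points of a subtree stays in the subtree, so its first edge is one
that `offGraph` deletes. Hence a hanging part meets the subtree in its root only. -/
theorem eq_of_offGraph_reachable {G : SimpleGraph W} (hS : S.IsAcyclic)
    (hG : G.Preconnected) (ι : G →g S) {x y : W}
    (h : (offGraph S (Set.range ι)).Reachable (ι x) (ι y)) : ι x = ι y := by
  classical
  by_contra hne
  obtain ⟨p, hp⟩ := h.exists_isPath
  obtain ⟨r⟩ := hG x y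
  have h2 := (hS.subsingleton_path _ _).elim
    ⟨p.mapLe (offGraph_le S _), hp.mapLe _⟩ (r.map ι).toPath
  have hnil : ¬ p.Nil := fun hn => hne hn.eq
  have hadj := p.adj_snd hnil
  refine hadj.2 ⟨⟨x, rfl⟩, ?_⟩
  have h3 : p.snd ∈ (p.mapLe (offGraph_le S _)).support := by
    rw [SimpleGraph.Walk.support_mapLe_eq_support]
    exact p.getVert_mem_support 1
  have h4 : p.snd ∈ (r.map ι).toPath.1.support := by
    rw [← h2]; exact h3
  have h5 := SimpleGraph.Walk.support_toPath_subset_support _ h4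
  rw [SimpleGraph.Walk.support_map] at h5
  obtain ⟨w, -, hw⟩ := List.mem_map.1 h5
  exact ⟨w, hw⟩

theorem exists_offGraph_reachable (hS : S.Preconnected) {i : V} (hi : i ∈ I) (v : V) :
    ∃ u ∈ I, (offGraph S I).Reachable u v := by
  obtain ⟨p⟩ := hS v i
  induction p with
  | nil => exact ⟨_, hi, .rfl⟩
  | @cons v w _ h p ih =>
    obtain ⟨u, hu, huw⟩ := ih hi
    by_cases hvw : v ∈ I ∧ w ∈ I
    · exact ⟨v, hvw.1, .rfl⟩
    · exact ⟨u, hu, huw.trans (SimpleGraph.Adj.reachable ⟨h.symm, fun h => hvw h.symm⟩)⟩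

/-- A tree with a subtree whose hanging parts are permuted transitively by automorphisms is
obtained by attaching one of these parts everywhere. -/
theorem nonempty_iso_attach {G : SimpleGraph W} (hS : S.IsAcyclic) (hSc : S.Preconnected)
    (hG : G.Preconnected) (ι : G →g S) (hι : Function.Injective ι) (N : Set W) (x₀ : W)
    (hout : ∀ x ∉ N, ∀ v, S.Adj (ι x) v → v ∈ Set.range ι)
    (φ : N → S ≃g S) (hφ : ∀ x, φ x (ι x₀) = ι x)
    (hφr : ∀ x v, φ x v ∈ Set.range ι ↔ v ∈ Set.range ι) :
    Nonempty (S ≃g attach G N (hangingTree S (Set.range ι) (ι x₀)) ⟨ι x₀, .rfl⟩) := by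
  classical
  set I := Set.range ι with hI
  set H := offGraph S I with hH
  have hφH (x : N) {u v : V} : H.Adj (φ x u) (φ x v) ↔ H.Adj u v := by
    change S.Adj _ _ ∧ ¬ (φ x u ∈ I ∧ φ x v ∈ I) ↔ S.Adj _ _ ∧ ¬ (u ∈ I ∧ v ∈ I)
    rw [hφr, hφr, (φ x).map_adj_iff]
  let φH (x : N) : H ≃g H := ⟨(φ x).toEquiv, hφH x⟩
  have hreach (x : N) {u v : V} : H.Reachable (φ x u) (φ x v) ↔ H.Reachable u v :=
    SimpleGraph.Iso.reachable_iff (φ := φH x)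
  let c : {u // H.Reachable (ι x₀) u} := ⟨ι x₀, .rfl⟩
  have hzI (z : {u // H.Reachable (ι x₀) u}) (hz : (z : V) ∈ I) : z = c := by
    obtain ⟨w, hw⟩ := hz
    have := z.2
    rw [← hw] at this
    exact Subtype.ext (hw.symm.trans (eq_of_offGraph_reachable hS hG ι this).symm)
  -- The copy attached at `x` is the hanging part at `x₀`, transported by the automorphism `φ x`.
  let Ψ : W ⊕ N × {z : {u // H.Reachable (ι x₀) u} // z ≠ c} → V :=
    Sum.elim ι fun p => φ p.1 (p.2 : {u // H.Reachable (ι x₀) u})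
  have hΨr (x : N) (z) : Ψ (rosePoint c x z) = φ x z := by
    by_cases hz : z = c
    · subst hz
      simp [rosePoint, Ψ, c, hφ]
    · simp [rosePoint, Ψ, hz]
  have hcomp (x : N) (z : {u // H.Reachable (ι x₀) u}) : H.Reachable (ι x) (φ x z) := by
    rw [← hφ, hreach]
    exact z.2
  have hnotI (x : N) (z : {u // H.Reachable (ι x₀) u}) (hz : z ≠ c) : φ x z ∉ I :=
    fun h => hz (hzI z ((hφr x z).1 h))
  have hinj : Function.Injective Ψ := by
    rintro (w | ⟨x, z, hz⟩) (w' | ⟨x', z', hz'⟩) h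
    · exact congrArg _ (hι h)
    · exact absurd ⟨w, h⟩ (hnotI x' z' hz')
    · exact absurd ⟨w', h.symm⟩ (hnotI x z hz)
    · change φ x z = φ x' z' at h
      have h1 := hcomp x z
      rw [h] at h1
      have h2 := hι (eq_of_offGraph_reachable hS hG ι (h1.trans (hcomp x' z').symm))
      obtain rfl := Subtype.ext h2
      have h3 : z = z' := Subtype.ext ((φ x).injective h)
      subst h3
      rfl
  have hsurj : Function.Surjective Ψ := by
    intro v
    obtain ⟨_, ⟨w, rfl⟩, hw⟩ := exists_offGraph_reachable I hSc ⟨x₀, rfl⟩ v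
    by_cases hN : w ∈ N
    · let x : N := ⟨w, hN⟩
      have hz : H.Reachable (ι x₀) ((φ x).symm v) := by
        rw [← hreach x, hφ]
        simpa [x] using hw
      exact ⟨rosePoint c x ⟨_, hz⟩, by rw [hΨr]; simp⟩
    -- Outside `N` the hanging part is a single vertex, by `hout`.
    · obtain ⟨p⟩ := hw
      cases p with
      | nil => exact ⟨.inl w, rfl⟩
      | cons h p => exact absurd ⟨⟨w, rfl⟩, hout w hN _ h.1⟩ h.2
  refine ⟨(RelIso.symm ⟨Equiv.ofBijective Ψ ⟨hinj, hsurj⟩, ?_⟩)⟩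
  intro a b
  change S.Adj (Ψ a) (Ψ b) ↔ (attach G N (hangingTree S I (ι x₀)) c).Adj a b
  -- Every edge at a vertex of a hanging part other than its root remains inside that part.
  have key : ∀ (x : N) (z : {z : {u // H.Reachable (ι x₀) u} // z ≠ c}) b,
      S.Adj (Ψ (.inr (x, z))) (Ψ b) →
      ∃ z', H.Adj (z : {u // H.Reachable (ι x₀) u}) z' ∧ ∃ hz', b = rosePoint c x ⟨z', hz'⟩ := by
    intro x z b h
    have h1 : H.Adj (φ x z) (Ψ b) := ⟨h, fun h' => hnotI x z z.2 h'.1⟩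
    have h2 := (hcomp x z).trans h1.reachable
    have hz' : H.Reachable (ι x₀) ((φ x).symm (Ψ b)) := by
      rw [← hreach x, hφ]
      simpa using h2
    refine ⟨(φ x).symm (Ψ b), ?_, hz', hinj ?_⟩
    · rw [← hφH x]
      simpa using h1
    · rw [hΨr]
      simp
  have hros (x : N) (z : {z : {u // H.Reachable (ι x₀) u} // z ≠ c}) :
      (Sum.inr (x, z) : W ⊕ N × {z : {u // H.Reachable (ι x₀) u} // z ≠ c}) =
        rosePoint c x z := by
    rw [rosePoint, dif_neg z.2]
  constructor
  · intro h
    refine ⟨fun hab => h.ne (congrArg Ψ hab), ?_⟩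
    rcases a with u | ⟨x, z⟩
    · rcases b with w | ⟨x, z⟩
      · exact Or.inl (Or.inl ⟨u, w, adj_of_adj_map hS hG ι hι h, rfl, rfl⟩)
      · obtain ⟨z', h1, hz', h2⟩ := key x z _ h.symm
        exact Or.inl (Or.inr ⟨x, ⟨z', hz'⟩, z, h1.symm, h2, hros x z⟩)
    · obtain ⟨z', h1, hz', h2⟩ := key x z _ h
      exact Or.inl (Or.inr ⟨x, z, ⟨z', hz'⟩, h1, hros x z, h2⟩)
  · have h1 : ∀ a b : W ⊕ N × {z : {u // H.Reachable (ι x₀) u} // z ≠ c},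
        ((∃ u w : W, G.Adj u w ∧ a = .inl u ∧ b = .inl w) ∨
          ∃ (v : N) (z z' : {u // H.Reachable (ι x₀) u}), (hangingTree S I (ι x₀)).Adj z z' ∧
            a = rosePoint c v z ∧ b = rosePoint c v z') → S.Adj (Ψ a) (Ψ b) := by
      rintro a b (⟨u, w, h, rfl, rfl⟩ | ⟨x, z, z', h, rfl, rfl⟩)
      · exact ι.map_adj h
      · rw [hΨr, hΨr, (φ x).map_adj_iff]
        exact h.1
    rintro ⟨-, h | h⟩
    · exact h1 _ _ h
    · exact (h1 _ _ h).symm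

end Attach

end GraphLemmas

/-- A normalized discrete valuation on a division ring; `ord 0` is irrelevant. -/
structure DiscVal (D : Type*) [DivisionRing D] where
  ord : D → ℤ
  ord_mul : ∀ {x y : D}, x ≠ 0 → y ≠ 0 → ord (x * y) = ord x + ord y
  ord_add : ∀ {x y : D}, x ≠ 0 → y ≠ 0 → x + y ≠ 0 → min (ord x) (ord y) ≤ ord (x + y)
  unif : D
  unif_ne_zero : unif ≠ 0
  ord_unif : ord unif = 1

/-! ### Discrete valuations and their filtrations -/

namespace DiscVal

variable {D : Type*} [DivisionRing D] (v : DiscVal D)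

theorem ord_one : v.ord 1 = 0 := by
  have := v.ord_mul (one_ne_zero (α := D)) one_ne_zero
  rw [mul_one] at this
  omega

theorem ord_inv {x : D} (hx : x ≠ 0) : v.ord x⁻¹ = - v.ord x := by
  have := v.ord_mul hx (inv_ne_zero hx)
  rw [mul_inv_cancel₀ hx, v.ord_one] at this
  omega

theorem ord_neg (x : D) : v.ord (-x) = v.ord x := by
  by_cases hx : x = 0
  · rw [hx, neg_zero]
  have h1 : v.ord (-1) = 0 := by
    have h0 : (-1 : D) ≠ 0 := neg_ne_zero.2 one_ne_zero
    have := v.ord_mul h0 h0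
    rw [neg_one_mul, neg_neg, v.ord_one] at this
    omega
  rw [← neg_one_mul, v.ord_mul (neg_ne_zero.2 one_ne_zero) hx, h1, zero_add]

theorem ord_pow {x : D} (hx : x ≠ 0) (k : ℕ) : v.ord (x ^ k) = k * v.ord x := by
  induction k with
  | zero => simp [v.ord_one]
  | succ k ih => rw [pow_succ, v.ord_mul (pow_ne_zero k hx) hx, ih]; push_cast; ring

theorem ord_zpow {x : D} (hx : x ≠ 0) (k : ℤ) : v.ord (x ^ k) = k * v.ord x := by
  obtain ⟨m, rfl | rfl⟩ := k.eq_nat_or_neg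
  · rw [zpow_natCast, v.ord_pow hx]
  · rw [zpow_neg, zpow_natCast, v.ord_inv (pow_ne_zero m hx), v.ord_pow hx]; ring

theorem unif_zpow_ne_zero (k : ℤ) : v.unif ^ k ≠ 0 := zpow_ne_zero k v.unif_ne_zero

theorem ord_unif_zpow (k : ℤ) : v.ord (v.unif ^ k) = k := by
  rw [v.ord_zpow v.unif_ne_zero, v.ord_unif, mul_one]

/-- The elements of order at least `i`. -/
def fil (i : ℤ) : AddSubgroup D where
  carrier := {x | x ≠ 0 → i ≤ v.ord x}
  zero_mem' h := absurd rfl h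
  add_mem' {x y} hx hy hxy := by
    by_cases hx0 : x = 0
    · subst hx0; rw [zero_add] at hxy ⊢; exact hy hxy
    by_cases hy0 : y = 0
    · subst hy0; rw [add_zero] at hxy ⊢; exact hx hxy
    exact (le_min (hx hx0) (hy hy0)).trans (v.ord_add hx0 hy0 hxy)
  neg_mem' {x} hx h := by
    rw [v.ord_neg]; exact hx (neg_ne_zero.1 h)

theorem mem_fil_of_ne {i : ℤ} {x : D} (hx : x ≠ 0) : x ∈ v.fil i ↔ i ≤ v.ord x :=
  ⟨fun h => h hx, fun h _ => h⟩

variable {v} in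
theorem fil_mono {i j : ℤ} (h : i ≤ j) {x : D} (hx : x ∈ v.fil j) : x ∈ v.fil i :=
  fun h0 => h.trans (hx h0)

variable {v} in
theorem mul_mem_fil {i j : ℤ} {x y : D} (hx : x ∈ v.fil i) (hy : y ∈ v.fil j) :
    x * y ∈ v.fil (i + j) := by
  intro h
  have hx0 : x ≠ 0 := left_ne_zero_of_mul h
  have hy0 : y ≠ 0 := right_ne_zero_of_mul h
  rw [v.ord_mul hx0 hy0]
  exact add_le_add (hx hx0) (hy hy0)

variable {v} in
theorem mul_mem_fil' {i j k : ℤ} (h : k ≤ i + j) {x y : D} (hx : x ∈ v.fil i) (hy : y ∈ v.fil j) :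
    x * y ∈ v.fil k := fil_mono h (mul_mem_fil hx hy)

theorem mem_fil_ord (x : D) : x ∈ v.fil (v.ord x) := fun _ => le_rfl

theorem one_mem_fil : (1 : D) ∈ v.fil 0 := fun _ => v.ord_one.ge

theorem one_mem_fil_iff {i : ℤ} : (1 : D) ∈ v.fil i ↔ i ≤ 0 := by
  rw [v.mem_fil_of_ne one_ne_zero, v.ord_one]

theorem unif_zpow_mem (k : ℤ) : v.unif ^ k ∈ v.fil k := fun _ => (v.ord_unif_zpow k).ge

theorem mul_mem_fil_iff_left {i : ℤ} {x y : D} (hx : x ≠ 0) :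
    x * y ∈ v.fil i ↔ y ∈ v.fil (i - v.ord x) := by
  by_cases hy : y = 0
  · subst hy; simp [(v.fil _).zero_mem]
  rw [v.mem_fil_of_ne (mul_ne_zero hx hy), v.mem_fil_of_ne hy, v.ord_mul hx hy]
  omega

theorem mul_mem_fil_iff_right {i : ℤ} {x y : D} (hy : y ≠ 0) :
    x * y ∈ v.fil i ↔ x ∈ v.fil (i - v.ord y) := by
  by_cases hx : x = 0
  · subst hx; simp [(v.fil _).zero_mem]
  rw [v.mem_fil_of_ne (mul_ne_zero hx hy), v.mem_fil_of_ne hx, v.ord_mul hx hy]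
  omega

theorem ord_eq_of_mem_of_notMem {i : ℤ} {x : D} (h : x ∈ v.fil i) (h' : x ∉ v.fil (i + 1)) :
    x ≠ 0 ∧ v.ord x = i := by
  have h0 : x ≠ 0 := by rintro rfl; exact h' (v.fil _).zero_mem
  rw [v.mem_fil_of_ne h0] at h h'
  exact ⟨h0, by omega⟩

theorem ord_add_eq {x y : D} (hx : x ≠ 0) (hy : y ∈ v.fil (v.ord x + 1)) :
    x + y ≠ 0 ∧ v.ord (x + y) = v.ord x := by
  refine v.ord_eq_of_mem_of_notMem
    ((v.fil _).add_mem (v.mem_fil_ord x) (fil_mono (by omega) hy)) fun h => ?_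
  have := (v.fil _).sub_mem h hy
  rw [add_sub_cancel_right, v.mem_fil_of_ne hx] at this
  omega

end DiscVal

/-! ### The valuation of a division algebra over a local field -/

section Existence

variable (K : Type*) [Field K] [ValuativeRel K] [TopologicalSpace K]
  [IsNonarchimedeanLocalField K]

/-- The valuation `v` has the ring of integers `𝒪_D`. -/
def DiscVal.IsCompat {D : Type*} [DivisionRing D] [Algebra K D] (v : DiscVal D) : Prop :=
  ∀ x : D, IsIntegral 𝒪[K] x ↔ x ∈ v.fil 0

variable (D : Type*) [DivisionRing D] [Algebra K D] [FiniteDimensional K D]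

/-- The additive normalization of `|N_{D/K}(x)|`. -/
noncomputable def normOrd (x : D) : ℤ :=
  - WithZero.log (IsNonarchimedeanLocalField.valueGroupWithZeroIsoInt K
      (valuation K (Algebra.norm K x)))

variable {K D}

theorem iso_valuation_norm_ne_zero {x : D} (hx : x ≠ 0) :
    IsNonarchimedeanLocalField.valueGroupWithZeroIsoInt K (valuation K (Algebra.norm K x)) ≠ 0 := by
  simpa using (Algebra.norm_ne_zero_iff (R := K)).2 hx

theorem normOrd_mul {x y : D} (hx : x ≠ 0) (hy : y ≠ 0) :
    normOrd K D (x * y) = normOrd K D x + normOrd K D y := by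
  simp only [normOrd, map_mul]
  rw [WithZero.log_mul (iso_valuation_norm_ne_zero hx) (iso_valuation_norm_ne_zero hy)]
  ring

theorem isIntegral_iff_normOrd {x : D} (hx : x ≠ 0) :
    IsIntegral 𝒪[K] x ↔ 0 ≤ normOrd K D x := by
  rw [isIntegral_iff_norm, normOrd, neg_nonneg]
  rw [← WithZero.log_one, WithZero.log_le_log (iso_valuation_norm_ne_zero hx) one_ne_zero,
    ← map_one (IsNonarchimedeanLocalField.valueGroupWithZeroIsoInt K)]
  exact (IsNonarchimedeanLocalField.valueGroupWithZeroIsoInt K).map_le_map_iff'.symm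

variable (K D) in
theorem exists_normOrd_ne_zero : ∃ x : D, x ≠ 0 ∧ normOrd K D x ≠ 0 := by
  obtain ⟨a, ha0, ha⟩ := Valuation.IsNontrivial.exists_lt_one (v := valuation K)
  have ha0 : a ≠ 0 := by simpa using ha0
  have h0 : algebraMap K D a⁻¹ ≠ 0 := by simpa using ha0
  refine ⟨algebraMap K D a⁻¹, h0, fun h => ?_⟩
  have h1 := (isIntegral_iff_normOrd h0).2 h.ge
  rw [isIntegral_iff_norm, Algebra.norm_algebraMap, map_pow,
    pow_le_one_iff Module.finrank_pos.ne', map_inv₀, inv_le_one₀ ((valuation K).pos_iff.2 ha0)] at h1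
  exact absurd h1 ha.not_ge

variable (K D) in
-- The orders of the norms form a nontrivial subgroup `m ℤ` of `ℤ`, and dividing by `m` normalizes.
-- The ultrametric inequality comes from writing `x + y = x (1 + x⁻¹ y)`: if `x⁻¹ y` is integral, so
-- is `1 + x⁻¹ y`.
theorem exists_discVal : ∃ v : DiscVal D, v.IsCompat K := by
  have hone : normOrd K D 1 = 0 := by simp [normOrd]
  have hinv {x : D} (hx : x ≠ 0) : normOrd K D x⁻¹ = - normOrd K D x := by
    have := normOrd_mul (K := K) hx (inv_ne_zero hx)
    rw [mul_inv_cancel₀ hx, hone] at this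
    omega
  obtain ⟨m, ⟨hm0, p, hp0, hp⟩, hmin⟩ := Int.exists_least_of_bdd
    (P := fun m => 0 < m ∧ ∃ x : D, x ≠ 0 ∧ normOrd K D x = m) ⟨0, fun z hz => hz.1.le⟩ (by
      obtain ⟨x, hx, h⟩ := exists_normOrd_ne_zero K D
      rcases lt_or_gt_of_ne h with h | h
      · exact ⟨_, neg_pos.2 h, x⁻¹, inv_ne_zero hx, hinv hx⟩
      · exact ⟨_, h, x, hx, rfl⟩)
  have hpow (k : ℕ) : normOrd K D (p ^ k) = k * m := by
    induction k with
    | zero => simp [hone]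
    | succ k ih => rw [pow_succ, normOrd_mul (pow_ne_zero k hp0) hp0, ih, hp]; push_cast; ring
  have hzpow (k : ℤ) : normOrd K D (p ^ k) = k * m := by
    obtain ⟨j, rfl | rfl⟩ := k.eq_nat_or_neg
    · rw [zpow_natCast, hpow]
    · rw [zpow_neg, zpow_natCast, hinv (pow_ne_zero j hp0), hpow]; ring
  have hdvd {x : D} (hx : x ≠ 0) : m ∣ normOrd K D x := by
    rw [Int.dvd_iff_emod_eq_zero]
    by_contra h
    have h1 := Int.emod_nonneg (normOrd K D x) hm0.ne'
    have h2 := Int.emod_lt_of_pos (normOrd K D x) hm0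
    have hq : p ^ (-(normOrd K D x / m)) ≠ 0 := zpow_ne_zero _ hp0
    have h3 : normOrd K D (p ^ (-(normOrd K D x / m)) * x) = normOrd K D x % m := by
      rw [normOrd_mul hq hx, hzpow, Int.emod_def]; ring
    have := hmin _ ⟨by omega, _, mul_ne_zero hq hx, h3⟩
    omega
  have hnn {x : D} (hx : x ≠ 0) : 0 ≤ normOrd K D x / m ↔ IsIntegral 𝒪[K] x := by
    rw [isIntegral_iff_normOrd hx, Int.ediv_nonneg_iff_of_pos hm0]
  have hmul {x y : D} (hx : x ≠ 0) (hy : y ≠ 0) :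
      normOrd K D (x * y) / m = normOrd K D x / m + normOrd K D y / m := by
    rw [normOrd_mul hx hy, Int.add_ediv_of_dvd_left (hdvd hx)]
  have hadd {x y : D} (hx : x ≠ 0) (hy : y ≠ 0) (hxy : x + y ≠ 0)
      (h : normOrd K D x / m ≤ normOrd K D y / m) :
      normOrd K D x / m ≤ normOrd K D (x + y) / m := by
    have h1 : 0 ≤ normOrd K D (x⁻¹ * y) / m := by
      rw [hmul (inv_ne_zero hx) hy, hinv hx, Int.neg_ediv_of_dvd (hdvd hx)]; omega
    have h2 := isIntegral_one_add ((hnn (mul_ne_zero (inv_ne_zero hx) hy)).1 h1)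
    have h3 : x + y = x * (1 + x⁻¹ * y) := by
      rw [mul_add, mul_one, mul_inv_cancel_left₀ hx]
    rw [h3] at hxy ⊢
    have h4 := right_ne_zero_of_mul hxy
    rw [hmul hx h4]
    have := (hnn h4).2 h2
    omega
  refine ⟨⟨fun x => normOrd K D x / m, hmul, ?_, p, hp0, ?_⟩, ?_⟩
  · intro x y hx hy hxy
    rcases le_total (normOrd K D x / m) (normOrd K D y / m) with h | h
    · rw [min_eq_left h]; exact hadd hx hy hxy h
    · rw [min_eq_right h, add_comm x y]; exact hadd hy hx (by rwa [add_comm]) h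
  · rw [hp, Int.ediv_self hm0.ne']
  · intro x
    by_cases hx : x = 0
    · subst hx; simp [isIntegral_zero]
    · rw [DiscVal.mem_fil_of_ne _ hx]
      exact (hnn hx).symm

end Existence

/-- The ramification index of a homomorphism of division algebras. -/
theorem exists_ord_map_eq_mul {K : Type*} [Field K] [ValuativeRel K] {D D' : Type*} [DivisionRing D]
    [Algebra K D] [DivisionRing D'] [Algebra K D'] {v : DiscVal D} {v' : DiscVal D'}
    (hv : v.IsCompat K) (hv' : v'.IsCompat K) (φ : D →ₐ[K] D') :
    ∃ m : ℕ, 0 < m ∧ ∀ x, x ≠ 0 → v'.ord (φ x) = m * v.ord x := by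
  have hinj : Function.Injective φ := φ.toRingHom.injective
  have hφ0 {x : D} (hx : x ≠ 0) : φ x ≠ 0 := (map_ne_zero_iff φ hinj).2 hx
  have hnn {x : D} (hx : x ≠ 0) : 0 ≤ v'.ord (φ x) ↔ 0 ≤ v.ord x := by
    rw [← v.mem_fil_of_ne hx, ← v'.mem_fil_of_ne (hφ0 hx), ← hv, ← hv']
    exact isIntegral_algHom_iff (φ.restrictScalars 𝒪[K]) hinj
  -- Order zero means that `x` and `x⁻¹` are both integral, and `φ` preserves integrality. So
  -- `v'.ord ∘ φ` depends on `v.ord` only, and the factor is the order of the image of a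
  -- uniformizer.
  have hunit {x : D} (hx : x ≠ 0) (h : v.ord x = 0) : v'.ord (φ x) = 0 := by
    have h1 := (hnn hx).2 h.ge
    have h2 := (hnn (inv_ne_zero hx)).2 (by rw [v.ord_inv hx, h]; rfl)
    rw [map_inv₀, v'.ord_inv (hφ0 hx)] at h2
    omega
  have hpos : 0 < v'.ord (φ v.unif) := by
    by_contra h
    have := (hnn (inv_ne_zero v.unif_ne_zero)).1 (by
      rw [map_inv₀, v'.ord_inv (hφ0 v.unif_ne_zero)]; omega)
    rw [v.ord_inv v.unif_ne_zero, v.ord_unif] at this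
    omega
  refine ⟨(v'.ord (φ v.unif)).toNat, by omega, fun x hx => ?_⟩
  have hne := v.unif_zpow_ne_zero (- v.ord x)
  have h := hunit (x := v.unif ^ (- v.ord x) * x) (mul_ne_zero hne hx) (by
    rw [v.ord_mul hne hx, v.ord_unif_zpow]; omega)
  rw [map_mul, v'.ord_mul (hφ0 hne) (hφ0 hx), map_zpow₀, v'.ord_zpow (hφ0 v.unif_ne_zero)] at h
  rw [Int.toNat_of_nonneg hpos.le]
  linarith [mul_comm (v.ord x) (v'.ord (φ v.unif))]

/-! ### The ring of integers as a free module -/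

section Lattice

variable (K : Type*) [Field K] [ValuativeRel K] [TopologicalSpace K]
  [IsNonarchimedeanLocalField K]

theorem t2Space_localField : T2Space K := by
  refine IsTopologicalAddGroup.t2Space_of_zero_sep fun x hx => ?_
  exact ⟨_, (IsValuativeTopology.hasBasis_nhds_zero' K).mem_of_mem (i := valuation K x)
    (by simpa using hx), lt_irrefl (valuation K x)⟩

variable (D : Type*) [Ring D] [IsDomain D] [Algebra K D] [FiniteDimensional K D]

/-- The integers of a finite-dimensional division algebra form a finitely generated module. -/
theorem integers_fg : (Subalgebra.toSubmodule (integers K D)).FG := by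
  classical
  have := t2Space_localField K
  let b := Module.finBasis K D
  let N := Module.finrank K D
  have hN : N ≠ 0 := Module.finrank_pos.ne'
  let F : (Fin N → K) → K := fun x => Algebra.norm K (b.equivFun.symm x)
  have hF : Continuous F := by
    have : F = fun x => (∑ i, x i • Algebra.leftMulMatrix b (b i)).det := by
      ext x
      simp only [F]
      rw [Algebra.norm_eq_matrix_det b, b.equivFun_symm_apply, map_sum]
      simp only [map_smul]
    rw [this]
    refine Continuous.matrix_det (continuous_finsetSum _ fun i _ => ?_)
    exact (continuous_apply i).smul continuous_const
  -- Every nonzero vector, divided by its largest coordinate, lies in one of these compact sets. The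
  -- norm form does not vanish on them, so it is bounded away from zero there.
  let S (i : Fin N) : Set (Fin N → K) :=
    Set.univ.pi fun j => if j = i then {1} else {a | valuation K a ≤ 1}
  have hS (i) : IsCompact (S i) := isCompact_univ_pi fun j => by
    split_ifs
    · exact isCompact_singleton
    · exact IsNonarchimedeanLocalField.isCompact_closedBall K 1
  have hSi (i) {x} (hx : x ∈ S i) : x i = 1 := by simpa [S] using hx i trivial
  have hbd (i) : ∃ γ : ValueGroupWithZero K, γ ≠ 0 ∧ ∀ x ∈ S i, γ ≤ valuation K (F x) := by
    have hc : IsClosed (F '' S i) := ((hS i).image hF).isClosed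
    have h0 : (0 : K) ∈ (F '' S i)ᶜ := by
      rintro ⟨x, hx, h⟩
      have h1 : b.equivFun.symm x = 0 := by
        by_contra hne
        exact Algebra.norm_ne_zero_iff.2 hne h
      rw [LinearEquiv.map_eq_zero_iff] at h1
      have := hSi i hx
      rw [h1] at this
      simp at this
    obtain ⟨γ, hγ, hsub⟩ := (IsValuativeTopology.hasBasis_nhds_zero' K).mem_iff.1
      (hc.isOpen_compl.mem_nhds h0)
    exact ⟨γ, hγ, fun x hx => not_lt.1 fun h => hsub h ⟨x, hx, rfl⟩⟩
  choose γ hγ0 hγ using hbd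
  -- Integrality bounds the `N`-th power of the largest coordinate by some `(γ i)⁻¹`. With `1 ≤ |δ|`
  -- the bound passes to the coordinate itself, because values above `1` only grow under the `N`-th
  -- power.
  have hδ : ∃ δ : K, δ ≠ 0 ∧ 1 ≤ valuation K δ ∧ ∀ i, (γ i)⁻¹ ≤ valuation K δ := by
    obtain ⟨δ, hδ⟩ := ValuativeRel.valuation_surjective
      (1 ⊔ Finset.univ.sup fun i => (γ i)⁻¹)
    have h1 : 1 ≤ valuation K δ := hδ ▸ le_sup_left
    refine ⟨δ, fun h => by simp [h] at h1, h1, fun i => ?_⟩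
    rw [hδ]
    exact (Finset.le_sup (f := fun i => (γ i)⁻¹) (Finset.mem_univ i)).trans le_sup_right
  obtain ⟨δ, hδ0, hδ1, hδ⟩ := hδ
  refine Submodule.FG.of_le (T := Submodule.span 𝒪[K] (Set.range fun i => δ • b i))
    ((Submodule.fg_span (Set.finite_range _))) fun x hx => ?_
  have hcoord (j) : valuation K (b.equivFun x j) ≤ valuation K δ := by
    by_cases hx0 : x = 0
    · simp [hx0]
    obtain ⟨i, -, hi⟩ := Finset.exists_max_image Finset.univ
      (fun i => valuation K (b.equivFun x i)) ⟨j, Finset.mem_univ j⟩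
    refine (hi j (Finset.mem_univ j)).trans ?_
    set y := b.equivFun x with hy
    have hyi : y i ≠ 0 := by
      intro h
      apply hx0
      rw [← LinearEquiv.map_eq_zero_iff b.equivFun, ← hy]
      ext j
      have := hi j (Finset.mem_univ j)
      rw [h, map_zero, le_zero_iff, map_eq_zero] at this
      exact this
    have hyS : (y i)⁻¹ • y ∈ S i := by
      intro j _
      dsimp only
      split_ifs with hj
      · subst hj
        simp [hyi]
      · simp only [Set.mem_ofPred_eq, Pi.smul_apply, smul_eq_mul, map_mul, map_inv₀]
        rw [inv_mul_le_iff₀ ((valuation K).pos_iff.2 hyi), mul_one]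
        exact hi j (Finset.mem_univ j)
    have h1 := hγ i _ hyS
    have h2 : F ((y i)⁻¹ • y) = (y i)⁻¹ ^ N * Algebra.norm K x := by
      simp only [F, map_smul, hy, LinearEquiv.symm_apply_apply]
      rw [Algebra.smul_def, map_mul, Algebra.norm_algebraMap]
    have h3 : valuation K (Algebra.norm K x) ≤ 1 := (isIntegral_iff_norm x).1 hx
    rw [h2, map_mul, map_pow, map_inv₀] at h1
    have h4 : γ i ≤ (valuation K (y i))⁻¹ ^ N := h1.trans (mul_le_of_le_one_right' h3)
    rw [inv_pow] at h4
    have h5 : valuation K (y i) ^ N ≤ (γ i)⁻¹ := by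
      rw [le_inv_comm₀ (zero_lt_iff.2 (hγ0 i)) (pow_pos ((valuation K).pos_iff.2 hyi) N)] at h4
      exact h4
    by_contra hlt
    rw [not_le] at hlt
    have h6 : valuation K δ < valuation K (y i) ^ N :=
      hlt.trans_le (le_self_pow (hδ1.trans hlt.le) hN)
    exact absurd (h5.trans (hδ i)) h6.not_ge
  rw [← b.sum_equivFun x]
  refine Submodule.sum_mem _ fun j _ => ?_
  have : b.equivFun x j • b j =
      (⟨δ⁻¹ * b.equivFun x j, by
        rw [Valuation.mem_integer_iff, map_mul, map_inv₀,
          inv_mul_le_iff₀ ((valuation K).pos_iff.2 hδ0), mul_one]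
        exact hcoord j⟩ : 𝒪[K]) • (δ • b j) := by
    rw [Subring.smul_def, smul_smul, mul_right_comm, inv_mul_cancel₀ hδ0, one_mul]
  rw [this]
  exact Submodule.smul_mem _ _ (Submodule.subset_span ⟨j, rfl⟩)

theorem finite_integers : Module.Finite 𝒪[K] (integers K D) :=
  Module.Finite.iff_fg.2 (integers_fg K D)

theorem exists_smul_mem_integers (x : D) : ∃ a : 𝒪[K], a ≠ 0 ∧ a • x ∈ integers K D := by
  by_cases hx : x = 0
  · exact ⟨1, one_ne_zero, by rw [hx, smul_zero]; exact zero_mem _⟩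
  have hn : 0 < valuation K (Algebra.norm K x) :=
    (valuation K).pos_iff.2 (Algebra.norm_ne_zero_iff.2 hx)
  -- The norm of `a • x` carries a power of `a`. As `|a| ≤ 1`, that power is at most `|a|`, and `|a|
  -- ≤ |N x|⁻¹` suffices.
  obtain ⟨a, ha⟩ := ValuativeRel.valuation_surjective
    (1 ⊓ (valuation K (Algebra.norm K x))⁻¹)
  have h1 : valuation K a ≤ 1 := ha ▸ inf_le_left
  have h2 : valuation K a ≤ (valuation K (Algebra.norm K x))⁻¹ := ha ▸ inf_le_right
  refine ⟨⟨a, h1⟩, fun h => ?_, (isIntegral_iff_norm _).2 ?_⟩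
  · have h0 : a = 0 := congrArg Subtype.val h
    rw [h0, map_zero] at ha
    exact (lt_min one_pos (inv_pos.2 hn)).ne ha
  · rw [Subring.smul_def, Algebra.smul_def, map_mul, map_mul, Algebra.norm_algebraMap, map_pow]
    refine (mul_le_mul_left (pow_le_of_le_one zero_le h1 Module.finrank_pos.ne') _).trans ?_
    exact (mul_le_mul_left h2 _).trans (inv_mul_cancel₀ (ne_of_gt hn)).le

/-- A basis of the integers is a basis of the division algebra. -/
theorem exists_basis_integers :
    Nonempty (Module.Basis (Fin (Module.finrank K D)) 𝒪[K] (integers K D)) := by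
  have := finite_integers K D
  have : Module.IsTorsionFree 𝒪[K] (integers K D) :=
    Function.Injective.moduleIsTorsionFree _ Subtype.val_injective fun _ _ => rfl
  have : Module.Free 𝒪[K] (integers K D) := inferInstance
  let b := Module.finBasis 𝒪[K] (integers K D)
  have hli : LinearIndependent K fun i => (b i : D) := by
    rw [← LinearIndependent.iff_fractionRing 𝒪[K] K]
    exact b.linearIndependent.map' (integers K D).toSubmodule.subtype
      (Submodule.ker_subtype _)
  have hsp : ⊤ ≤ Submodule.span K (Set.range fun i => (b i : D)) := by
    intro x _
    obtain ⟨a, ha, hx⟩ := exists_smul_mem_integers K D x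
    have ha' : (a : K) ≠ 0 := fun h => ha (Subtype.ext h)
    have h1 : a • x ∈ Submodule.span K (Set.range fun i => (b i : D)) := by
      have := congrArg (Subtype.val) (b.sum_repr ⟨_, hx⟩)
      simp only at this
      rw [← this, AddSubmonoidClass.coe_finsetSum]
      refine Submodule.sum_mem _ fun i _ => ?_
      exact Submodule.smul_mem _ ((b.repr ⟨_, hx⟩ i : 𝒪[K]) : K) (Submodule.subset_span ⟨i, rfl⟩)
    have := Submodule.smul_mem _ (a : K)⁻¹ h1
    rwa [Subring.smul_def, smul_smul, inv_mul_cancel₀ ha', one_smul] at this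
  have := Module.finrank_eq_card_basis (Module.Basis.mk hli hsp)
  rw [Fintype.card_fin] at this
  rw [this]
  exact ⟨b⟩

end Lattice

/-! ### Indices in the filtration and the fundamental identity -/

namespace DiscVal

variable {D : Type*} [DivisionRing D] (v : DiscVal D)

theorem relIndex_fil_succ (i : ℤ) :
    (v.fil (i + 1)).relIndex (v.fil i) = (v.fil 1).relIndex (v.fil 0) := by
  have hmap (j : ℤ) : (v.fil j).map (AddMonoidHom.mulLeft (v.unif ^ i)) = v.fil (i + j) := by
    ext x
    constructor
    · rintro ⟨y, hy, rfl⟩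
      exact mul_mem_fil (v.unif_zpow_mem i) hy
    · intro hx
      refine ⟨(v.unif ^ i)⁻¹ * x, ?_, mul_inv_cancel_left₀ (v.unif_zpow_ne_zero i) x⟩
      rw [SetLike.mem_coe, v.mul_mem_fil_iff_left (inv_ne_zero (v.unif_zpow_ne_zero i)),
        v.ord_inv (v.unif_zpow_ne_zero i), v.ord_unif_zpow]
      exact fil_mono (by omega) hx
  have := AddSubgroup.relIndex_map_map_of_injective (v.fil 1) (v.fil 0)
    (f := AddMonoidHom.mulLeft (v.unif ^ i)) (mul_right_injective₀ (v.unif_zpow_ne_zero i))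
  rwa [hmap, hmap, add_zero] at this

theorem relIndex_fil (k : ℕ) :
    (v.fil k).relIndex (v.fil 0) = (v.fil 1).relIndex (v.fil 0) ^ k := by
  induction k with
  | zero => simp
  | succ k ih =>
    rw [← AddSubgroup.relIndex_mul_relIndex _ (v.fil k) _ (fun x hx => fil_mono (by simp) hx)
      (fun x hx => fil_mono (by simp) hx), ih, pow_succ, mul_comm]
    congr 1
    exact v.relIndex_fil_succ k

end DiscVal

section Identity

variable {K : Type*} [Field K] [ValuativeRel K] [TopologicalSpace K]
  [IsNonarchimedeanLocalField K] {D : Type*} [DivisionRing D] [Algebra K D] [FiniteDimensional K D]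

namespace DiscVal.IsCompat

variable {v : DiscVal D} (hv : v.IsCompat K)
include hv

theorem isUnit_iff (x : integers K D) : IsUnit x ↔ (x : D) ∉ v.fil 1 := by
  have hx := (hv x).1 x.2
  constructor
  · rintro ⟨u, rfl⟩ h
    have h1 : ((u : integers K D) : D) * ((u⁻¹ : (integers K D)ˣ) : integers K D) = 1 := by
      rw [← MulMemClass.coe_mul, u.mul_inv]
      rfl
    have h2 := DiscVal.mul_mem_fil h ((hv _).1 ((u⁻¹ : (integers K D)ˣ) : integers K D).2)
    rw [h1, v.one_mem_fil_iff] at h2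
    omega
  · intro h
    obtain ⟨h0, h1⟩ := v.ord_eq_of_mem_of_notMem hx h
    have h2 : (x : D)⁻¹ ∈ integers K D :=
      (hv _).2 (by rw [v.mem_fil_of_ne (inv_ne_zero h0), v.ord_inv h0, h1]; rfl)
    exact ⟨⟨x, ⟨_, h2⟩, Subtype.ext (mul_inv_cancel₀ h0), Subtype.ext (inv_mul_cancel₀ h0)⟩, rfl⟩

theorem mem_maxIdeal_iff (x : integers K D) : x ∈ maxIdeal K D ↔ (x : D) ∈ v.fil 1 := by
  rw [← not_iff_not, ← hv.isUnit_iff]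
  exact not_not

theorem relIndex_eq_card :
    (v.fil 1).relIndex (v.fil 0) = Nat.card 𝓀[K] ^ residualDegree K D := by
  have := finite_integers K D
  let : Module 𝓀[K] (integers K D ⧸ maxIdeal K D) := (residue_torsion K D).module
  have : IsScalarTower 𝒪[K] 𝓀[K] (integers K D ⧸ maxIdeal K D) :=
    (residue_torsion K D).isScalarTower
  have : Module.Finite 𝒪[K] (integers K D ⧸ maxIdeal K D) :=
    Module.Finite.of_surjective
      ({ toFun := Submodule.Quotient.mk
         map_add' := fun _ _ => rfl
         map_smul' := fun _ _ => rfl } : integers K D →ₗ[𝒪[K]] integers K D ⧸ maxIdeal K D)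
      (Submodule.Quotient.mk_surjective _)
  have : Module.Finite 𝓀[K] (integers K D ⧸ maxIdeal K D) :=
    Module.Finite.of_restrictScalars_finite 𝒪[K] _ _
  have h1 := Module.natCard_eq_pow_finrank (K := 𝓀[K]) (V := integers K D ⧸ maxIdeal K D)
  refine Eq.trans ?_ h1
  have h2 := AddSubgroup.index_comap (v.fil 1)
    (integers K D).toSubmodule.toAddSubgroup.subtype
  have h3 : (integers K D).toSubmodule.toAddSubgroup.subtype.range = v.fil 0 := by
    ext x
    rw [AddSubgroup.range_subtype, ← hv x]
    rfl
  rw [h3] at h2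
  rw [← h2]
  have h4 : (v.fil 1).comap (integers K D).toSubmodule.toAddSubgroup.subtype =
      (maxIdeal K D).toAddSubgroup := by
    ext x
    exact (hv.mem_maxIdeal_iff x).symm
  rw [h4]
  rfl

end DiscVal.IsCompat

theorem DiscVal.IsCompat.mem_maximalIdeal_iff {vK : DiscVal K} (hvK : vK.IsCompat K) (a : 𝒪[K]) :
    a ∈ 𝓂[K] ↔ (a : K) ∈ vK.fil 1 := by
  let b : integers K K := ⟨a, isIntegral_algebraMap (R := 𝒪[K]) (x := a)⟩
  rw [← hvK.mem_maxIdeal_iff b, IsLocalRing.mem_maximalIdeal, mem_nonunits_iff]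
  change ¬ IsUnit a ↔ ¬ IsUnit b
  rw [not_iff_not, isUnit_integers_iff, Algebra.norm_self]
  change _ ↔ ¬ valuation K (a : K) < 1
  rw [Valuation.Integers.isUnit_iff_valuation_eq_one (Valuation.integer.integers (valuation K))]
  rw [not_lt]
  exact ⟨fun h => h.ge, fun h => le_antisymm a.2 h⟩

variable {v : DiscVal D} {vK : DiscVal K} {e : ℕ}

/-- `fil e` is `ϖ 𝒪_D` for a uniformizer `ϖ` of `K`. Since `𝒪_D` is free of rank `[D : K]`, the
quotient is a product of `[D : K]` copies of the residue field of `K`. -/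
theorem relIndex_fil_ramification (hv : v.IsCompat K) (hvK : vK.IsCompat K)
    (he : ∀ a : K, a ≠ 0 → v.ord (algebraMap K D a) = e * vK.ord a) :
    (v.fil e).relIndex (v.fil 0) = Nat.card 𝓀[K] ^ Module.finrank K D := by
  obtain ⟨b⟩ := exists_basis_integers K D
  let T : (Fin (Module.finrank K D) → 𝒪[K]) →+ D :=
    (integers K D).toSubmodule.toAddSubgroup.subtype.comp b.equivFun.symm.toLinearMap.toAddMonoidHom
  have hT (x) : T x = (b.equivFun.symm x : integers K D) := rfl
  have hr : T.range = v.fil 0 := by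
    ext x
    rw [← hv x]
    constructor
    · rintro ⟨y, rfl⟩
      exact (b.equivFun.symm y).2
    · intro hx
      exact ⟨b.equivFun ⟨x, hx⟩, by rw [hT, LinearEquiv.symm_apply_apply]⟩
  have h0 : algebraMap K D vK.unif ≠ 0 := by simpa using vK.unif_ne_zero
  have h1 : v.ord (algebraMap K D vK.unif) = e := by
    rw [he _ vK.unif_ne_zero, vK.ord_unif, mul_one]
  have hϖ : vK.unif ∈ 𝒪[K] := by
    have := (hvK vK.unif).2 (by rw [vK.mem_fil_of_ne vK.unif_ne_zero, vK.ord_unif]; decide)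
    rw [isIntegral_iff_norm, Algebra.norm_self] at this
    exact this
  let ϖ : 𝒪[K] := ⟨vK.unif, hϖ⟩
  have hTs (y) : T (ϖ • y) = algebraMap K D vK.unif * T y := by
    rw [hT, hT, map_smul, ← Algebra.smul_def]
    rfl
  have hm (a : 𝒪[K]) : a ∈ 𝓂[K] ↔ ∃ c, a = ϖ * c := by
    rw [hvK.mem_maximalIdeal_iff]
    constructor
    · intro h
      have h2 : vK.unif⁻¹ * a ∈ vK.fil 0 := by
        rw [vK.mul_mem_fil_iff_left (inv_ne_zero vK.unif_ne_zero), vK.ord_inv vK.unif_ne_zero,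
          vK.ord_unif]
        exact DiscVal.fil_mono (by omega) h
      rw [← hvK, isIntegral_iff_norm, Algebra.norm_self] at h2
      exact ⟨⟨_, h2⟩, Subtype.ext (mul_inv_cancel_left₀ vK.unif_ne_zero _).symm⟩
    · rintro ⟨c, rfl⟩
      have h2 : (c : K) ∈ vK.fil 0 := (hvK _).1 (isIntegral_algebraMap (R := 𝒪[K]) (x := c))
      have h3 : vK.unif ∈ vK.fil 1 := by
        rw [vK.mem_fil_of_ne vK.unif_ne_zero, vK.ord_unif]
      exact DiscVal.mul_mem_fil' (by omega) h3 h2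
  have hc : (v.fil e).comap T = AddSubgroup.pi Set.univ fun _ => (𝓂[K]).toAddSubgroup := by
    ext x
    rw [AddSubgroup.mem_comap, AddSubgroup.mem_pi]
    constructor
    · intro hx i _
      have h2 : (algebraMap K D vK.unif)⁻¹ * T x ∈ v.fil 0 := by
        rw [v.mul_mem_fil_iff_left (inv_ne_zero h0), v.ord_inv h0, h1]
        exact DiscVal.fil_mono (by omega) hx
      rw [← hr] at h2
      obtain ⟨y, hy⟩ := h2
      have h3 : T x = T (ϖ • y) := by rw [hTs, hy, mul_inv_cancel_left₀ h0]
      have h4 : x = ϖ • y := b.equivFun.symm.injective (Subtype.ext h3)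
      exact (hm _).2 ⟨y i, by rw [h4]; rfl⟩
    · intro h
      choose y hy using fun i => (hm (x i)).1 (h i trivial)
      have h4 : x = ϖ • y := funext hy
      rw [h4, hTs]
      have h5 : T y ∈ v.fil 0 := hr ▸ ⟨y, rfl⟩
      exact DiscVal.mul_mem_fil' (by omega) (v.mem_fil_ord _) h5
  rw [← hr, ← AddSubgroup.index_comap, hc, AddSubgroup.index_pi, Finset.prod_const,
    Finset.card_univ, Fintype.card_fin]
  rfl

theorem one_lt_card_residueField : 1 < Nat.card 𝓀[K] := Finite.one_lt_card

/-- The maps `ord` and `absNorm` on `Dˣ` have the same kernel, the units of `𝒪_D`. The index of the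
value groups can therefore be computed in `ℤ`, where `Kˣ` has image `e ℤ`. -/
theorem ramificationIndex_eq (hv : v.IsCompat K)
    (he : ∀ a : K, a ≠ 0 → v.ord (algebraMap K D a) = e * vK.ord a) :
    ramificationIndex K D = e := by
  let ω : Dˣ →* Multiplicative ℤ :=
    { toFun := fun x => Multiplicative.ofAdd (v.ord x)
      map_one' := by simp [v.ord_one]
      map_mul' := fun x y => by
        rw [Units.val_mul, v.ord_mul x.ne_zero y.ne_zero]; rfl }
  have hker : ω.ker = (absNorm K D).ker := by
    ext x
    rw [MonoidHom.mem_ker, MonoidHom.mem_ker]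
    have hnn (x : Dˣ) : 0 ≤ v.ord x ↔ valuation K (Algebra.norm K (x : D)) ≤ 1 := by
      rw [← isIntegral_iff_norm, hv, v.mem_fil_of_ne x.ne_zero]
    have h1 := hnn x
    have h2 := hnn x⁻¹
    rw [Units.val_inv_eq_inv_val, v.ord_inv x.ne_zero, ← Units.val_inv_eq_inv_val] at h2
    have h3 : valuation K (Algebra.norm K ((x⁻¹ : Dˣ) : D)) ≤ 1 ↔
        1 ≤ valuation K (Algebra.norm K (x : D)) := by
      have h4 : valuation K (Algebra.norm K (x : D)) *
          valuation K (Algebra.norm K ((x⁻¹ : Dˣ) : D)) = 1 := by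
        rw [← map_mul, ← map_mul, x.mul_inv, map_one, map_one]
      rw [eq_inv_of_mul_eq_one_right h4, inv_le_one₀]
      exact (valuation K).pos_iff.2 (Algebra.norm_ne_zero_iff.2 x.ne_zero)
    rw [h3] at h2
    have h5 : absNorm K D x = 1 ↔ valuation K (Algebra.norm K (x : D)) = 1 := Units.ext_iff
    have h6 : ω x = 1 ↔ v.ord (x : D) = 0 := Iff.rfl
    rw [h5, h6, le_antisymm_iff (a := valuation K _), ← h1, ← h2]
    constructor
    · intro h; constructor <;> omega
    · rintro ⟨h, h'⟩; omega
  have hsurj : ω.range = ⊤ := by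
    rw [MonoidHom.range_eq_top]
    intro z
    refine ⟨Units.mk0 _ (v.unif_zpow_ne_zero z.toAdd), ?_⟩
    change Multiplicative.ofAdd (v.ord (v.unif ^ z.toAdd)) = z
    rw [v.ord_unif_zpow]; rfl
  set H := (Units.map (algebraMap K D : K →* D)).range with hH
  have hHω : H.map ω = AddSubgroup.toSubgroup (AddSubgroup.zmultiples (e : ℤ)) := by
    ext z
    constructor
    · rintro ⟨_, ⟨a, rfl⟩, rfl⟩
      change v.ord (algebraMap K D a) ∈ AddSubgroup.zmultiples (e : ℤ)
      rw [he _ a.ne_zero, AddSubgroup.mem_zmultiples_iff]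
      exact ⟨vK.ord a, by rw [smul_eq_mul, mul_comm]⟩
    · intro hz
      obtain ⟨k, hk⟩ := AddSubgroup.mem_zmultiples_iff.1 (show z.toAdd ∈ _ from hz)
      refine ⟨_, ⟨Units.mk0 _ (vK.unif_zpow_ne_zero k), rfl⟩, ?_⟩
      change v.ord (algebraMap K D (vK.unif ^ k)) = z.toAdd
      rw [he _ (vK.unif_zpow_ne_zero k), vK.ord_unif_zpow, ← hk, smul_eq_mul, mul_comm]
  rw [ramificationIndex, MonoidHom.range_eq_map (absNorm K D), Subgroup.relIndex_map_map,
    ← hker, ← Subgroup.relIndex_map_map, ← MonoidHom.range_eq_map, hsurj, hHω,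
    Subgroup.relIndex_top_right]
  exact Int.index_zmultiples e

theorem exists_ord_algebraMap (hv : v.IsCompat K) (hvK : vK.IsCompat K) :
    0 < ramificationIndex K D ∧
    ∀ a : K, a ≠ 0 → v.ord (algebraMap K D a) = ramificationIndex K D * vK.ord a := by
  obtain ⟨e, h0, he⟩ := exists_ord_map_eq_mul hvK hv (Algebra.ofId K D)
  rw [ramificationIndex_eq (e := e) hv he]
  exact ⟨h0, he⟩

variable (K D) in
/-- The fundamental identity `[D : K] = e f`. -/
theorem finrank_eq_ramificationIndex_mul :
    Module.finrank K D = ramificationIndex K D * residualDegree K D := by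
  obtain ⟨v, hv⟩ := exists_discVal K D
  obtain ⟨vK, hvK⟩ := exists_discVal K K
  -- The index of `fil e` is counted a second time, as `e` steps of size `q ^ f`.
  have h := relIndex_fil_ramification hv hvK (exists_ord_algebraMap hv hvK).2
  rw [v.relIndex_fil, hv.relIndex_eq_card, ← pow_mul] at h
  rw [Nat.mul_comm]
  exact (Nat.pow_right_injective one_lt_card_residueField h).symm

end Identity

/-! ### Residue fields and conjugation -/

namespace DiscVal

variable {D : Type u} [DivisionRing D] (v : DiscVal D)

/-- The valuation ring. -/
def integer : Subring D where
  carrier := v.fil 0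
  one_mem' := v.one_mem_fil
  mul_mem' hx hy := mul_mem_fil hx hy
  zero_mem' := (v.fil 0).zero_mem
  add_mem' := (v.fil 0).add_mem
  neg_mem' := (v.fil 0).neg_mem

theorem mem_integer {x : D} : x ∈ v.integer ↔ x ∈ v.fil 0 := Iff.rfl

/-- The ideal of elements of positive order in the valuation ring. -/
def integerMaxIdeal : Ideal v.integer where
  carrier := {x | (x : D) ∈ v.fil 1}
  zero_mem' := (v.fil 1).zero_mem
  add_mem' := (v.fil 1).add_mem
  smul_mem' a _ hx := mul_mem_fil' (i := 0) (by omega) a.2 hx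

instance : v.integerMaxIdeal.IsTwoSided :=
  ⟨fun {_} b hx => mul_mem_fil' (j := 0) (by omega) hx b.2⟩

/-- A residue field of a discretely valued division ring with finite residue ring. -/
structure ResidueMap (k : Type*) [Field k] where
  map : v.integer →+* k
  surj : Function.Surjective map
  eq_zero_iff : ∀ x, map x = 0 ↔ (x : D) ∈ v.fil 1

/-- By additivity of the order the residue ring has no zero divisors, and by Wedderburn's theorem a
finite domain is a field. -/
theorem exists_residueMap (hfin : (v.fil 1).relIndex (v.fil 0) ≠ 0) :
    ∃ (k : Type u) (_ : Field k) (_ : Finite k), Nonempty (v.ResidueMap k) := by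
  have hdom : IsDomain (v.integer ⧸ v.integerMaxIdeal) := by
    have : Nontrivial (v.integer ⧸ v.integerMaxIdeal) := by
      refine ⟨⟨1, 0, fun h => ?_⟩⟩
      have h1 : (1 : D) ∈ v.fil 1 := Ideal.Quotient.eq_zero_iff_mem.1
        (show Ideal.Quotient.mk v.integerMaxIdeal 1 = 0 from h)
      rw [v.one_mem_fil_iff] at h1
      omega
    have : NoZeroDivisors (v.integer ⧸ v.integerMaxIdeal) := by
      constructor
      intro a b hab
      obtain ⟨a, rfl⟩ := Ideal.Quotient.mk_surjective a
      obtain ⟨b, rfl⟩ := Ideal.Quotient.mk_surjective b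
      rw [← map_mul, Ideal.Quotient.eq_zero_iff_mem] at hab
      rw [Ideal.Quotient.eq_zero_iff_mem, Ideal.Quotient.eq_zero_iff_mem]
      by_contra! h
      obtain ⟨h1, h2⟩ := h
      obtain ⟨ha0, ha⟩ := v.ord_eq_of_mem_of_notMem a.2 h1
      obtain ⟨hb0, hb⟩ := v.ord_eq_of_mem_of_notMem b.2 h2
      have h3 : (a : D) * b ∈ v.fil 1 := hab
      rw [v.mem_fil_of_ne (mul_ne_zero ha0 hb0), v.ord_mul ha0 hb0] at h3
      omega
    exact NoZeroDivisors.to_isDomain _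
  have hf : Finite (v.integer ⧸ v.integerMaxIdeal) := by
    apply Nat.finite_of_card_ne_zero
    exact hfin
  have hfield := Finite.isDomain_to_isField (v.integer ⧸ v.integerMaxIdeal)
  let := hfield.toField
  exact ⟨_, this, hf, ⟨Ideal.Quotient.mk v.integerMaxIdeal, Ideal.Quotient.mk_surjective,
    fun x => Ideal.Quotient.eq_zero_iff_mem⟩⟩

namespace ResidueMap

variable {v} {k : Type*} [Field k] (r : v.ResidueMap k)

theorem eq_iff {x y : v.integer} : r.map x = r.map y ↔ (x : D) - y ∈ v.fil 1 := by
  rw [← sub_eq_zero, ← map_sub, r.eq_zero_iff]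
  rfl

include r in
theorem comm (x y : v.integer) : (x : D) * y - y * x ∈ v.fil 1 := by
  have := (r.eq_iff (x := x * y) (y := y * x)).1 (by rw [map_mul, map_mul, mul_comm])
  exact this

include r in
theorem natCard : Nat.card k = (v.fil 1).relIndex (v.fil 0) := by
  have h1 : r.map.toAddMonoidHom.ker = (v.fil 1).addSubgroupOf (v.fil 0) := by
    ext x
    exact r.eq_zero_iff x
  have h2 := AddSubgroup.index_ker r.map.toAddMonoidHom
  rw [h1] at h2
  refine Eq.trans ?_ h2.symm
  have h3 : r.map.toAddMonoidHom.range = ⊤ := AddMonoidHom.range_eq_top.2 r.surj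
  rw [h3]
  exact (Nat.card_congr AddSubgroup.topEquiv.toEquiv).symm

theorem conj_mem {y x : D} (hx : x ∈ v.integer) : y * x * y⁻¹ ∈ v.integer := by
  by_cases hy : y = 0
  · rw [hy, zero_mul, zero_mul]; exact zero_mem _
  rw [v.mem_integer, v.mul_mem_fil_iff_right (inv_ne_zero hy), v.mul_mem_fil_iff_left hy, v.ord_inv hy]
  exact fil_mono (by omega) hx

/-- The automorphism of the residue field induced by conjugation with the uniformizer. -/
theorem exists_conj [Finite k] : ∃ σ : RingAut k, ∀ x : v.integer,
    r.map ⟨v.unif * x * v.unif⁻¹, conj_mem x.2⟩ = σ (r.map x) := by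
  let c : v.integer →+* v.integer :=
    { toFun := fun x => ⟨v.unif * x * v.unif⁻¹, conj_mem x.2⟩
      map_one' := Subtype.ext (by simp [v.unif_ne_zero])
      map_mul' := fun x y => Subtype.ext (by simp [mul_assoc, v.unif_ne_zero])
      map_zero' := Subtype.ext (by simp)
      map_add' := fun x y => Subtype.ext (by simp [mul_add, add_mul]) }
  let s : k →+* k := RingHom.liftOfSurjective r.map r.surj ⟨r.map.comp c, fun x hx => by
    rw [RingHom.mem_ker] at hx ⊢
    rw [r.eq_zero_iff] at hx
    rw [RingHom.comp_apply, r.eq_zero_iff]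
    change v.unif * x * v.unif⁻¹ ∈ v.fil 1
    rw [v.mul_mem_fil_iff_right (inv_ne_zero v.unif_ne_zero),
      v.mul_mem_fil_iff_left v.unif_ne_zero, v.ord_inv v.unif_ne_zero]
    exact fil_mono (by omega) hx⟩
  have hs : ∀ x, s (r.map x) = r.map (c x) := fun x =>
    RingHom.liftOfRightInverse_comp_apply _ _ _ _ _
  refine ⟨RingEquiv.ofBijective s (Finite.injective_iff_bijective.1 s.injective), fun x => ?_⟩
  exact (hs x).symm

variable {r} {σ : RingAut k}
  (hσ : ∀ x : v.integer, r.map ⟨v.unif * x * v.unif⁻¹, conj_mem x.2⟩ = σ (r.map x))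
include hσ

theorem map_conj_unif_pow (i : ℕ) (x : v.integer) :
    r.map ⟨v.unif ^ i * x * (v.unif ^ i)⁻¹, conj_mem x.2⟩ = (σ ^ i) (r.map x) := by
  induction i with
  | zero => simp
  | succ i ih =>
    rw [pow_succ' σ, RingAut.mul_apply, ← ih, ← hσ]
    congr 2
    rw [pow_succ', mul_inv_rev]
    simp only [mul_assoc]

/-- Conjugation by an element of order `i` acts as `σ ^ i` on the residue field. -/
theorem map_conj {y : D} (hy : y ≠ 0) {i : ℕ} (hi : v.ord y = i) (x : v.integer) :
    r.map ⟨y * x * y⁻¹, conj_mem x.2⟩ = (σ ^ i) (r.map x) := by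
  rw [← map_conj_unif_pow hσ, r.eq_iff]
  have hπ : v.unif ^ i ≠ 0 := pow_ne_zero i v.unif_ne_zero
  set w := v.unif ^ i * x * (v.unif ^ i)⁻¹ with hw
  have hwm : w ∈ v.fil 0 := conj_mem x.2
  -- `y` is a unit times `πⁱ`, and conjugation by a unit is trivial on the commutative residue
  -- field.
  set u := y * (v.unif ^ i)⁻¹ with hu
  have hu0 : u ≠ 0 := mul_ne_zero hy (inv_ne_zero hπ)
  have huo : v.ord u = 0 := by
    rw [hu, v.ord_mul hy (inv_ne_zero hπ), v.ord_inv hπ, v.ord_pow v.unif_ne_zero, v.ord_unif]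
    omega
  have hum : u ∈ v.fil 0 := by rw [v.mem_fil_of_ne hu0, huo]
  have h1 : y * x * y⁻¹ = u * w * u⁻¹ := by
    rw [hu, hw, mul_inv_rev, inv_inv]
    simp only [mul_assoc, inv_mul_cancel_left₀ hπ]
  have h2 : y * x * y⁻¹ - w = (u * w - w * u) * u⁻¹ := by
    rw [h1, sub_mul, mul_assoc w, mul_inv_cancel₀ hu0, mul_one]
  change y * x * y⁻¹ - w ∈ v.fil 1
  rw [h2, v.mul_mem_fil_iff_right (inv_ne_zero hu0), v.ord_inv hu0, huo]
  exact r.comm ⟨u, hum⟩ ⟨w, hwm⟩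

end ResidueMap

end DiscVal

/-! ### Fixed fields in a finite field -/

section FiniteFields

variable {k : Type*} [Field k] {σ : RingAut k} {n q : ℕ}

/-- By Artin's theorem `k` has degree `n / gcd(n, i)`, the order of `σ ^ i`, over its fixed field.
Counting elements of `k` gives the cardinality. -/
theorem natCard_fixedPoints (hn : 0 < n) (hk : Nat.card k = q ^ n)
    (hσ : orderOf σ = n) (i : ℕ) :
    Nat.card (FixedPoints.subfield (Subgroup.zpowers (σ ^ i)) k) = q ^ n.gcd i := by
  have hfin : IsOfFinOrder (σ ^ i) := (orderOf_pos_iff.1 (by omega : 0 < orderOf σ)).pow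
  have : Finite (Subgroup.zpowers (σ ^ i)) := hfin.finite_zpowers
  let := Fintype.ofFinite (Subgroup.zpowers (σ ^ i))
  have h1 := FixedPoints.finrank_eq_card (Subgroup.zpowers (σ ^ i)) k
  rw [← Nat.card_eq_fintype_card, Nat.card_zpowers,
    (orderOf_pos_iff.1 (by omega : 0 < orderOf σ)).orderOf_pow, hσ] at h1
  have h2 := Module.natCard_eq_pow_finrank
    (K := FixedPoints.subfield (Subgroup.zpowers (σ ^ i)) k) (V := k)
  rw [hk, h1] at h2
  have hg := Nat.gcd_dvd_left n i
  have h3 : n / n.gcd i ≠ 0 := (Nat.div_pos (Nat.le_of_dvd hn hg) (Nat.gcd_pos_of_pos_left i hn)).ne'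
  refine (Nat.pow_left_injective h3 (?_ : _ ^ _ = _ ^ _))
  rw [← h2, ← pow_mul, Nat.mul_div_cancel' hg]

theorem mem_fixedPoints {i : ℕ} {x : k} :
    x ∈ FixedPoints.subfield (Subgroup.zpowers (σ ^ i)) k ↔ (σ ^ i) x = x := by
  constructor
  · intro h
    exact h ⟨σ ^ i, Subgroup.mem_zpowers _⟩
  · rintro h ⟨g, hg⟩
    have : Subgroup.zpowers (σ ^ i) ≤ MulAction.stabilizer (RingAut k) x := by
      rw [Subgroup.zpowers_le]
      exact h
    exact this hg

/-- A subfield that is fixed by `σ ^ i` has degree dividing `i`. -/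
theorem dvd_of_fixed [Finite k] (hq : 1 < q) (hn : 0 < n) (hk : Nat.card k = q ^ n)
    (hσ : orderOf σ = n) {F : Subfield k} {f i : ℕ} (hF : Nat.card F = q ^ f)
    (h : ∀ x ∈ F, (σ ^ i) x = x) : f ∣ i := by
  have hle : F ≤ FixedPoints.subfield (Subgroup.zpowers (σ ^ i)) k :=
    fun x hx => mem_fixedPoints.2 (h x hx)
  let := (Subfield.inclusion hle).toAlgebra
  have h2 := Module.natCard_eq_pow_finrank (K := F)
    (V := FixedPoints.subfield (Subgroup.zpowers (σ ^ i)) k)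
  rw [natCard_fixedPoints hn hk hσ, hF, ← pow_mul] at h2
  have h3 := Nat.pow_right_injective hq h2
  exact (Dvd.intro _ h3.symm).trans (Nat.gcd_dvd_right n i)

end FiniteFields

/-! ### Residue fields of division subalgebras -/

section ResidueSubfield

variable {K : Type*} [Field K] {D D' : Type*} [DivisionRing D]
    [Algebra K D] [DivisionRing D'] [Algebra K D'] {v : DiscVal D} {v' : DiscVal D'}

theorem map_mem_fil_iff {φ : D →ₐ[K] D'} {m : ℕ} (hm : 0 < m)
    (hφ : ∀ x, x ≠ 0 → v'.ord (φ x) = m * v.ord x) {x : D} {i j : ℤ}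
    (h1 : m * (j - 1) < i) (h2 : i ≤ m * j) : φ x ∈ v'.fil i ↔ x ∈ v.fil j := by
  by_cases hx : x = 0
  · simp [hx]
  have hm' : (0 : ℤ) < m := by exact_mod_cast hm
  rw [v.mem_fil_of_ne hx, v'.mem_fil_of_ne ((map_ne_zero_iff φ φ.toRingHom.injective).2 hx), hφ x hx]
  constructor
  · intro h
    have := lt_of_mul_lt_mul_left (h1.trans_le h) hm'.le
    omega
  · intro h
    exact h2.trans (mul_le_mul_of_nonneg_left h hm'.le)

theorem map_mem_fil_mul_iff {φ : D →ₐ[K] D'} {m : ℕ} (hm : 0 < m)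
    (hφ : ∀ x, x ≠ 0 → v'.ord (φ x) = m * v.ord x) {x : D} (j : ℤ) :
    φ x ∈ v'.fil (m * j) ↔ x ∈ v.fil j :=
  map_mem_fil_iff hm hφ (by
    have hm' : (0 : ℤ) < m := by exact_mod_cast hm
    rw [mul_sub, mul_one]; omega) le_rfl

theorem map_mem_fil_zero_iff {φ : D →ₐ[K] D'} {m : ℕ} (hm : 0 < m)
    (hφ : ∀ x, x ≠ 0 → v'.ord (φ x) = m * v.ord x) {x : D} :
    φ x ∈ v'.fil 0 ↔ x ∈ v.fil 0 := by
  simpa using map_mem_fil_mul_iff hm hφ (x := x) 0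

theorem map_mem_fil_one_iff {φ : D →ₐ[K] D'} {m : ℕ} (hm : 0 < m)
    (hφ : ∀ x, x ≠ 0 → v'.ord (φ x) = m * v.ord x) {x : D} :
    φ x ∈ v'.fil 1 ↔ x ∈ v.fil 1 :=
  map_mem_fil_iff hm hφ (by simp) (by simpa using Nat.succ_le_of_lt hm)

/-- The residue field of a division subalgebra has `|𝓀[D]|` elements. -/
theorem exists_residueSubfield {φ : D →ₐ[K] D'} {m : ℕ} (hm : 0 < m)
    (hφ : ∀ x, x ≠ 0 → v'.ord (φ x) = m * v.ord x) {k : Type*} [Field k] (r : v'.ResidueMap k) :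
    ∃ F : Subfield k, Nat.card F = (v.fil 1).relIndex (v.fil 0) ∧
      ∀ y, y ∈ F ↔ ∃ (x : D) (hx : φ x ∈ v'.integer), x ∈ v.fil 0 ∧ r.map ⟨φ x, hx⟩ = y := by
  have h0 {x : D} (hx : x ∈ v.fil 0) : φ x ∈ v'.integer := (map_mem_fil_zero_iff hm hφ).2 hx
  let t : v.integer →+* k := r.map.comp
    { toFun := fun x => ⟨φ x, h0 x.2⟩
      map_one' := Subtype.ext (map_one φ)
      map_mul' := fun x y => Subtype.ext (map_mul φ _ _)
      map_zero' := Subtype.ext (map_zero φ)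
      map_add' := fun x y => Subtype.ext (map_add φ _ _) }
  have ht (x : v.integer) : t x = 0 ↔ (x : D) ∈ v.fil 1 := by
    rw [← map_mem_fil_one_iff hm hφ]
    exact r.eq_zero_iff _
  let F : Subfield k :=
    { t.range with
      inv_mem' := by
        rintro _ ⟨x, rfl⟩
        by_cases hx : (x : D) ∈ v.fil 1
        · rw [(ht x).2 hx, inv_zero]
          exact t.range.zero_mem
        · obtain ⟨hx0, hx1⟩ := v.ord_eq_of_mem_of_notMem x.2 hx
          have hi : (x : D)⁻¹ ∈ v.integer := by
            rw [v.mem_integer, v.mem_fil_of_ne (inv_ne_zero hx0), v.ord_inv hx0, hx1]; rfl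
          refine ⟨⟨_, hi⟩, ?_⟩
          apply eq_inv_of_mul_eq_one_left
          rw [← map_mul, ← map_one t]
          exact congrArg t (Subtype.ext (inv_mul_cancel₀ hx0)) }
  refine ⟨F, ?_, fun y => ?_⟩
  · have h1 : t.toAddMonoidHom.ker = (v.fil 1).addSubgroupOf (v.fil 0) := by
      ext x
      exact ht x
    have h2 := AddSubgroup.index_ker t.toAddMonoidHom
    rw [h1] at h2
    exact h2.symm
  · constructor
    · rintro ⟨x, rfl⟩
      exact ⟨x, h0 x.2, x.2, rfl⟩
    · rintro ⟨x, hx, hx', rfl⟩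
      exact ⟨⟨x, hx'⟩, rfl⟩

end ResidueSubfield

/-! ### Commuting elements and their polynomial correction -/

section Subfields

theorem exists_field_of_commute {K : Type*} [Field K] {B : Type u} [DivisionRing B] [Algebra K B]
    [FiniteDimensional K B] {w z : B} (h : w * z = z * w) :
    ∃ (E : Type u) (_ : Field E) (_ : Algebra K E) (_ : FiniteDimensional K E) (χ : E →ₐ[K] B),
      (∃ x, χ x = w) ∧ ∃ x, χ x = z := by
  have hcomm : ∀ a ∈ ({w, z} : Set B), ∀ b ∈ ({w, z} : Set B), a * b = b * a := by
    rintro a (rfl | rfl) b (rfl | rfl)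
    · rfl
    · exact h
    · exact h.symm
    · rfl
  have := Algebra.isMulCommutative_adjoin K hcomm
  let : CommRing (Algebra.adjoin K {w, z}) :=
    { (inferInstance : Ring (Algebra.adjoin K {w, z})) with mul_comm := fun a b => mul_comm' a b }
  let : Field (Algebra.adjoin K {w, z}) := fieldOfFiniteDimensional K _
  exact ⟨Algebra.adjoin K {w, z}, this, inferInstance, inferInstance, Subalgebra.val _,
    ⟨⟨w, Algebra.subset_adjoin (by simp)⟩, rfl⟩, ⟨⟨z, Algebra.subset_adjoin (by simp)⟩, rfl⟩⟩

variable {B : Type*} [DivisionRing B]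

/-- The sum `∑ wⁱ y wʲ` over `i + j = m - 1`. -/
def twistedSum (w y : B) : ℕ → B
  | 0 => 0
  | m + 1 => w * twistedSum w y m + y * w ^ m

/-- The commutator with `w` telescopes. Summed over the monomials of a polynomial `p`, it becomes
the commutator of `p(w)` with `y`. -/
theorem mul_twistedSum_sub (w y : B) (m : ℕ) :
    w * twistedSum w y m - twistedSum w y m * w = w ^ m * y - y * w ^ m := by
  induction m with
  | zero => simp [twistedSum]
  | succ m ih =>
    have : w * twistedSum w y (m + 1) - twistedSum w y (m + 1) * w =
        w * (w * twistedSum w y m - twistedSum w y m * w) + w * y * w ^ m - y * w ^ m * w := by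
      simp only [twistedSum]
      noncomm_ring
    rw [this, ih, pow_succ' w m, mul_assoc y, ← pow_succ, pow_succ']
    noncomm_ring

/-- Modulo `fil (j + 1)` the elements `w` and `y` commute, so the `m` summands all agree with `w ^
(m - 1) * y`. The coefficient is that of the derivative of `Xᵐ`. -/
theorem twistedSum_sub_mem {v : DiscVal B} {w y : B} {j : ℤ} (hw : w ∈ v.fil 0)
    (hwy : y * w - w * y ∈ v.fil (j + 1)) (m : ℕ) :
    twistedSum w y m - m * w ^ (m - 1) * y ∈ v.fil (j + 1) := by
  have hpow (m : ℕ) : y * w ^ m - w ^ m * y ∈ v.fil (j + 1) := by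
    induction m with
    | zero => simp
    | succ m ih =>
      have : y * w ^ (m + 1) - w ^ (m + 1) * y =
          (y * w - w * y) * w ^ m + w * (y * w ^ m - w ^ m * y) := by
        rw [pow_succ']; noncomm_ring
      rw [this]
      exact (v.fil _).add_mem
        (DiscVal.mul_mem_fil' (j := 0) (by omega) hwy (v.integer.pow_mem hw m))
        (DiscVal.mul_mem_fil' (i := 0) (by omega) hw ih)
  induction m with
  | zero => simp [twistedSum]
  | succ m ih =>
    have : twistedSum w y (m + 1) - (m + 1 : ℕ) * w ^ (m + 1 - 1) * y =
        w * (twistedSum w y m - m * w ^ (m - 1) * y) + (y * w ^ m - w ^ m * y) := by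
      rcases m with _ | m
      · simp [twistedSum]
      · have h1 : w * ((m + 1 : ℕ) * w ^ m * y) = (m + 1 : ℕ) * w ^ (m + 1) * y := by
          rw [pow_succ', ← mul_assoc, ← mul_assoc, ← mul_assoc, (Nat.cast_commute (m + 1) w).eq]
        simp only [Nat.add_sub_cancel, twistedSum, mul_sub] at h1 ⊢
        rw [h1]
        push_cast
        noncomm_ring
    rw [this]
    exact (v.fil _).add_mem (DiscVal.mul_mem_fil' (i := 0) (by omega) hw ih) (hpow m)

open Polynomial in
-- `z` is the combination of twisted sums with the coefficients of `p`. If `p` kills `w`, then `z`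
-- commutes with `w` exactly, and if `p'(w)` is a unit, then `z` is nonzero with the order of `y`
-- (for `j` that order). This corrects an approximate commutation in one step, without a limit.
theorem exists_commuting_approx {R : Type*} [CommRing R] [Algebra R B] {v : DiscVal B}
    (hR : ∀ a : R, algebraMap R B a ∈ v.fil 0) {w y : B} {j : ℤ} (hw : w ∈ v.fil 0)
    (hwy : y * w - w * y ∈ v.fil (j + 1)) (p : R[X]) :
    ∃ z : B, w * z - z * w = aeval w p * y - y * aeval w p ∧
      z - aeval w (derivative p) * y ∈ v.fil (j + 1) := by
  induction p using Polynomial.induction_on' with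
  | add p q hp hq =>
    obtain ⟨z, h1, h2⟩ := hp
    obtain ⟨z', h1', h2'⟩ := hq
    refine ⟨z + z', ?_, ?_⟩
    · have : w * (z + z') - (z + z') * w = (w * z - z * w) + (w * z' - z' * w) := by noncomm_ring
      rw [this, h1, h1', map_add]
      noncomm_ring
    · have : z + z' - aeval w (derivative (p + q)) * y =
          (z - aeval w (derivative p) * y) + (z' - aeval w (derivative q) * y) := by
        rw [map_add, map_add]; noncomm_ring
      rw [this]
      exact (v.fil _).add_mem h2 h2'
  | monomial m a =>
    refine ⟨a • twistedSum w y m, ?_, ?_⟩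
    · rw [aeval_monomial, ← Algebra.smul_def, mul_smul_comm, smul_mul_assoc, ← smul_sub,
        mul_twistedSum_sub, smul_sub, smul_mul_assoc, mul_smul_comm]
    · have : a • twistedSum w y m - aeval w (derivative (monomial m a)) * y =
          algebraMap R B a * (twistedSum w y m - m * w ^ (m - 1) * y) := by
        rw [derivative_monomial, aeval_monomial, Algebra.smul_def, map_mul, map_natCast]
        noncomm_ring
      rw [this]
      exact DiscVal.mul_mem_fil' (i := 0) (by omega) (hR a) (twistedSum_sub_mem hw hwy m)

end Subfields

/-! ### Ramification and residue field of a central division algebra -/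

section CentralDivision

variable {K : Type*} [Field K] [ValuativeRel K] [TopologicalSpace K]
  [IsNonarchimedeanLocalField K]

theorem ramificationIndex_mul {D D' : Type*} [DivisionRing D] [Algebra K D]
    [FiniteDimensional K D] [DivisionRing D'] [Algebra K D'] [FiniteDimensional K D']
    {v : DiscVal D} {v' : DiscVal D'} (hv : v.IsCompat K) (hv' : v'.IsCompat K)
    {φ : D →ₐ[K] D'} {m : ℕ} (hφ : ∀ x, x ≠ 0 → v'.ord (φ x) = m * v.ord x) :
    ramificationIndex K D' = m * ramificationIndex K D := by
  obtain ⟨vK, hvK⟩ := exists_discVal K K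
  have h1 := (exists_ord_algebraMap hv hvK).2 _ vK.unif_ne_zero
  have h2 := (exists_ord_algebraMap hv' hvK).2 _ vK.unif_ne_zero
  have h0 : algebraMap K D vK.unif ≠ 0 := by simpa using vK.unif_ne_zero
  have h3 := hφ _ h0
  rw [AlgHom.commutes, h2, h1, vK.ord_unif] at h3
  simp only [mul_one] at h3
  exact_mod_cast h3

theorem relIndex_fil_ne_zero {D : Type*} [DivisionRing D] [Algebra K D]
    [FiniteDimensional K D] {v : DiscVal D} (hv : v.IsCompat K) :
    (v.fil 1).relIndex (v.fil 0) ≠ 0 := by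
  rw [hv.relIndex_eq_card]
  exact (pow_pos (zero_lt_one.trans one_lt_card_residueField) _).ne'

variable {B : Type u} [DivisionRing B] [Algebra K B] [Algebra.IsCentral K B]
  [FiniteDimensional K B] {n : ℕ} {v : DiscVal B}

theorem ramificationIndex_mul_residualDegree_le (hn : Module.finrank K B = n ^ 2) {E : Type*}
    [Field E] [Algebra K E] [FiniteDimensional K E] (χ : E →ₐ[K] B) :
    ramificationIndex K E * residualDegree K E ≤ n := by
  rw [← finrank_eq_ramificationIndex_mul]
  have := finrank_sq_le_of_comm χ
  rw [hn] at this
  exact (Nat.pow_le_pow_iff_left two_ne_zero).1 this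

theorem exists_mem_pow_eq {k : Type*} [Field k] [Finite k] (r : v.ResidueMap k) :
    ∃ w : v.integer, ∀ x : k, x ≠ 0 → ∃ i : ℕ, x = r.map w ^ i := by
  obtain ⟨g, hg⟩ := IsCyclic.exists_generator (α := kˣ)
  obtain ⟨w, hw⟩ := r.surj g
  refine ⟨w, fun x hx => ?_⟩
  obtain ⟨i, hi⟩ := (mem_powers_iff_mem_zpowers (x := g)).2 (hg (Units.mk0 x hx))
  refine ⟨i, ?_⟩
  have := congrArg Units.val hi
  simp only [Units.val_pow_eq_pow_val, Units.val_mk0] at this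
  rw [hw, this]

omit [Algebra.IsCentral K B] in
-- The residue field of `E` contains a generator of the multiplicative group of `k`, hence all of
-- `k`.
theorem residualDegree_eq_of_generator (hv : v.IsCompat K) {k : Type*} [Field k] [Finite k]
    (r : v.ResidueMap k) {w : v.integer} (hw : ∀ x : k, x ≠ 0 → ∃ i : ℕ, x = r.map w ^ i)
    {E : Type*} [Field E] [Algebra K E] [FiniteDimensional K E] (χ : E →ₐ[K] B)
    (hE : ∃ x, χ x = w) : residualDegree K E = residualDegree K B := by
  obtain ⟨vE, hvE⟩ := exists_discVal K E
  obtain ⟨m, hm, hχ⟩ := exists_ord_map_eq_mul hvE hv χ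
  obtain ⟨F, hF, hFm⟩ := exists_residueSubfield hm hχ r
  have hw' : r.map w ∈ F := by
    obtain ⟨x, hx⟩ := hE
    have h1 : χ x ∈ v.integer := by rw [hx]; exact w.2
    refine (hFm _).2 ⟨x, h1, (map_mem_fil_zero_iff hm hχ).1 h1, ?_⟩
    congr 1
    exact Subtype.ext hx
  have htop : F = ⊤ := by
    rw [eq_top_iff]
    intro x _
    by_cases hx : x = 0
    · rw [hx]; exact F.zero_mem
    · obtain ⟨i, rfl⟩ := hw x hx
      exact F.pow_mem hw' i
  rw [htop, Nat.card_congr (Subfield.topEquiv (K := k)).toEquiv, r.natCard, hv.relIndex_eq_card,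
    hvE.relIndex_eq_card] at hF
  exact (Nat.pow_right_injective one_lt_card_residueField hF).symm

/-- Every subfield has degree `e f ≤ n`. A lift of a generator of the residue field generates a
subfield with the full residual degree, and a uniformizer generates one with the full ramification,
so both invariants are at most `n`. Their product is `n²`. -/
theorem ramificationIndex_eq_and_residualDegree_eq (hn : Module.finrank K B = n ^ 2)
    (hv : v.IsCompat K) : ramificationIndex K B = n ∧ residualDegree K B = n := by
  obtain ⟨k, _, _, ⟨r⟩⟩ := v.exists_residueMap (relIndex_fil_ne_zero hv)
  obtain ⟨vK, hvK⟩ := exists_discVal K K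
  have hf : residualDegree K B ≤ n := by
    obtain ⟨w, hw⟩ := exists_mem_pow_eq r
    obtain ⟨E, _, _, _, χ, hE, -⟩ := exists_field_of_commute (K := K) (rfl : (w : B) * w = w * w)
    obtain ⟨vE, hvE⟩ := exists_discVal K E
    have h1 := ramificationIndex_mul_residualDegree_le hn χ
    rw [residualDegree_eq_of_generator hv r hw χ hE] at h1
    exact (Nat.le_mul_of_pos_left _ (exists_ord_algebraMap hvE hvK).1).trans h1
  have he : ramificationIndex K B ≤ n := by
    obtain ⟨E, _, _, _, χ, ⟨x, hx⟩, -⟩ :=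
      exists_field_of_commute (K := K) (rfl : v.unif * v.unif = v.unif * v.unif)
    obtain ⟨vE, hvE⟩ := exists_discVal K E
    obtain ⟨m, hm, hχ⟩ := exists_ord_map_eq_mul hvE hv χ
    have hx0 : x ≠ 0 := by
      rintro rfl
      rw [map_zero] at hx
      exact v.unif_ne_zero hx.symm
    have h1 := hχ x hx0
    rw [hx, v.ord_unif] at h1
    have h2 : m = 1 := by
      have : (m : ℤ) ∣ 1 := ⟨_, h1⟩
      exact_mod_cast Int.eq_one_of_dvd_one (by omega) this
    have h3 := ramificationIndex_mul_residualDegree_le hn χ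
    rw [ramificationIndex_mul hvE hv hχ, h2, one_mul]
    refine (Nat.le_mul_of_pos_right _ (Nat.pos_of_ne_zero fun h => ?_)).trans h3
    have h4 := finrank_eq_ramificationIndex_mul K E
    rw [h, mul_zero] at h4
    exact Module.finrank_pos.ne' h4
  have h := finrank_eq_ramificationIndex_mul K B
  rw [hn, sq] at h
  have hpos : 0 < n := Nat.pos_of_ne_zero fun h0 => by
    rw [h0] at hn
    exact (Module.finrank_pos (R := K) (M := B)).ne' hn
  constructor
  · refine le_antisymm he (Nat.le_of_mul_le_mul_right ?_ hpos)
    rw [h]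
    exact Nat.mul_le_mul_left _ hf
  · refine le_antisymm hf (Nat.le_of_mul_le_mul_left ?_ hpos)
    rw [h]
    exact Nat.mul_le_mul_right _ he

open Polynomial in
/-- If conjugation by `y` fixes a generator of the residue field, then `y` can be corrected to
commute with a lift of that generator. -/
theorem exists_commute_of_conj_trivial (hn : Module.finrank K B = n ^ 2)
    (hv : v.IsCompat K) {k : Type*} [Field k] [Finite k] (r : v.ResidueMap k)
    {w : v.integer} (hw : ∀ x : k, x ≠ 0 → ∃ i : ℕ, x = r.map w ^ i) {y : B} (hy : y ≠ 0)
    (hwy : y * w - w * y ∈ v.fil (v.ord y + 1)) :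
    ∃ z : B, z ≠ 0 ∧ v.ord z = v.ord y ∧ w * z = z * w := by
  have hR (a : 𝒪[K]) : algebraMap 𝒪[K] B a ∈ v.integer := (hv _).1 isIntegral_algebraMap
  let ρ : 𝒪[K] →+* v.integer :=
    { toFun := fun a => ⟨algebraMap 𝒪[K] B a, hR a⟩
      map_one' := Subtype.ext (map_one _)
      map_mul' := fun x y => Subtype.ext (map_mul _ _ _)
      map_zero' := Subtype.ext (map_zero _)
      map_add' := fun x y => Subtype.ext (map_add _ _ _) }
  let ρ' : 𝒪[K] →+* k := r.map.comp ρ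
  have hloc : IsLocalHom ρ' := by
    constructor
    intro a ha
    by_contra hna
    obtain ⟨vK, hvK⟩ := exists_discVal K K
    have h1 : a ∈ 𝓂[K] := hna
    rw [hvK.mem_maximalIdeal_iff] at h1
    refine ha.ne_zero ((r.eq_zero_iff _).2 ?_)
    by_cases h0 : (a : K) = 0
    · have : ((ρ a : v.integer) : B) = 0 := by
        change algebraMap K B a = 0
        rw [h0, map_zero]
      rw [this]
      exact zero_mem _
    · have h2 := exists_ord_algebraMap hv hvK
      rw [vK.mem_fil_of_ne h0] at h1
      have h3 : algebraMap K B a ∈ v.fil 1 := by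
        rw [v.mem_fil_of_ne (by simpa using h0), h2.2 _ h0]
        have : (0 : ℤ) < ramificationIndex K B := by exact_mod_cast h2.1
        nlinarith
      exact h3
  let ρk : 𝓀[K] →+* k := IsLocalRing.ResidueField.lift ρ'
  let : Algebra 𝓀[K] k := ρk.toAlgebra
  have hρk (a : 𝒪[K]) : algebraMap 𝓀[K] k (IsLocalRing.residue 𝒪[K] a) = r.map (ρ a) :=
    IsLocalRing.ResidueField.lift_residue_apply ρ' a
  obtain ⟨E, _, _, _, χ, ⟨x, hx⟩, -⟩ := exists_field_of_commute (K := K) (rfl : (w : B) * w = w * w)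
  have hxi : IsIntegral 𝒪[K] x := by
    rw [← isIntegral_algHom_iff (χ.restrictScalars 𝒪[K]) χ.toRingHom.injective]
    change IsIntegral 𝒪[K] (χ x)
    rw [hx]
    exact (hv _).2 w.2
  -- `p` has degree at most `n`, as the degree of a subfield, while the residue of `w` has degree
  -- `n` over the residue field of `K`. So `p` reduces to the minimal polynomial of that residue,
  -- which is separable, and `p'(w)` is a unit.
  set p := minpoly 𝒪[K] x with hp
  have hpm : p.Monic := minpoly.monic hxi
  have hdeg : p.natDegree ≤ n := by
    have h1 : (minpoly K x).natDegree = p.natDegree := by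
      rw [minpoly.isIntegrallyClosed_eq_field_fractions' K hxi, hpm.natDegree_map]
    rw [← h1]
    refine (minpoly.natDegree_le x).trans ?_
    rw [finrank_eq_ramificationIndex_mul]
    exact ramificationIndex_mul_residualDegree_le hn χ
  have hpw : aeval (w : B) p = 0 := by
    have := congrArg (χ.restrictScalars 𝒪[K]) (minpoly.aeval 𝒪[K] x)
    rw [map_zero, ← aeval_algHom_apply] at this
    rw [← this, ← hx]
    rfl
  have hev (P : 𝒪[K][X]) (h : aeval (w : B) P ∈ v.integer) :
      aeval (r.map w) (P.map (IsLocalRing.residue 𝒪[K])) = r.map ⟨aeval (w : B) P, h⟩ := by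
    rw [aeval_def, eval₂_map]
    have h1 : (algebraMap 𝓀[K] k).comp (IsLocalRing.residue 𝒪[K]) = r.map.comp ρ :=
      RingHom.ext hρk
    have h2 : (⟨aeval (w : B) P, h⟩ : v.integer) =
        ∑ i ∈ Finset.range (P.natDegree + 1), ρ (P.coeff i) * w ^ i := by
      apply Subtype.ext
      rw [AddSubmonoidClass.coe_finsetSum]
      simp only [aeval_eq_sum_range, Algebra.smul_def]
      rfl
    rw [h1, eval₂_eq_sum_range, h2, map_sum]
    simp only [map_mul, map_pow, RingHom.comp_apply]
  have hint (P : 𝒪[K][X]) : aeval (w : B) P ∈ v.integer := by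
    rw [aeval_eq_sum_range]
    refine v.integer.sum_mem fun i _ => ?_
    rw [Algebra.smul_def]
    exact v.integer.mul_mem (hR _) (v.integer.pow_mem w.2 i)
  have hfr : Module.finrank 𝓀[K] k = n := by
    have h1 := Module.natCard_eq_pow_finrank (K := 𝓀[K]) (V := k)
    rw [r.natCard, hv.relIndex_eq_card, (ramificationIndex_eq_and_residualDegree_eq hn hv).2] at h1
    exact (Nat.pow_right_injective one_lt_card_residueField h1).symm
  have hmin : (minpoly 𝓀[K] (r.map w)).natDegree = n := by
    rw [← hfr, ← Field.primitive_element_iff_minpoly_natDegree_eq, eq_top_iff]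
    intro x _
    by_cases hx : x = 0
    · rw [hx]; exact zero_mem _
    · obtain ⟨i, rfl⟩ := hw x hx
      exact pow_mem (IntermediateField.mem_adjoin_simple_self _ _) i
  have hroot : aeval (r.map w) (p.map (IsLocalRing.residue 𝒪[K])) = 0 := by
    rw [hev p (hint p), r.eq_zero_iff]
    change aeval (w : B) p ∈ v.fil 1
    rw [hpw]
    exact zero_mem _
  have hwint : IsIntegral 𝓀[K] (r.map w) := Algebra.IsIntegral.isIntegral _
  have heq : p.map (IsLocalRing.residue 𝒪[K]) = minpoly 𝓀[K] (r.map w) :=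
    eq_of_monic_of_dvd_of_natDegree_le (minpoly.monic hwint) (hpm.map _) (minpoly.dvd _ _ hroot)
      (by rw [hmin, hpm.natDegree_map]; exact hdeg)
  have hsep : (p.map (IsLocalRing.residue 𝒪[K])).Separable := by
    rw [heq]
    exact PerfectField.separable_of_irreducible (minpoly.irreducible hwint)
  have hder := hsep.aeval_derivative_ne_zero hroot
  rw [derivative_map, hev _ (hint _), Ne, r.eq_zero_iff] at hder
  obtain ⟨hd0, hd⟩ := v.ord_eq_of_mem_of_notMem (hint (derivative p)) hder
  -- Here `p(w) = 0` makes `z` commute with `w`, and `z` differs from `p'(w) * y` by a term of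
  -- higher order.
  obtain ⟨z, hz1, hz2⟩ := exists_commuting_approx hR w.2 hwy p
  rw [hpw, zero_mul, mul_zero, sub_self] at hz1
  have hdy := mul_ne_zero hd0 hy
  have ho : v.ord (aeval (w : B) (derivative p) * y) = v.ord y := by
    rw [v.ord_mul hd0 hy, hd, zero_add]
  rw [← ho] at hz2
  obtain ⟨h1, h2⟩ := v.ord_add_eq hdy hz2
  rw [add_sub_cancel] at h1 h2
  exact ⟨z, h1, h2.trans ho, sub_eq_zero.1 hz1⟩

/-- Conjugation by a uniformizer generates the Galois group of the residue field. -/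
theorem orderOf_conj_eq (hn : Module.finrank K B = n ^ 2)
    (hv : v.IsCompat K) {k : Type*} [Field k] [Finite k] {r : v.ResidueMap k} {σ : RingAut k}
    (hσ : ∀ x : v.integer, r.map ⟨v.unif * x * v.unif⁻¹, DiscVal.ResidueMap.conj_mem x.2⟩ =
      σ (r.map x)) : orderOf σ = n := by
  obtain ⟨vK, hvK⟩ := exists_discVal K K
  obtain ⟨heB, hfB⟩ := ramificationIndex_eq_and_residualDegree_eq hn hv
  have hk : Nat.card k = Nat.card 𝓀[K] ^ n := by rw [r.natCard, hv.relIndex_eq_card, hfB]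
  have : Finite (RingAut k) := Finite.of_injective (fun f => (f : k → k)) DFunLike.coe_injective
  have hpos : 0 < orderOf σ := orderOf_pos_iff.2 (isOfFinOrder_of_finite σ)
  refine le_antisymm ?_ (not_lt.1 fun hlt => ?_)
  -- At most `n`: `σ` fixes the residue field of the centre `K`, so its fixed field has at least `q`
  -- elements, while `k` has degree `orderOf σ` over that field.
  · obtain ⟨m, hm, hφ⟩ := exists_ord_map_eq_mul hvK hv (Algebra.ofId K B)
    obtain ⟨F, hF, hFm⟩ := exists_residueSubfield hm hφ r
    have hfix : F ≤ FixedPoints.subfield (Subgroup.zpowers (σ ^ 1)) k := by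
      intro y hy
      obtain ⟨x, hx, -, rfl⟩ := (hFm y).1 hy
      rw [mem_fixedPoints, pow_one, ← hσ]
      congr 2
      change v.unif * algebraMap K B x * v.unif⁻¹ = algebraMap K B x
      rw [← Algebra.commutes, mul_assoc, mul_inv_cancel₀ v.unif_ne_zero, mul_one]
    let := Fintype.ofFinite (Subgroup.zpowers (σ ^ 1))
    have h1 := FixedPoints.finrank_eq_card (Subgroup.zpowers (σ ^ 1)) k
    rw [← Nat.card_eq_fintype_card, Nat.card_zpowers] at h1
    have h2 := Module.natCard_eq_pow_finrank
      (K := FixedPoints.subfield (Subgroup.zpowers (σ ^ 1)) k) (V := k)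
    have h3 : Nat.card F ≤ Nat.card (FixedPoints.subfield (Subgroup.zpowers (σ ^ 1)) k) :=
      Nat.card_le_card_of_injective _ (Set.inclusion_injective hfix)
    have h4 : residualDegree K K = 1 := by
      have := finrank_eq_ramificationIndex_mul K K
      rw [Module.finrank_self] at this
      exact Nat.eq_one_of_mul_eq_one_left this.symm
    rw [hF, hvK.relIndex_eq_card, h4, pow_one] at h3
    have h5 : Module.finrank (FixedPoints.subfield (Subgroup.zpowers (σ ^ 1)) k) k = orderOf σ := by
      rw [h1, pow_one]
    rw [hk, h5] at h2
    have h6 := Nat.pow_le_pow_left h3 (orderOf σ)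
    rw [← h2] at h6
    exact (Nat.pow_le_pow_iff_right one_lt_card_residueField).1 h6
  -- At least `n`: the power of the uniformizer with exponent `orderOf σ` acts trivially on `k`, so
  -- some `z` of the same order commutes with a lift `w` of a generator. The field `K(w, z)` has
  -- residual degree `n`, hence is unramified over `K`, and all its orders in `B` are multiples of
  -- `n`.
  · obtain ⟨w, hw⟩ := exists_mem_pow_eq r
    set y := v.unif ^ orderOf σ with hy
    have hy0 : y ≠ 0 := pow_ne_zero _ v.unif_ne_zero
    have hyo : v.ord y = orderOf σ := by
      rw [hy, v.ord_pow v.unif_ne_zero, v.ord_unif, mul_one]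
    have hwy : y * w - w * y ∈ v.fil (v.ord y + 1) := by
      have h1 := DiscVal.ResidueMap.map_conj hσ hy0 hyo w
      rw [pow_orderOf_eq_one, RingAut.one_apply, r.eq_iff] at h1
      have h2 : y * w - w * y = (y * w * y⁻¹ - w) * y := by
        rw [sub_mul, inv_mul_cancel_right₀ hy0]
      rw [h2, add_comm]
      exact DiscVal.mul_mem_fil h1 (v.mem_fil_ord y)
    obtain ⟨z, hz0, hzo, hwz⟩ := exists_commute_of_conj_trivial hn hv r hw hy0 hwy
    obtain ⟨E, _, _, _, χ, hE, ⟨x, hx⟩⟩ := exists_field_of_commute (K := K) hwz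
    obtain ⟨vE, hvE⟩ := exists_discVal K E
    obtain ⟨m, hm, hχ⟩ := exists_ord_map_eq_mul hvE hv χ
    have h1 := ramificationIndex_mul_residualDegree_le hn χ
    rw [residualDegree_eq_of_generator hv r hw χ hE, hfB] at h1
    have h2 := ramificationIndex_mul hvE hv hχ
    have h3 : ramificationIndex K E ≤ 1 := Nat.le_of_mul_le_mul_right (by omega) (by omega : 0 < n)
    have h4 := (exists_ord_algebraMap hvE hvK).1
    have h5 : m = n := by
      rw [show ramificationIndex K E = 1 by omega, mul_one] at h2
      omega
    have hx0 : x ≠ 0 := by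
      rintro rfl
      rw [map_zero] at hx
      exact hz0 hx.symm
    have h6 := hχ x hx0
    rw [hx, hzo, hyo, h5] at h6
    have h7 : n ∣ orderOf σ := by
      have : (n : ℤ) ∣ (orderOf σ : ℤ) := ⟨_, h6⟩
      exact_mod_cast this
    exact absurd (Nat.le_of_dvd hpos h7) (by omega)

end CentralDivision

/-! ### Residue fields of a subalgebra and of its centralizer -/

section Centralizer

variable {K : Type*} [Field K] [ValuativeRel K] [TopologicalSpace K]
  [IsNonarchimedeanLocalField K]
  {B : Type*} [DivisionRing B] [Algebra K B] [FiniteDimensional K B] {n : ℕ} {v : DiscVal B}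
  {L : Type*} [DivisionRing L] [Algebra K L] [FiniteDimensional K L] {vL : DiscVal L}
  {C : Type*} [DivisionRing C] [Algebra K C] [FiniteDimensional K C] {vC : DiscVal C}
  {ψ : L →ₐ[K] B} {φ : C →ₐ[K] B}
  {k : Type*} [Field k] [Finite k] {r : v.ResidueMap k} {σ : RingAut k}

omit [FiniteDimensional K B] [FiniteDimensional K L] [FiniteDimensional K C] [ValuativeRel K]
  [TopologicalSpace K] [IsNonarchimedeanLocalField K] [Finite k] in
/-- The residue field of `C` is fixed by the conjugation with a uniformizer of `L` if `L` and `C`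
commute. -/
theorem conj_eq_self_of_commute (hcomm : ∀ l c, ψ l * φ c = φ c * ψ l)
    (hσ : ∀ x : v.integer, r.map ⟨v.unif * x * v.unif⁻¹, DiscVal.ResidueMap.conj_mem x.2⟩ =
      σ (r.map x)) {mL : ℕ} (hψ : ∀ x, x ≠ 0 → v.ord (ψ x) = mL * vL.ord x)
    {c : C} (hc : φ c ∈ v.integer) :
    (σ ^ mL) (r.map ⟨φ c, hc⟩) = r.map ⟨φ c, hc⟩ := by
  have h0 : ψ vL.unif ≠ 0 := (map_ne_zero_iff ψ ψ.toRingHom.injective).2 vL.unif_ne_zero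
  have ho : v.ord (ψ vL.unif) = mL := by rw [hψ _ vL.unif_ne_zero, vL.ord_unif, mul_one]
  rw [← DiscVal.ResidueMap.map_conj hσ h0 ho]
  congr 2
  change ψ vL.unif * φ c * (ψ vL.unif)⁻¹ = φ c
  rw [hcomm, mul_assoc, mul_inv_cancel₀ h0, mul_one]

/-- The residue field of `C` lies in the fixed field of `σ ^ mL`, which has `q ^ mL` elements
because `mL` divides `n`. -/
theorem residualDegree_le_of_commute (hcomm : ∀ l c, ψ l * φ c = φ c * ψ l)
    (hv : v.IsCompat K) (hvL : vL.IsCompat K) (hvC : vC.IsCompat K) (hn : 0 < n)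
    (heB : ramificationIndex K B = n) (hk : Nat.card k = Nat.card 𝓀[K] ^ n) (hσn : orderOf σ = n)
    (hσ : ∀ x : v.integer, r.map ⟨v.unif * x * v.unif⁻¹, DiscVal.ResidueMap.conj_mem x.2⟩ =
      σ (r.map x)) {mL mC : ℕ} (hψ : ∀ x, x ≠ 0 → v.ord (ψ x) = mL * vL.ord x)
    (hmC : 0 < mC) (hφ : ∀ x, x ≠ 0 → v.ord (φ x) = mC * vC.ord x) :
    residualDegree K C ≤ mL := by
  obtain ⟨F, hF, hFm⟩ := exists_residueSubfield hmC hφ r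
  have hle : F ≤ FixedPoints.subfield (Subgroup.zpowers (σ ^ mL)) k := by
    intro y hy
    obtain ⟨x, hx, -, rfl⟩ := (hFm y).1 hy
    exact mem_fixedPoints.2 (conj_eq_self_of_commute hcomm hσ hψ hx)
  have h3 : Nat.card F ≤ Nat.card (FixedPoints.subfield (Subgroup.zpowers (σ ^ mL)) k) :=
    Nat.card_le_card_of_injective _ (Set.inclusion_injective hle)
  have hdvd : mL ∣ n := by
    rw [← heB, ramificationIndex_mul hvL hv hψ]
    exact Nat.dvd_mul_right _ _
  rw [hF, hvC.relIndex_eq_card, natCard_fixedPoints hn hk hσn, Nat.gcd_eq_right hdvd] at h3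
  exact (Nat.pow_le_pow_iff_right one_lt_card_residueField).1 h3

variable (hcomm : ∀ l c, ψ l * φ c = φ c * ψ l)
  (hC : ∀ b : B, (∀ l, ψ l * b = b * ψ l) → ∃ c, φ c = b)
  (hv : v.IsCompat K) (hvL : vL.IsCompat K) (hvC : vC.IsCompat K) (hn : 0 < n)
  (heB : ramificationIndex K B = n) (hk : Nat.card k = Nat.card 𝓀[K] ^ n) (hσn : orderOf σ = n)
  (hσ : ∀ x : v.integer, r.map ⟨v.unif * x * v.unif⁻¹, DiscVal.ResidueMap.conj_mem x.2⟩ =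
      σ (r.map x)) {mL mC : ℕ} (hmL : 0 < mL) (hψ : ∀ x, x ≠ 0 → v.ord (ψ x) = mL * vL.ord x)
  (hmC : 0 < mC) (hφ : ∀ x, x ≠ 0 → v.ord (φ x) = mC * vC.ord x)

include hcomm hC hv hvL hvC hn heB hk hσn hσ hmL hψ hmC hφ

/-- Ramification over a division subalgebra is the residual degree of its centralizer. -/
theorem residualDegree_centralizer (hdim : Module.finrank K B = n ^ 2) :
    residualDegree K C = mL ∧ residualDegree K L = mC := by
  have h1 := residualDegree_le_of_commute hcomm hv hvL hvC hn heB hk hσn hσ hψ hmC hφ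
  have h2 := residualDegree_le_of_commute (fun l c => (hcomm c l).symm) hv hvC hvL hn heB hk hσn hσ
    hφ hmL hψ
  have h3 := finrank_le_finrank_mul_finrank_centralizer ψ φ hC
  rw [finrank_eq_ramificationIndex_mul K L, finrank_eq_ramificationIndex_mul K C, hdim] at h3
  have h4 := ramificationIndex_mul hvL hv hψ
  have h5 := ramificationIndex_mul hvC hv hφ
  rw [heB] at h4 h5
  set eL := ramificationIndex K L
  set eC := ramificationIndex K C
  set fL := residualDegree K L
  set fC := residualDegree K C
  have heL : 0 < eL := Nat.pos_of_ne_zero fun h => by rw [h] at h4; omega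
  have heC : 0 < eC := Nat.pos_of_ne_zero fun h => by rw [h] at h5; omega
  -- The dimension bound gives `mL * mC ≤ fC * fL`, so neither of the inequalities `h1`, `h2` can be
  -- strict.
  have h6 : mL * mC * (eC * eL) ≤ fC * fL * (eC * eL) := by
    calc mL * mC * (eC * eL) = (mL * eL) * (mC * eC) := by ring
      _ = n ^ 2 := by rw [← h4, ← h5, sq]
      _ ≤ eC * fC * (eL * fL) := h3
      _ = _ := by ring
  have h7 := Nat.le_of_mul_le_mul_right h6 (Nat.mul_pos heC heL)
  constructor
  · refine le_antisymm h1 (Nat.le_of_mul_le_mul_right (h7.trans ?_) hmC)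
    exact Nat.mul_le_mul_left _ h2
  · refine le_antisymm h2 (Nat.le_of_mul_le_mul_left (h7.trans ?_) hmL)
    exact Nat.mul_le_mul_right _ h1

/-- Elements that nearly commute with the integers of `L` are near the centralizer of `L`. -/
theorem exists_near_centralizer (hdim : Module.finrank K B = n ^ 2) {b : B} (hb : b ∈ v.fil 0)
    {s : ℤ} (hs : ∀ l ∈ vL.fil 0, ψ l * b - b * ψ l ∈ v.fil s) (j : ℕ) (hj : j + mL ≤ s) :
    ∃ c ∈ vC.fil 0, b - φ c ∈ v.fil j := by
  obtain ⟨hfC, hfL⟩ := residualDegree_centralizer hcomm hC hv hvL hvC hn heB hk hσn hσ hmL hψ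
    hmC hφ hdim
  have hinj : Function.Injective φ := φ.toRingHom.injective
  induction j with
  | zero => exact ⟨0, zero_mem _, by simpa using hb⟩
  | succ j ih =>
    obtain ⟨c, hc0, hc⟩ := ih (by push_cast at hj; omega)
    by_cases hbc : b - φ c ∈ v.fil (j + 1)
    · exact ⟨c, hc0, by exact_mod_cast hbc⟩
    obtain ⟨h0, ho⟩ := v.ord_eq_of_mem_of_notMem hc hbc
    set b' := b - φ c with hb'
    have hs' : ∀ l ∈ vL.fil 0, ψ l * b' - b' * ψ l ∈ v.fil s := by
      intro l hl
      have : ψ l * b' - b' * ψ l = ψ l * b - b * ψ l := by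
        rw [hb', mul_sub, sub_mul, hcomm]; abel
      rw [this]
      exact hs l hl
    -- Conjugation by `b'` acts as `σ ^ j` on the residue field and fixes that of `L`, which has
    -- degree `mC`. So `C` has elements of order `j` in `B`.
    have hdvd : mC ∣ j := by
      obtain ⟨F, hF, hFm⟩ := exists_residueSubfield hmL hψ r
      rw [hvL.relIndex_eq_card, hfL] at hF
      refine dvd_of_fixed one_lt_card_residueField hn hk hσn hF fun y hy => ?_
      obtain ⟨l, hl, hl0, rfl⟩ := (hFm y).1 hy
      rw [← DiscVal.ResidueMap.map_conj hσ h0 ho, r.eq_iff]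
      have h1 : b' * ψ l * b'⁻¹ - ψ l = -((ψ l * b' - b' * ψ l) * b'⁻¹) := by
        rw [sub_mul (ψ l * b'), mul_inv_cancel_right₀ h0, neg_sub]
      change b' * ψ l * b'⁻¹ - ψ l ∈ v.fil 1
      rw [h1, neg_mem_iff, v.mul_mem_fil_iff_right (inv_ne_zero h0), v.ord_inv h0, ho]
      exact DiscVal.fil_mono (by push_cast at hj; omega) (hs' l hl0)
    obtain ⟨t, ht⟩ := hdvd
    set c₁ := vC.unif ^ t with hc₁
    have hc₁0 : c₁ ≠ 0 := pow_ne_zero t vC.unif_ne_zero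
    have hc₁o : vC.ord c₁ = t := by rw [hc₁, vC.ord_pow vC.unif_ne_zero, vC.ord_unif, mul_one]
    have hφ0 : φ c₁ ≠ 0 := (map_ne_zero_iff φ hinj).2 hc₁0
    have hφo : v.ord (φ c₁) = j := by rw [hφ _ hc₁0, hc₁o, ht]; push_cast; rfl
    set u := b' * (φ c₁)⁻¹ with hu
    have hu0 : u ≠ 0 := mul_ne_zero h0 (inv_ne_zero hφ0)
    have huo : v.ord u = 0 := by
      rw [hu, v.ord_mul h0 (inv_ne_zero hφ0), v.ord_inv hφ0, ho, hφo]; omega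
    have hum : u ∈ v.integer := by rw [v.mem_integer, v.mem_fil_of_ne hu0, huo]
    -- Commuting `u` with a uniformizer of `L` and cancelling that uniformizer costs `mL` in the
    -- order. This is the loss `mL` in the hypothesis on `s`.
    have hfix : (σ ^ mL) (r.map ⟨u, hum⟩) = r.map ⟨u, hum⟩ := by
      have hp0 : ψ vL.unif ≠ 0 := (map_ne_zero_iff ψ ψ.toRingHom.injective).2 vL.unif_ne_zero
      have hpo : v.ord (ψ vL.unif) = mL := by rw [hψ _ vL.unif_ne_zero, vL.ord_unif, mul_one]
      rw [← DiscVal.ResidueMap.map_conj hσ hp0 hpo, r.eq_iff]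
      change ψ vL.unif * u * (ψ vL.unif)⁻¹ - u ∈ v.fil 1
      have hinvc : (φ c₁)⁻¹ * ψ vL.unif = ψ vL.unif * (φ c₁)⁻¹ := by
        rw [← map_inv₀, hcomm]
      have h1 : ψ vL.unif * u * (ψ vL.unif)⁻¹ - u =
          (ψ vL.unif * b' - b' * ψ vL.unif) * (φ c₁)⁻¹ * (ψ vL.unif)⁻¹ := by
        rw [sub_mul, sub_mul, mul_assoc b', ← hinvc, ← mul_assoc b', mul_inv_cancel_right₀ hp0,
          hu, ← mul_assoc]
      rw [h1, v.mul_mem_fil_iff_right (inv_ne_zero hp0), v.mul_mem_fil_iff_right (inv_ne_zero hφ0),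
        v.ord_inv hp0, v.ord_inv hφ0, hpo, hφo]
      refine DiscVal.fil_mono ?_ (hs' vL.unif ?_)
      · push_cast at hj; omega
      · rw [vL.mem_fil_of_ne vL.unif_ne_zero, vL.ord_unif]; decide
    obtain ⟨F, hF, hFm⟩ := exists_residueSubfield hmC hφ r
    -- The residue field of `C` is the whole fixed field of `σ ^ mL`, since `f(C/K) = mL`. Thus the
    -- leading coefficient `u` of `b'` can be lifted to `C`, which improves the approximation by one
    -- order.
    have hFeq : (F : Set k) = FixedPoints.subfield (Subgroup.zpowers (σ ^ mL)) k := by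
      have hle : F ≤ FixedPoints.subfield (Subgroup.zpowers (σ ^ mL)) k := by
        intro y hy
        obtain ⟨x, hx, -, rfl⟩ := (hFm y).1 hy
        exact mem_fixedPoints.2 (conj_eq_self_of_commute hcomm hσ hψ hx)
      have hdvd : mL ∣ n := by
        rw [← heB, ramificationIndex_mul hvL hv hψ]
        exact Nat.dvd_mul_right _ _
      refine Set.eq_of_subset_of_ncard_le hle ?_ (Set.toFinite _)
      change Nat.card (FixedPoints.subfield (Subgroup.zpowers (σ ^ mL)) k) ≤ Nat.card F
      rw [hF, hvC.relIndex_eq_card, natCard_fixedPoints hn hk hσn, Nat.gcd_eq_right hdvd, hfC]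
    have huF : r.map ⟨u, hum⟩ ∈ F := by
      change _ ∈ (F : Set k)
      rw [hFeq]
      exact mem_fixedPoints.2 hfix
    obtain ⟨c₂, hc₂, hc₂0, hc₂r⟩ := (hFm _).1 huF
    have h2 : u - φ c₂ ∈ v.fil 1 := r.eq_iff.1 hc₂r.symm
    refine ⟨c + c₂ * c₁, add_mem hc0 (DiscVal.mul_mem_fil' (i := 0) (j := t) (by omega) hc₂0
      (by rw [← hc₁o]; exact vC.mem_fil_ord _)), ?_⟩
    have h3 : b - φ (c + c₂ * c₁) = (u - φ c₂) * φ c₁ := by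
      rw [sub_mul, hu, inv_mul_cancel_right₀ hφ0, hb', map_add, map_mul, sub_sub]
    rw [h3]
    refine DiscVal.mul_mem_fil' ?_ h2 (v.mem_fil_ord _)
    rw [hφo]; push_cast; omega

/-- Powers of a uniformizer of small order act nontrivially on the residue field of `L`. -/
theorem exists_conj_sub_notMem (hdim : Module.finrank K B = n ^ 2) {i : ℕ} (hi : 0 < i)
    (hi' : i < mC) :
    ∃ l ∈ vL.fil 0, v.unif ^ i * ψ l * (v.unif ^ i)⁻¹ - ψ l ∉ v.fil 1 := by
  obtain ⟨hfC, hfL⟩ := residualDegree_centralizer hcomm hC hv hvL hvC hn heB hk hσn hσ hmL hψ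
    hmC hφ hdim
  by_contra! h
  obtain ⟨F, hF, hFm⟩ := exists_residueSubfield hmL hψ r
  rw [hvL.relIndex_eq_card, hfL] at hF
  -- A trivial action of `σ ^ i` on the residue field of `L`, of degree `mC`, would force `mC ∣ i`.
  have := dvd_of_fixed one_lt_card_residueField hn hk hσn hF (i := i) fun y hy => by
    obtain ⟨l, hl, hl0, rfl⟩ := (hFm y).1 hy
    rw [← DiscVal.ResidueMap.map_conj_unif_pow hσ, r.eq_iff]
    exact h l hl0
  exact absurd (Nat.le_of_dvd hi this) (by omega)

end Centralizer

/-! ### Relative positions of lattices -/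

namespace DiscVal

variable {D : Type*} [DivisionRing D] (v : DiscVal D)

/-- Matrices all of whose entries have order at least `i`. -/
def MatFil (i : ℤ) (X : Matrix (Fin 2) (Fin 2) D) : Prop := ∀ a b, X a b ∈ v.fil i

variable {v}

theorem matFil_mk {i : ℤ} {a b c d : D} :
    v.MatFil i !![a, b; c, d] ↔ a ∈ v.fil i ∧ b ∈ v.fil i ∧ c ∈ v.fil i ∧ d ∈ v.fil i := by
  simp [MatFil, Fin.forall_fin_two, and_assoc]

theorem MatFil.mul {i j : ℤ} {X Y : Matrix (Fin 2) (Fin 2) D} (hX : v.MatFil i X)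
    (hY : v.MatFil j Y) : v.MatFil (i + j) (X * Y) := by
  intro a b
  rw [Matrix.mul_apply]
  exact sum_mem fun c _ => mul_mem_fil (hX a c) (hY c b)

theorem matFil_one : v.MatFil 0 (1 : Matrix (Fin 2) (Fin 2) D) := by
  rw [Matrix.one_fin_two, matFil_mk]
  exact ⟨v.one_mem_fil, zero_mem _, zero_mem _, v.one_mem_fil⟩

variable (v)

/-- The lattices `g 𝒪²` and `h 𝒪²` are at distance at most `r`, up to scaling. -/
def Within (r : ℤ) (g h : (Matrix (Fin 2) (Fin 2) D)ˣ) : Prop :=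
  ∃ i : ℤ, v.MatFil i (g⁻¹ * h : (Matrix (Fin 2) (Fin 2) D)ˣ) ∧
    v.MatFil (-r - i) (h⁻¹ * g : (Matrix (Fin 2) (Fin 2) D)ˣ)

variable {v}

theorem Within.refl (g : (Matrix (Fin 2) (Fin 2) D)ˣ) : v.Within 0 g g :=
  ⟨0, by simpa using matFil_one, by simpa using matFil_one⟩

theorem Within.symm {r : ℤ} {g h : (Matrix (Fin 2) (Fin 2) D)ˣ} (H : v.Within r g h) :
    v.Within r h g := by
  obtain ⟨i, h1, h2⟩ := H
  exact ⟨-r - i, h2, by convert h1 using 1; omega⟩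

theorem Within.trans {r s : ℤ} {g h l : (Matrix (Fin 2) (Fin 2) D)ˣ} (H : v.Within r g h)
    (H' : v.Within s h l) : v.Within (r + s) g l := by
  obtain ⟨i, h1, h2⟩ := H
  obtain ⟨j, h3, h4⟩ := H'
  refine ⟨i + j, ?_, ?_⟩
  · have := h1.mul h3
    rw [← Units.val_mul] at this
    convert this using 2
    group
  · have := h4.mul h2
    rw [← Units.val_mul] at this
    convert this using 2
    · omega
    · group

theorem within_mul_left {r : ℤ} {x g h : (Matrix (Fin 2) (Fin 2) D)ˣ} :
    v.Within r (x * g) (x * h) ↔ v.Within r g h := by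
  unfold Within
  have h1 : (x * g)⁻¹ * (x * h) = g⁻¹ * h := by group
  have h2 : (x * h)⁻¹ * (x * g) = h⁻¹ * g := by group
  rw [h1, h2]

theorem Within.trans_zero {r : ℤ} {g h l : (Matrix (Fin 2) (Fin 2) D)ˣ} (H : v.Within r g h)
    (H' : v.Within 0 h l) : v.Within r g l := by
  simpa using H.trans H'

theorem Within.zero_trans {r : ℤ} {g h l : (Matrix (Fin 2) (Fin 2) D)ˣ} (H : v.Within 0 g h)
    (H' : v.Within r h l) : v.Within r g l := by
  simpa using H.trans H'

theorem within_of_mul {r i : ℤ} {g x : (Matrix (Fin 2) (Fin 2) D)ˣ}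
    (h1 : v.MatFil i (x : Matrix (Fin 2) (Fin 2) D))
    (h2 : v.MatFil (-r - i) (x⁻¹ : (Matrix (Fin 2) (Fin 2) D)ˣ)) :
    v.Within r g (g * x) :=
  ⟨i, by simpa using h1, by simpa using h2⟩

variable (v)

/-- The matrix `[1, 0; b, πʳ]`. -/
def low (b : D) (r : ℕ) : (Matrix (Fin 2) (Fin 2) D)ˣ where
  val := !![1, 0; b, v.unif ^ r]
  inv := !![1, 0; -((v.unif ^ r)⁻¹ * b), (v.unif ^ r)⁻¹]
  val_inv := by
    have := pow_ne_zero r v.unif_ne_zero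
    simp [Matrix.one_fin_two, this]
  inv_val := by
    have := pow_ne_zero r v.unif_ne_zero
    simp [Matrix.one_fin_two, this]

theorem coe_low (b : D) (r : ℕ) :
    (v.low b r : Matrix (Fin 2) (Fin 2) D) = !![1, 0; b, v.unif ^ r] := rfl

theorem coe_low_inv (b : D) (r : ℕ) : ((v.low b r)⁻¹ : (Matrix (Fin 2) (Fin 2) D)ˣ).val =
    !![1, 0; -((v.unif ^ r)⁻¹ * b), (v.unif ^ r)⁻¹] := rfl

variable (D) in
/-- The permutation matrix `[0, 1; 1, 0]`. -/
def swap : (Matrix (Fin 2) (Fin 2) D)ˣ where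
  val := !![0, 1; 1, 0]
  inv := !![0, 1; 1, 0]
  val_inv := by simp [Matrix.one_fin_two]
  inv_val := by simp [Matrix.one_fin_two]

theorem coe_swap : (swap D : Matrix (Fin 2) (Fin 2) D) = !![0, 1; 1, 0] := rfl

theorem coe_swap_inv : ((swap D)⁻¹ : (Matrix (Fin 2) (Fin 2) D)ˣ).val = !![0, 1; 1, 0] := rfl

/-- The matrix `[a, b; 0, d]`. -/
def tri {a d : D} (ha : a ≠ 0) (b : D) (hd : d ≠ 0) : (Matrix (Fin 2) (Fin 2) D)ˣ where
  val := !![a, b; 0, d]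
  inv := !![a⁻¹, -(a⁻¹ * b * d⁻¹); 0, d⁻¹]
  val_inv := by simp [Matrix.one_fin_two, ha, hd, ← mul_assoc]
  inv_val := by simp [Matrix.one_fin_two, ha, hd]

theorem ord_unif_pow (r : ℕ) : v.ord (v.unif ^ r) = r := by
  rw [v.ord_pow v.unif_ne_zero, v.ord_unif, mul_one]

theorem unif_pow_ne_zero (r : ℕ) : v.unif ^ r ≠ 0 := pow_ne_zero r v.unif_ne_zero

theorem unif_pow_mem (r : ℕ) : v.unif ^ r ∈ v.fil r := fun _ => (v.ord_unif_pow r).ge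

theorem unif_pow_inv_mem (r : ℕ) : (v.unif ^ r)⁻¹ ∈ v.fil (-r) := fun _ => by
  rw [v.ord_inv (v.unif_pow_ne_zero r), v.ord_unif_pow]

theorem inv_unif_pow_mul_mem_iff {r : ℕ} {x : D} {i : ℤ} :
    (v.unif ^ r)⁻¹ * x ∈ v.fil i ↔ x ∈ v.fil (i + r) := by
  rw [v.mul_mem_fil_iff_left (inv_ne_zero (v.unif_pow_ne_zero r)),
    v.ord_inv (v.unif_pow_ne_zero r), v.ord_unif_pow, sub_neg_eq_add]

theorem mul_unif_pow_mem_iff {r : ℕ} {x : D} {i : ℤ} :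
    x * v.unif ^ r ∈ v.fil i ↔ x ∈ v.fil (i - r) := by
  rw [v.mul_mem_fil_iff_right (v.unif_pow_ne_zero r), v.ord_unif_pow]

theorem low_mul_low (b b' : D) (r s : ℕ) :
    v.low b r * v.low b' s = v.low (b + v.unif ^ r * b') (r + s) := by
  apply Units.ext
  simp [coe_low, pow_add]

theorem low_mul_low_zero (b : D) (r s : ℕ) : v.low b r * v.low 0 s = v.low b (r + s) := by
  rw [low_mul_low, mul_zero, add_zero]

theorem low_inv_mul_low (b b' : D) (r : ℕ) :
    ((v.low b r)⁻¹ * v.low b' r : (Matrix (Fin 2) (Fin 2) D)ˣ).val =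
      !![1, 0; (v.unif ^ r)⁻¹ * (b' - b), 1] := by
  have := v.unif_pow_ne_zero r
  rw [Units.val_mul, coe_low_inv, coe_low, Matrix.mul_fin_two]
  simp [this, mul_add, sub_eq_add_neg, add_comm]

variable {v}

theorem within_low_iff {b b' : D} {r : ℕ} :
    v.Within 0 (v.low b r) (v.low b' r) ↔ b - b' ∈ v.fil r := by
  have hs (i : ℤ) : b' - b ∈ v.fil i ↔ b - b' ∈ v.fil i := by rw [← neg_mem_iff, neg_sub]
  constructor
  · rintro ⟨i, h1, h2⟩
    rw [low_inv_mul_low, matFil_mk] at h1 h2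
    have h3 := v.one_mem_fil_iff.1 h1.1
    have h4 := v.one_mem_fil_iff.1 h2.1
    have h5 := h1.2.2.1
    rw [v.inv_unif_pow_mul_mem_iff, hs] at h5
    exact fil_mono (by omega) h5
  · intro h
    refine ⟨0, ?_, ?_⟩
    · rw [low_inv_mul_low, matFil_mk]
      refine ⟨v.one_mem_fil, zero_mem _, ?_, v.one_mem_fil⟩
      rw [v.inv_unif_pow_mul_mem_iff, hs, zero_add]
      exact h
    · rw [low_inv_mul_low, matFil_mk]
      refine ⟨v.one_mem_fil, zero_mem _, ?_, v.one_mem_fil⟩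
      rw [v.inv_unif_pow_mul_mem_iff]
      exact fil_mono (by omega) h

theorem within_swap (g : (Matrix (Fin 2) (Fin 2) D)ˣ) : v.Within 0 g (g * swap D) := by
  refine within_of_mul (i := 0) ?_ ?_
  · rw [coe_swap, matFil_mk]
    exact ⟨zero_mem _, v.one_mem_fil, v.one_mem_fil, zero_mem _⟩
  · rw [coe_swap_inv, matFil_mk]
    exact ⟨zero_mem _, v.one_mem_fil, v.one_mem_fil, zero_mem _⟩

theorem within_low {b : D} (hb : b ∈ v.fil 0) (g : (Matrix (Fin 2) (Fin 2) D)ˣ) (r : ℕ) :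
    v.Within r g (g * v.low b r) := by
  refine within_of_mul (i := 0) ?_ ?_
  · rw [coe_low, matFil_mk]
    exact ⟨v.one_mem_fil, zero_mem _, hb, fil_mono (by omega) (v.unif_pow_mem r)⟩
  · rw [coe_low_inv, matFil_mk]
    refine ⟨fil_mono (by omega) v.one_mem_fil, zero_mem _, ?_,
      fil_mono (by omega) (v.unif_pow_inv_mem r)⟩
    rw [neg_mem_iff, v.inv_unif_pow_mul_mem_iff]
    exact fil_mono (by omega) hb

theorem within_low_zero {b : D} (hb : b ∈ v.fil 0) (g : (Matrix (Fin 2) (Fin 2) D)ˣ) :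
    v.Within 0 g (g * v.low b 0) := within_low hb g 0

/-- The entry `1` of `low b r` forces the scaling exponent to be at most `0`, and the entry `(πʳ)⁻¹`
of its inverse then forces `r ≤ t`. So `low b r` really moves a lattice by `r`. -/
theorem le_of_within_low {b : D} {g : (Matrix (Fin 2) (Fin 2) D)ˣ} {r : ℕ} {t : ℤ}
    (h : v.Within t g (g * v.low b r)) : (r : ℤ) ≤ t := by
  obtain ⟨i, h1, h2⟩ := h
  rw [inv_mul_cancel_left, coe_low, matFil_mk] at h1
  rw [show (g * v.low b r)⁻¹ * g = (v.low b r)⁻¹ by group, coe_low_inv, matFil_mk] at h2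
  have h3 := v.one_mem_fil_iff.1 h1.1
  have h4 := h2.2.2.2
  rw [v.mem_fil_of_ne (inv_ne_zero (v.unif_pow_ne_zero r)), v.ord_inv (v.unif_pow_ne_zero r),
    v.ord_unif_pow] at h4
  omega

/-- Going back along an edge. -/
theorem within_low_swap_low (g : (Matrix (Fin 2) (Fin 2) D)ˣ) :
    v.Within 0 g (g * v.low 0 1 * swap D * v.low 0 1) := by
  have h1 : (v.low 0 1 * swap D * v.low 0 1 : (Matrix (Fin 2) (Fin 2) D)ˣ).val =
      !![0, v.unif; v.unif, 0] := by
    simp [Units.val_mul, coe_low, coe_swap]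
  have h2 : ((v.low 0 1 * swap D * v.low 0 1)⁻¹ : (Matrix (Fin 2) (Fin 2) D)ˣ).val =
      !![0, v.unif⁻¹; v.unif⁻¹, 0] := by
    simp [mul_inv_rev, Units.val_mul, coe_low_inv, coe_swap_inv]
  have hu := v.unif_pow_mem 1
  have hi := v.unif_pow_inv_mem 1
  rw [pow_one] at hu hi
  have := within_of_mul (v := v) (r := 0) (i := 1) (g := g) (x := v.low 0 1 * swap D * v.low 0 1)
    (by rw [h1, matFil_mk]; exact ⟨zero_mem _, hu, hu, zero_mem _⟩)
    (by rw [h2, matFil_mk]; exact ⟨zero_mem _, hi, hi, zero_mem _⟩)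
  rwa [← mul_assoc, ← mul_assoc] at this

/-- Elimination: with the upper left entry of minimal order `i`, the matrix is `low β r` times an
upper triangular matrix whose entries have order at least `i` and whose inverse has entries of order
at least `-i`. The second factor only rescales the standard lattice. The exponent `r` is the excess
of the order of the remaining pivot over `i`. -/
theorem within_low_of_minimal {x : (Matrix (Fin 2) (Fin 2) D)ˣ}
    (h0 : x.val 0 0 ≠ 0) (hmin : v.MatFil (v.ord (x.val 0 0)) x.val) :
    ∃ r : ℕ, v.Within 0 (v.low (x.val 1 0 * (x.val 0 0)⁻¹) r) x := by
  set i := v.ord (x.val 0 0) with hi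
  set β := x.val 1 0 * (x.val 0 0)⁻¹ with hβ
  have hβm : β ∈ v.fil 0 := by
    rw [hβ, v.mul_mem_fil_iff_right (inv_ne_zero h0), v.ord_inv h0]
    exact fil_mono (by omega) (hmin 1 0)
  set y := x.val 1 1 - β * x.val 0 1 with hy
  have hym : y ∈ v.fil i := sub_mem (hmin 1 1) (mul_mem_fil' (by omega) hβm (hmin 0 1))
  -- Otherwise the second row would be a left multiple of the first, against invertibility.
  have hy0 : y ≠ 0 := by
    intro hy0
    have h1 : !![-β, 1; 0, 0] * x.val = 0 := by
      rw [Matrix.eta_fin_two x.val, Matrix.mul_fin_two]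
      have h2 : -β * x.val 0 1 + 1 * x.val 1 1 = 0 := by
        rw [← hy0, hy]; noncomm_ring
      have h3 : -β * x.val 0 0 + 1 * x.val 1 0 = 0 := by
        rw [hβ, neg_mul, inv_mul_cancel_right₀ h0, one_mul, neg_add_cancel]
      rw [h2, h3]
      ext a b
      fin_cases a <;> fin_cases b <;> simp
    have h2 : (!![-β, 1; 0, 0] : Matrix (Fin 2) (Fin 2) D) = 0 := by
      have := congrArg (· * (x⁻¹).val) h1
      simpa [mul_assoc] using this
    have := congrFun (congrFun h2 0) 1
    simp at this
  have hyi : i ≤ v.ord y := hym hy0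
  obtain ⟨r, hr⟩ := Int.eq_ofNat_of_zero_le (by omega : 0 ≤ v.ord y - i)
  set d := (v.unif ^ r)⁻¹ * y with hd
  have hd0 : d ≠ 0 := mul_ne_zero (inv_ne_zero (v.unif_pow_ne_zero r)) hy0
  have hdo : v.ord d = i := by
    rw [hd, v.ord_mul (inv_ne_zero (v.unif_pow_ne_zero r)) hy0, v.ord_inv (v.unif_pow_ne_zero r),
      v.ord_unif_pow]
    omega
  refine ⟨r, ?_⟩
  have hx : x = v.low β r * tri h0 (x.val 0 1) hd0 := by
    apply Units.ext
    rw [Units.val_mul, coe_low]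
    change x.val = !![1, 0; β, v.unif ^ r] * !![x.val 0 0, x.val 0 1; 0, d]
    have h2 : β * x.val 0 1 + v.unif ^ r * d = x.val 1 1 := by
      rw [hd, mul_inv_cancel_left₀ (v.unif_pow_ne_zero r), hy, add_sub_cancel]
    have h3 : β * x.val 0 0 = x.val 1 0 := by rw [hβ, inv_mul_cancel_right₀ h0]
    rw [Matrix.mul_fin_two, h2, h3]
    simp only [one_mul, zero_mul, add_zero, mul_zero]
    exact Matrix.eta_fin_two x.val
  have h00i : (x.val 0 0)⁻¹ ∈ v.fil (-i) := fun _ => by rw [v.ord_inv h0]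
  have hdi : d⁻¹ ∈ v.fil (-i) := fun _ => by rw [v.ord_inv hd0, hdo]
  have hdm : d ∈ v.fil i := by rw [← hdo]; exact v.mem_fil_ord d
  have key : v.Within 0 (v.low β r) (v.low β r * tri h0 (x.val 0 1) hd0) := by
    refine within_of_mul (i := i) ?_ ?_
    · change v.MatFil i !![x.val 0 0, x.val 0 1; 0, d]
      rw [matFil_mk]
      exact ⟨hmin 0 0, hmin 0 1, zero_mem _, hdm⟩
    · change v.MatFil (-0 - i) !![(x.val 0 0)⁻¹, -((x.val 0 0)⁻¹ * x.val 0 1 * d⁻¹); 0, d⁻¹]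
      rw [matFil_mk, neg_zero, zero_sub]
      refine ⟨h00i, neg_mem ?_, zero_mem _, hdi⟩
      exact mul_mem_fil' (by omega) (mul_mem_fil h00i (hmin 0 1)) hdi
  rwa [← hx] at key

theorem exists_matFil_ord (x : (Matrix (Fin 2) (Fin 2) D)ˣ) :
    ∃ p : Fin 2 × Fin 2, x.val p.1 p.2 ≠ 0 ∧ v.MatFil (v.ord (x.val p.1 p.2)) x.val := by
  classical
  have hne : ∃ p : Fin 2 × Fin 2, x.val p.1 p.2 ≠ 0 := by
    by_contra! h
    have hx : x.val = 0 := by ext a b; exact h (a, b)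
    exact x.ne_zero hx
  obtain ⟨p, hp, hpmin⟩ := Finset.exists_min_image
    (Finset.univ.filter fun p : Fin 2 × Fin 2 => x.val p.1 p.2 ≠ 0) (fun p => v.ord (x.val p.1 p.2))
    (by obtain ⟨p, hp⟩ := hne; exact ⟨p, by simpa using hp⟩)
  exact ⟨p, by simpa using hp, fun a b h => hpmin (a, b) (by simpa using h)⟩

/-- Relative positions of lattices: every lattice has, up to scaling, a basis
`(1, b), (0, πʳ)` or `(b, 1), (πʳ, 0)`, with `b` of positive order in the second case. -/
theorem exists_within_low (x : (Matrix (Fin 2) (Fin 2) D)ˣ) :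
    (∃ b ∈ v.fil 0, ∃ r : ℕ, v.Within 0 (v.low b r) x) ∨
    ∃ b ∈ v.fil 1, ∃ r : ℕ, v.Within 0 (swap D * v.low b r) x := by
  have hcol (b : Fin 2) (y : (Matrix (Fin 2) (Fin 2) D)ˣ) (h0 : y.val 0 b ≠ 0)
      (hmin : v.MatFil (v.ord (y.val 0 b)) y.val) :
      ∃ r : ℕ, v.Within 0 (v.low (y.val 1 b * (y.val 0 b)⁻¹) r) y := by
    fin_cases b
    · exact within_low_of_minimal h0 hmin
    · have h1 (a : Fin 2) : (y * swap D).val a 0 = y.val a 1 := by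
        rw [Units.val_mul, coe_swap, Matrix.eta_fin_two y.val, Matrix.mul_fin_two]
        fin_cases a <;> simp
      have h2 : v.MatFil (v.ord (y.val 0 1)) (y * swap D).val := by
        have := hmin.mul (Y := (swap D).val) (j := 0) (by
          rw [coe_swap, matFil_mk]
          exact ⟨zero_mem _, v.one_mem_fil, v.one_mem_fil, zero_mem _⟩)
        simpa using this
      obtain ⟨r, hr⟩ := within_low_of_minimal (v := v) (x := y * swap D)
        (by rw [h1]; exact h0) (by rw [h1]; exact h2)
      rw [h1, h1] at hr
      exact ⟨r, hr.trans_zero (within_swap y).symm⟩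
  obtain ⟨p, hp0, hmin⟩ := exists_matFil_ord (v := v) x
  -- If the minimal order is attained in the first row, that entry is the pivot. Otherwise it is
  -- attained in the second row only, and after the swap the quotient `b` has positive order.
  by_cases hrow : ∃ b, x.val 0 b ∉ v.fil (v.ord (x.val p.1 p.2) + 1)
  · obtain ⟨b, hb⟩ := hrow
    obtain ⟨h0, ho⟩ := v.ord_eq_of_mem_of_notMem (hmin 0 b) hb
    rw [← ho] at hmin
    obtain ⟨r, hr⟩ := hcol b x h0 hmin
    refine Or.inl ⟨_, ?_, r, hr⟩
    rw [v.mul_mem_fil_iff_right (inv_ne_zero h0), v.ord_inv h0]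
    exact fil_mono (by omega) (hmin 1 b)
  · push Not at hrow
    right
    have hp1 : p.1 = 1 := by
      by_contra h
      have h00 : p.1 = 0 := by omega
      have := hrow p.2
      rw [← h00, v.mem_fil_of_ne hp0] at this
      omega
    have h1 (b : Fin 2) : (swap D * x).val 0 b = x.val 1 b := by
      rw [Units.val_mul, coe_swap, Matrix.eta_fin_two x.val, Matrix.mul_fin_two]
      fin_cases b <;> simp
    have h1' (b : Fin 2) : (swap D * x).val 1 b = x.val 0 b := by
      rw [Units.val_mul, coe_swap, Matrix.eta_fin_two x.val, Matrix.mul_fin_two]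
      fin_cases b <;> simp
    rw [hp1] at hp0 hmin hrow
    obtain ⟨r, hr⟩ := hcol p.2 (swap D * x) (by rw [h1]; exact hp0) (by
      rw [h1]
      intro a b
      fin_cases a
      · simpa [h1] using hmin 1 b
      · simpa [h1'] using hmin 0 b)
    rw [h1, h1'] at hr
    refine ⟨x.val 0 p.2 * (x.val 1 p.2)⁻¹, ?_, r, ?_⟩
    · rw [v.mul_mem_fil_iff_right (inv_ne_zero hp0), v.ord_inv hp0]
      exact fil_mono (by omega) (hrow p.2)
    · rw [← within_mul_left (x := swap D), ← mul_assoc] at hr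
      have : swap D * swap D = 1 := by
        apply Units.ext
        simp [coe_swap, Matrix.one_fin_two]
      rwa [this, one_mul] at hr

/-- The lattices adjacent to `g 𝒪²`. -/
theorem exists_of_within_one {g h : (Matrix (Fin 2) (Fin 2) D)ˣ} (H : v.Within 1 g h)
    (H0 : ¬ v.Within 0 g h) :
    (∃ b ∈ v.fil 0, v.Within 0 (g * v.low b 1) h) ∨ v.Within 0 (g * swap D * v.low 0 1) h := by
  rcases exists_within_low (v := v) (g⁻¹ * h) with ⟨b, hb, r, hr⟩ | ⟨b, hb, r, hr⟩
  · left
    rw [← within_mul_left (x := g), mul_inv_cancel_left] at hr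
    have h1 : (r : ℤ) ≤ 1 := le_of_within_low (H.trans_zero hr.symm)
    have h2 : r ≠ 0 := by
      rintro rfl
      exact H0 ((within_low_zero hb g).trans_zero hr)
    obtain rfl : r = 1 := by omega
    exact ⟨b, hb, hr⟩
  · right
    rw [← within_mul_left (x := g), mul_inv_cancel_left, ← mul_assoc] at hr
    have h1 : (r : ℤ) ≤ 1 :=
      le_of_within_low (((within_swap g).symm.zero_trans H).trans_zero hr.symm)
    have h2 : r ≠ 0 := by
      rintro rfl
      exact H0 (((within_swap g).trans_zero (within_low_zero (fil_mono (by omega) hb) _)).trans_zero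
        hr)
    obtain rfl : r = 1 := by omega
    -- `b` has positive order, so `low b 1` and `low 0 1` give the same lattice and this case yields
    -- a single neighbour.
    refine Within.trans_zero ?_ hr
    rw [within_mul_left, within_low_iff, zero_sub, neg_mem_iff]
    exact hb

end DiscVal

/-! ### Maximal orders as endomorphism rings of lattices -/

section Lattices

variable {K : Type*} [Field K] [ValuativeRel K] [TopologicalSpace K]
  [IsNonarchimedeanLocalField K] {D : Type*} [DivisionRing D] [Algebra K D]
  [FiniteDimensional K D] {v : DiscVal D}

namespace DiscVal.IsCompat

theorem mem_integers_iff (hv : v.IsCompat K) {x : D} : x ∈ integers K D ↔ x ∈ v.fil 0 := hv x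

omit [TopologicalSpace K] [IsNonarchimedeanLocalField K] [FiniteDimensional K D] in
theorem algebraMap_mem (hv : v.IsCompat K) (a : 𝒪[K]) : algebraMap 𝒪[K] D a ∈ v.fil 0 :=
  (hv _).1 isIntegral_algebraMap

theorem smul_mem (hv : v.IsCompat K) (a : 𝒪[K]) {x : D} {i : ℤ} (hx : x ∈ v.fil i) :
    a • x ∈ v.fil i := by
  rw [Algebra.smul_def]
  exact DiscVal.mul_mem_fil' (by omega) (hv.algebraMap_mem a) hx

/-- The lattice `g 𝒪²`. -/
def lattice (hv : v.IsCompat K) (g : (Matrix (Fin 2) (Fin 2) D)ˣ) :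
    Submodule 𝒪[K] (Fin 2 → D) where
  carrier := {z | ∀ i, ((g⁻¹).val.mulVec z) i ∈ v.fil 0}
  zero_mem' i := by rw [Matrix.mulVec_zero]; exact zero_mem _
  add_mem' {x y} hx hy i := by rw [Matrix.mulVec_add]; exact add_mem (hx i) (hy i)
  smul_mem' a x hx i := by rw [Matrix.mulVec_smul]; exact hv.smul_mem a (hx i)

theorem mem_lattice (hv : v.IsCompat K) {g : (Matrix (Fin 2) (Fin 2) D)ˣ} {z : Fin 2 → D} :
    z ∈ hv.lattice g ↔ ∀ i, ((g⁻¹).val.mulVec z) i ∈ v.fil 0 := Iff.rfl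

/-- The order `End (g 𝒪²)`. -/
def endOrder (hv : v.IsCompat K) (g : (Matrix (Fin 2) (Fin 2) D)ˣ) :
    Subalgebra 𝒪[K] (Matrix (Fin 2) (Fin 2) D) where
  carrier := {A | v.MatFil 0 ((g⁻¹).val * A * g.val)}
  mul_mem' {A B} hA hB := by
    have := DiscVal.MatFil.mul hA hB
    change v.MatFil 0 _
    simpa only [zero_add, mul_assoc, Units.mul_inv_cancel_left] using this
  add_mem' {A B} hA hB a b := by
    rw [mul_add, add_mul]
    exact add_mem (hA a b) (hB a b)
  algebraMap_mem' a := by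
    change v.MatFil 0 _
    rw [← Algebra.commutes, mul_assoc, Units.inv_mul, mul_one, Matrix.algebraMap_eq_diagonal]
    intro i j
    by_cases h : i = j
    · subst h
      rw [Matrix.diagonal_apply_eq]
      exact hv.algebraMap_mem a
    · rw [Matrix.diagonal_apply_ne _ h]
      exact zero_mem _

theorem mem_endOrder (hv : v.IsCompat K) {g : (Matrix (Fin 2) (Fin 2) D)ˣ}
    {A : Matrix (Fin 2) (Fin 2) D} :
    A ∈ hv.endOrder g ↔ v.MatFil 0 ((g⁻¹).val * A * g.val) := Iff.rfl

end DiscVal.IsCompat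

theorem matFil_iff_mulVec {X : Matrix (Fin 2) (Fin 2) D} {i : ℤ} : v.MatFil i X ↔
    ∀ z : Fin 2 → D, (∀ j, z j ∈ v.fil 0) → ∀ j, (X.mulVec z) j ∈ v.fil i := by
  constructor
  · intro h z hz j
    change ∑ k, X j k * z k ∈ v.fil i
    exact sum_mem fun k _ => DiscVal.mul_mem_fil' (i := i) (j := 0) (by omega) (h j k) (hz k)
  · intro h a b
    have := h (Pi.single b 1) (fun j => by
      by_cases hj : j = b
      · subst hj; rw [Pi.single_eq_same]; exact v.one_mem_fil
      · rw [Pi.single_eq_of_ne hj]; exact zero_mem _) a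
    simpa using this

theorem mulVec_mem_lattice_iff (hv : v.IsCompat K) {g h : (Matrix (Fin 2) (Fin 2) D)ˣ}
    {A : Matrix (Fin 2) (Fin 2) D} : (∀ z ∈ hv.lattice g, A.mulVec z ∈ hv.lattice h) ↔
      v.MatFil 0 ((h⁻¹).val * A * g.val) := by
  rw [matFil_iff_mulVec]
  constructor
  · intro H z hz j
    have := H (g.val.mulVec z) (by
      rw [hv.mem_lattice, Matrix.mulVec_mulVec, Units.inv_mul, Matrix.one_mulVec]; exact hz) j
    simpa only [Matrix.mulVec_mulVec, mul_assoc] using this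
  · intro H z hz j
    have := H _ hz j
    simpa only [Matrix.mulVec_mulVec, mul_assoc, Units.mul_inv, mul_one] using this

theorem lattice_le_lattice_iff (hv : v.IsCompat K) {g h : (Matrix (Fin 2) (Fin 2) D)ˣ} :
    hv.lattice g ≤ hv.lattice h ↔ v.MatFil 0 (h⁻¹ * g : (Matrix (Fin 2) (Fin 2) D)ˣ) := by
  have := mulVec_mem_lattice_iff hv (g := g) (h := h) (A := 1)
  simp only [Matrix.one_mulVec, mul_one, ← Units.val_mul] at this
  exact this

variable (K) in
theorem exists_smul_forall_mem {ι : Type*} [Finite ι] (hv : v.IsCompat K) (z : ι → D) :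
    ∃ a : 𝒪[K], a ≠ 0 ∧ ∀ i, a • z i ∈ v.fil 0 := by
  classical
  have := Fintype.ofFinite ι
  choose a ha h using fun i => exists_smul_mem_integers K D (z i)
  refine ⟨∏ i, a i, Finset.prod_ne_zero_iff.2 fun i _ => ha i, fun i => ?_⟩
  rw [← Finset.prod_erase_mul _ _ (Finset.mem_univ i), mul_smul]
  exact hv.smul_mem _ (hv.mem_integers_iff.1 (h i))

omit [TopologicalSpace K] [IsNonarchimedeanLocalField K] in
variable (K) in
theorem smul_inv_mem_span {M : Type*} [AddCommGroup M] [Module 𝒪[K] M] [Module K M]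
    [IsScalarTower 𝒪[K] K M] {a : 𝒪[K]} (ha : a ≠ 0) {s : Set M} {x : M} (h : a • x ∈ s) :
    x ∈ Submodule.span K s := by
  have : x = (a : K)⁻¹ • (a • x) := by
    rw [← algebraMap_smul K a x, smul_smul]
    have h0 : (a : K) ≠ 0 := fun h => ha (Subtype.ext h)
    change x = ((a : K)⁻¹ * (a : K)) • x
    rw [inv_mul_cancel₀ h0, one_smul]
  rw [this]
  exact Submodule.smul_mem _ _ (Submodule.subset_span h)

theorem isLattice_lattice (hv : v.IsCompat K) (g : (Matrix (Fin 2) (Fin 2) D)ˣ) :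
    IsLattice (hv.lattice g) := by
  refine ⟨?_, ?_, ?_⟩
  · have := finite_integers K D
    let F : (Fin 2 → integers K D) →ₗ[𝒪[K]] (Fin 2 → D) :=
      { toFun := fun z => g.val.mulVec fun i => (z i : D)
        map_add' := fun x y => by
          rw [← Matrix.mulVec_add]; rfl
        map_smul' := fun a x => by
          rw [RingHom.id_apply, ← Matrix.mulVec_smul]; rfl }
    have : hv.lattice g = LinearMap.range F := by
      ext z
      constructor
      · intro hz
        refine ⟨fun i => ⟨((g⁻¹).val.mulVec z) i, hv.mem_integers_iff.2 (hz i)⟩, ?_⟩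
        change g.val.mulVec ((g⁻¹).val.mulVec z) = z
        rw [Matrix.mulVec_mulVec, Units.mul_inv, Matrix.one_mulVec]
      · rintro ⟨z, rfl⟩ i
        change ((g⁻¹).val.mulVec (g.val.mulVec fun i => (z i : D))) i ∈ _
        rw [Matrix.mulVec_mulVec, Units.inv_mul, Matrix.one_mulVec]
        exact hv.mem_integers_iff.1 (z i).2
    rw [this, LinearMap.range_eq_map]
    exact Module.Finite.fg_top.map F
  · rw [eq_top_iff]
    intro z _
    obtain ⟨a, ha, h⟩ := exists_smul_forall_mem K hv ((g⁻¹).val.mulVec z)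
    refine smul_inv_mem_span K ha ?_
    intro i
    rw [Matrix.mulVec_smul]
    exact h i
  · intro z hz a i
    have : (g⁻¹).val.mulVec (fun i => z i * (a : D)) i = (g⁻¹).val.mulVec z i * a := by
      simp only [Matrix.mulVec, dotProduct, Finset.sum_mul, mul_assoc]
    rw [this]
    exact DiscVal.mul_mem_fil' (by omega) (hz i) (hv.mem_integers_iff.1 a.2)

theorem exists_forall_mem_fil_of_fg (hv : v.IsCompat K) {M : Submodule 𝒪[K] (Fin 2 → D)}
    (hM : M.FG) : ∃ N : ℤ, ∀ z ∈ M, ∀ i, z i ∈ v.fil N := by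
  induction M, hM using Submodule.fg_induction with
  | singleton x =>
    refine ⟨min (v.ord (x 0)) (v.ord (x 1)), fun z hz i => ?_⟩
    obtain ⟨a, rfl⟩ := Submodule.mem_span_singleton.1 hz
    refine hv.smul_mem a (DiscVal.fil_mono ?_ (v.mem_fil_ord (x i)))
    fin_cases i
    · exact min_le_left _ _
    · exact min_le_right _ _
  | sup M M' _ _ h h' =>
    obtain ⟨N, hN⟩ := h
    obtain ⟨N', hN'⟩ := h'
    refine ⟨min N N', fun z hz i => ?_⟩
    obtain ⟨x, hx, y, hy, rfl⟩ := Submodule.mem_sup.1 hz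
    exact add_mem (DiscVal.fil_mono (min_le_left _ _) (hN x hx i))
      (DiscVal.fil_mono (min_le_right _ _) (hN' y hy i))

theorem exists_smul_mem_of_mem_span {V : Type*} [AddCommGroup V] [Module 𝒪[K] V] [Module K V]
    [IsScalarTower 𝒪[K] K V] {M : Submodule 𝒪[K] V} {x : V}
    (hx : x ∈ Submodule.span K (M : Set V)) : ∃ a : 𝒪[K], a ≠ 0 ∧ a • x ∈ M := by
  induction hx using Submodule.span_induction with
  | mem x hx => exact ⟨1, one_ne_zero, by rwa [one_smul]⟩
  | zero => exact ⟨1, one_ne_zero, by rw [smul_zero]; exact zero_mem _⟩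
  | add x y _ _ hx hy =>
    obtain ⟨a, ha, hx⟩ := hx
    obtain ⟨b, hb, hy⟩ := hy
    refine ⟨a * b, mul_ne_zero ha hb, ?_⟩
    rw [smul_add, mul_comm, mul_smul, mul_comm, mul_smul]
    exact add_mem (M.smul_mem _ hx) (M.smul_mem _ hy)
  | smul c x _ hx =>
    obtain ⟨a, ha, hx⟩ := hx
    obtain ⟨p, s, hs, rfl⟩ := IsFractionRing.div_surjective (A := 𝒪[K]) c
    have hs0 : s ≠ 0 := nonZeroDivisors.ne_zero hs
    refine ⟨s * a, mul_ne_zero hs0 ha, ?_⟩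
    have : (s * a) • (algebraMap 𝒪[K] K p / algebraMap 𝒪[K] K s) • x = p • a • x := by
      rw [← algebraMap_smul K (s * a), ← algebraMap_smul K p, ← algebraMap_smul K a, smul_smul,
        smul_smul, map_mul]
      congr 1
      have : algebraMap 𝒪[K] K s ≠ 0 := by
        simpa using hs0
      field_simp
    rw [this]
    exact M.smul_mem _ hx

theorem exists_min_ord {P : D → Prop} (N : ℤ) (hN : ∀ x, P x → x ∈ v.fil N)
    (hP : ∃ x, P x ∧ x ≠ 0) : ∃ x, P x ∧ x ≠ 0 ∧ ∀ y, P y → y ∈ v.fil (v.ord x) := by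
  obtain ⟨k, ⟨x, hx, hx0, rfl⟩, h⟩ := Int.exists_least_of_bdd
    (P := fun k => ∃ x, P x ∧ x ≠ 0 ∧ v.ord x = k)
    ⟨N, by rintro _ ⟨x, hx, hx0, rfl⟩; exact hN x hx hx0⟩
    (by obtain ⟨x, hx, hx0⟩ := hP; exact ⟨_, x, hx, hx0, rfl⟩)
  exact ⟨x, hx, hx0, fun y hy hy0 => h _ ⟨y, hy, hy0, rfl⟩⟩

/-- Every lattice is free. -/
theorem exists_eq_lattice (hv : v.IsCompat K) {M : Submodule 𝒪[K] (Fin 2 → D)}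
    (hM : IsLattice M) : ∃ g : (Matrix (Fin 2) (Fin 2) D)ˣ, M = hv.lattice g := by
  obtain ⟨hfg, hspan, hmul⟩ := hM
  obtain ⟨N, hN⟩ := exists_forall_mem_fil_of_fg hv hfg
  have hmul' : ∀ z ∈ M, ∀ a ∈ v.fil 0, (fun i => z i * a) ∈ M := fun z hz a ha =>
    hmul z hz ⟨a, hv.mem_integers_iff.2 ha⟩
  have hsm (z : Fin 2 → D) : ∃ a : 𝒪[K], a ≠ 0 ∧ a • z ∈ M :=
    exists_smul_mem_of_mem_span (by rw [hspan]; trivial)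
  have hsm0 {a : 𝒪[K]} (ha : a ≠ 0) : a • (1 : D) ≠ 0 := by
    intro h
    rw [← algebraMap_smul K a (1 : D), smul_eq_zero] at h
    rcases h with h | h
    · exact ha (Subtype.ext h)
    · exact one_ne_zero h
  -- An echelon basis: `x` has second coordinate of least order in `M`, and `y` below has second
  -- coordinate `0` and first coordinate of least order among such vectors.
  obtain ⟨x1, ⟨x, hxM, rfl⟩, hx0, hxmin⟩ := exists_min_ord (v := v)
    (P := fun d => ∃ z ∈ M, z 1 = d) N (by rintro _ ⟨z, hz, rfl⟩; exact hN z hz 1) (by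
      obtain ⟨a, ha, h⟩ := hsm ![0, 1]
      exact ⟨_, ⟨_, h, rfl⟩, hsm0 ha⟩)
  obtain ⟨y0, ⟨y, hyM, hy1, rfl⟩, hy0, hymin⟩ := exists_min_ord (v := v)
    (P := fun d => ∃ z ∈ M, z 1 = 0 ∧ z 0 = d) N
    (by rintro _ ⟨z, hz, -, rfl⟩; exact hN z hz 0) (by
      obtain ⟨a, ha, h⟩ := hsm ![1, 0]
      exact ⟨_, ⟨_, h, by simp, rfl⟩, hsm0 ha⟩)
  have key (z : Fin 2 → D) : z ∈ hv.lattice (DiscVal.tri hy0 (x 0) hx0) ↔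
      (y 0)⁻¹ * (z 0 - x 0 * ((x 1)⁻¹ * z 1)) ∈ v.fil 0 ∧ (x 1)⁻¹ * z 1 ∈ v.fil 0 := by
    rw [hv.mem_lattice, Fin.forall_fin_two]
    change ((!![(y 0)⁻¹, -((y 0)⁻¹ * x 0 * (x 1)⁻¹); 0, (x 1)⁻¹] : Matrix (Fin 2) (Fin 2) D).mulVec
      z) 0 ∈ _ ∧ ((!![(y 0)⁻¹, -((y 0)⁻¹ * x 0 * (x 1)⁻¹); 0, (x 1)⁻¹] :
        Matrix (Fin 2) (Fin 2) D).mulVec z) 1 ∈ _ ↔ _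
    simp [Matrix.mulVec, dotProduct, Fin.sum_univ_two, mul_add, mul_assoc, sub_eq_add_neg]
  refine ⟨DiscVal.tri hy0 (x 0) hx0, ?_⟩
  ext z
  rw [key]
  constructor
  · intro hz
    have ha : (x 1)⁻¹ * z 1 ∈ v.fil 0 := by
      rw [v.mul_mem_fil_iff_left (inv_ne_zero hx0), v.ord_inv hx0]
      exact DiscVal.fil_mono (by omega) (hxmin _ ⟨z, hz, rfl⟩)
    refine ⟨?_, ha⟩
    rw [v.mul_mem_fil_iff_left (inv_ne_zero hy0), v.ord_inv hy0]
    refine DiscVal.fil_mono (by omega) (hymin _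
      ⟨z - (fun i => x i * ((x 1)⁻¹ * z 1)), sub_mem hz (hmul' x hxM _ ha), ?_, rfl⟩)
    change z 1 - x 1 * ((x 1)⁻¹ * z 1) = 0
    rw [mul_inv_cancel_left₀ hx0, sub_self]
  · rintro ⟨hb, ha⟩
    have : z = (fun i => x i * ((x 1)⁻¹ * z 1)) +
        fun i => y i * ((y 0)⁻¹ * (z 0 - x 0 * ((x 1)⁻¹ * z 1))) := by
      ext i
      fin_cases i
      · simp [mul_inv_cancel_left₀ hy0]
      · simp [mul_inv_cancel_left₀ hx0, hy1]
    rw [this]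
    exact add_mem (hmul' x hxM _ ha) (hmul' y hyM _ hb)

theorem isOrder_endOrder (hv : v.IsCompat K) (g : (Matrix (Fin 2) (Fin 2) D)ˣ) :
    IsOrder K (hv.endOrder g) := by
  constructor
  · have := finite_integers K D
    have : Module.Finite 𝒪[K] (Matrix (Fin 2) (Fin 2) (integers K D)) :=
      inferInstanceAs (Module.Finite 𝒪[K] (Fin 2 → Fin 2 → integers K D))
    let F : Matrix (Fin 2) (Fin 2) (integers K D) →ₗ[𝒪[K]] Matrix (Fin 2) (Fin 2) D :=
      { toFun := fun A => g.val * A.map (fun x => (x : D)) * (g⁻¹).val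
        map_add' := fun A B => by
          rw [← add_mul, ← mul_add]; rfl
        map_smul' := fun a A => by
          rw [RingHom.id_apply, ← smul_mul_assoc, ← mul_smul_comm]; rfl }
    have : Subalgebra.toSubmodule (hv.endOrder g) = LinearMap.range F := by
      ext A
      rw [Subalgebra.mem_toSubmodule]
      constructor
      · intro hA
        refine ⟨Matrix.of fun i j =>
          ⟨((g⁻¹).val * A * g.val) i j, hv.mem_integers_iff.2 (hA i j)⟩, ?_⟩
        change g.val * ((g⁻¹).val * A * g.val) * (g⁻¹).val = A
        simp only [mul_assoc, Units.mul_inv, mul_one, Units.mul_inv_cancel_left]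
      · rintro ⟨A, rfl⟩
        rw [hv.mem_endOrder]
        change v.MatFil 0 ((g⁻¹).val * (g.val * A.map (fun x => (x : D)) * (g⁻¹).val) * g.val)
        simp only [mul_assoc, Units.inv_mul, mul_one, Units.inv_mul_cancel_left]
        exact fun i j => hv.mem_integers_iff.1 (A i j).2
    rw [this, LinearMap.range_eq_map]
    exact Module.Finite.fg_top.map F
  · rw [eq_top_iff]
    intro A _
    obtain ⟨a, ha, h⟩ := exists_smul_forall_mem K hv
      (fun p : Fin 2 × Fin 2 => ((g⁻¹).val * A * g.val) p.1 p.2)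
    refine smul_inv_mem_span K ha ?_
    intro i j
    rw [mul_smul_comm, smul_mul_assoc]
    exact h (i, j)

theorem mulVec_mul_right (A : Matrix (Fin 2) (Fin 2) D) (z : Fin 2 → D) (a : D) :
    A.mulVec (fun i => z i * a) = fun i => A.mulVec z i * a := by
  ext i
  simp only [Matrix.mulVec, dotProduct, Finset.sum_mul, mul_assoc]

/-- Every order stabilizes a lattice. -/
theorem exists_le_endOrder (hv : v.IsCompat K) {Λ : Subalgebra 𝒪[K] (Matrix (Fin 2) (Fin 2) D)}
    (hΛ : IsOrder K Λ) : ∃ g, Λ ≤ hv.endOrder g := by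
  let f : Matrix (Fin 2) (Fin 2) D →ₗ[𝒪[K]] (Fin 2 → D) →ₗ[𝒪[K]] (Fin 2 → D) :=
    LinearMap.mk₂ 𝒪[K] (fun A z => A.mulVec z) (fun A B z => Matrix.add_mulVec A B z)
      (fun a A z => Matrix.smul_mulVec a A z) (fun A z w => Matrix.mulVec_add A z w)
      (fun a A z => Matrix.mulVec_smul A a z)
  have h1 := isLattice_lattice hv (1 : (Matrix (Fin 2) (Fin 2) D)ˣ)
  -- The products `Λ 𝒪²` form a lattice, and it is stable under `Λ`.
  set M := Submodule.map₂ f (Subalgebra.toSubmodule Λ) (hv.lattice 1) with hMdef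
  have hle : hv.lattice 1 ≤ M := fun z hz => by
    have := Submodule.apply_mem_map₂ f (p := Subalgebra.toSubmodule Λ) Λ.one_mem hz
    change Matrix.mulVec 1 z ∈ M at this
    rwa [Matrix.one_mulVec] at this
  have hM : IsLattice M := by
    refine ⟨hΛ.1.map₂ f h1.1, ?_, ?_⟩
    · rw [eq_top_iff, ← h1.2.1]
      exact Submodule.span_mono hle
    · intro z hz a
      let ρ : (Fin 2 → D) →ₗ[𝒪[K]] (Fin 2 → D) :=
        { toFun := fun z i => z i * (a : D)
          map_add' := fun x y => funext fun i => add_mul _ _ _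
          map_smul' := fun c x => funext fun i => smul_mul_assoc _ _ _ }
      have : M ≤ M.comap ρ := by
        rw [hMdef, Submodule.map₂_le]
        intro A hA z hz
        change (fun i => A.mulVec z i * (a : D)) ∈ M
        rw [← mulVec_mul_right]
        exact Submodule.apply_mem_map₂ f hA (h1.2.2 z hz a)
      exact this hz
  obtain ⟨g, hg⟩ := exists_eq_lattice hv hM
  refine ⟨g, fun A hA => ?_⟩
  rw [hv.mem_endOrder, ← mulVec_mem_lattice_iff hv, ← hg]
  have : M ≤ M.comap (f A) := by
    rw [hMdef, Submodule.map₂_le]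
    intro A' hA' z hz
    change A.mulVec (A'.mulVec z) ∈ M
    rw [Matrix.mulVec_mulVec]
    exact Submodule.apply_mem_map₂ f (p := Subalgebra.toSubmodule Λ) (Λ.mul_mem hA hA') hz
  exact fun z hz => this hz

theorem endOrder_le_of_within (hv : v.IsCompat K) {g h : (Matrix (Fin 2) (Fin 2) D)ˣ}
    (H : v.Within 0 g h) : hv.endOrder g ≤ hv.endOrder h := by
  obtain ⟨i, h1, h2⟩ := H
  intro A hA
  have := (h2.mul hA).mul h1
  rw [hv.mem_endOrder]
  simp only [Units.val_mul, mul_assoc, Units.mul_inv_cancel_left] at this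
  convert this using 1
  · omega
  · simp only [mul_assoc]

/-- Transporting matrix units to `End (g 𝒪²)` shows that every entry of `h⁻¹ g` times every entry of
`g⁻¹ h` is integral. Taking an entry of `h⁻¹ g` of least order bounds `g⁻¹ h` as homothety requires.
-/
theorem within_of_endOrder_le (hv : v.IsCompat K) {g h : (Matrix (Fin 2) (Fin 2) D)ˣ}
    (H : hv.endOrder g ≤ hv.endOrder h) : v.Within 0 g h := by
  have key (a b c d : Fin 2) : (h⁻¹ * g).val c a * (g⁻¹ * h).val b d ∈ v.fil 0 := by
    have hA : g.val * Matrix.single a b 1 * (g⁻¹).val ∈ hv.endOrder g := by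
      rw [hv.mem_endOrder]
      simp only [mul_assoc, Units.inv_mul, mul_one, Units.inv_mul_cancel_left]
      intro i j
      rw [Matrix.single_apply]
      split_ifs
      · exact v.one_mem_fil
      · exact zero_mem _
    have := (H hA) c d
    rw [← mul_assoc, ← mul_assoc, mul_assoc, mul_assoc (_ * _), ← mul_assoc, ← Units.val_mul,
      ← Units.val_mul] at this
    rw [mul_assoc, Matrix.mul_apply] at this
    simpa [Matrix.mul_apply, Matrix.single_apply, ite_and] using this
  obtain ⟨p, hp, hmin⟩ := DiscVal.exists_matFil_ord (v := v) (h⁻¹ * g)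
  refine DiscVal.Within.symm ⟨_, hmin, fun b d => ?_⟩
  have := key p.2 b p.1 d
  rw [v.mul_mem_fil_iff_left hp] at this
  exact DiscVal.fil_mono (by omega) this

/-- A larger order lies in some `End (h 𝒪²)`. The inclusion of endomorphism rings makes the lattices
homothetic, and homothety is symmetric. -/
theorem maximal_endOrder (hv : v.IsCompat K) (g : (Matrix (Fin 2) (Fin 2) D)ˣ) :
    Maximal (IsOrder K) (hv.endOrder g) := by
  refine ⟨isOrder_endOrder hv g, fun Λ hΛ hle => ?_⟩
  obtain ⟨h, hh⟩ := exists_le_endOrder hv hΛ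
  exact hh.trans (endOrder_le_of_within hv (within_of_endOrder_le hv (hle.trans hh)).symm)

/-- The vertex of the tree that belongs to the lattice `g 𝒪²`. -/
def DiscVal.IsCompat.vertex (hv : v.IsCompat K) (g : (Matrix (Fin 2) (Fin 2) D)ˣ) :
    MaximalOrder K D := ⟨hv.endOrder g, maximal_endOrder hv g⟩

theorem mem_vertex (hv : v.IsCompat K) {g : (Matrix (Fin 2) (Fin 2) D)ˣ}
    {A : Matrix (Fin 2) (Fin 2) D} :
    A ∈ (hv.vertex g).1 ↔ v.MatFil 0 ((g⁻¹).val * A * g.val) := Iff.rfl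

theorem vertex_eq_iff (hv : v.IsCompat K) {g h : (Matrix (Fin 2) (Fin 2) D)ˣ} :
    hv.vertex g = hv.vertex h ↔ v.Within 0 g h := by
  constructor
  · intro H
    exact within_of_endOrder_le hv (Subtype.ext_iff.1 H).le
  · intro H
    exact Subtype.ext (le_antisymm (endOrder_le_of_within hv H) (endOrder_le_of_within hv H.symm))

theorem exists_vertex_eq (hv : v.IsCompat K) (Λ : MaximalOrder K D) :
    ∃ g, hv.vertex g = Λ := by
  obtain ⟨g, hg⟩ := exists_le_endOrder hv Λ.2.1
  exact ⟨g, Subtype.ext (le_antisymm (Λ.2.2 (isOrder_endOrder hv g) hg) hg)⟩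

theorem isEndRing_lattice (hv : v.IsCompat K) (g : (Matrix (Fin 2) (Fin 2) D)ˣ) :
    IsEndRing (hv.vertex g) (hv.lattice g) := fun A => by
  rw [mulVec_mem_lattice_iff, mem_vertex]

theorem vertex_eq_of_isEndRing (hv : v.IsCompat K) {Λ : MaximalOrder K D}
    {g : (Matrix (Fin 2) (Fin 2) D)ˣ} (h : IsEndRing Λ (hv.lattice g)) : Λ = hv.vertex g := by
  apply Subtype.ext
  ext A
  rw [h A, isEndRing_lattice hv g A]

/-- The scalar matrix `πⁱ`. -/
def DiscVal.scal (v : DiscVal D) (i : ℤ) : (Matrix (Fin 2) (Fin 2) D)ˣ where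
  val := Matrix.scalar (Fin 2) (v.unif ^ i)
  inv := Matrix.scalar (Fin 2) (v.unif ^ (-i))
  val_inv := by
    rw [← map_mul, ← zpow_add₀ v.unif_ne_zero, add_neg_cancel, zpow_zero, map_one]
  inv_val := by
    rw [← map_mul, ← zpow_add₀ v.unif_ne_zero, neg_add_cancel, zpow_zero, map_one]

theorem matFil_scalar {i : ℤ} {x : D} (hx : x ∈ v.fil i) :
    v.MatFil i (Matrix.scalar (Fin 2) x) := by
  intro a b
  rw [Matrix.scalar_apply]
  by_cases h : a = b
  · subst h; rw [Matrix.diagonal_apply_eq]; exact hx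
  · rw [Matrix.diagonal_apply_ne _ h]; exact zero_mem _

theorem within_of_tree_rel (hv : v.IsCompat K) {g h : (Matrix (Fin 2) (Fin 2) D)ˣ}
    (H : ∃ M M' : Submodule 𝒪[K] (Fin 2 → D), IsLattice M ∧ IsLattice M' ∧
      IsEndRing (hv.vertex g) M ∧ IsEndRing (hv.vertex h) M' ∧ M' ≤ M ∧
      ∀ v ∈ M, ∀ a ∈ maxIdeal K D, (fun i => v i * (a : D)) ∈ M') : v.Within 1 g h := by
  obtain ⟨M, M', hM, hM', hg, hh, hle, hmul⟩ := H
  obtain ⟨g', rfl⟩ := exists_eq_lattice hv hM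
  obtain ⟨h', rfl⟩ := exists_eq_lattice hv hM'
  have h1 := (vertex_eq_iff hv).1 (vertex_eq_of_isEndRing hv hg)
  have h2 := (vertex_eq_iff hv).1 (vertex_eq_of_isEndRing hv hh)
  refine (h1.zero_trans ?_).trans_zero h2.symm
  refine ⟨0, (lattice_le_lattice_iff hv).1 hle, ?_⟩
  have hu : v.unif ∈ v.fil 1 := fun _ => v.ord_unif.ge
  rw [matFil_iff_mulVec]
  intro z hz j
  have hz' : g'.val.mulVec z ∈ hv.lattice g' := by
    rw [hv.mem_lattice, Matrix.mulVec_mulVec, Units.inv_mul, Matrix.one_mulVec]; exact hz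
  have h3 := hmul _ hz' ⟨v.unif, hv.mem_integers_iff.2 (DiscVal.fil_mono zero_le_one hu)⟩
    ((hv.mem_maxIdeal_iff _).2 hu) j
  rw [mulVec_mul_right, Matrix.mulVec_mulVec, v.mul_mem_fil_iff_right v.unif_ne_zero,
    v.ord_unif, ← Units.val_mul] at h3
  exact DiscVal.fil_mono (by omega) h3

theorem tree_adj_iff (hv : v.IsCompat K) {g h : (Matrix (Fin 2) (Fin 2) D)ˣ} :
    (tree K D).Adj (hv.vertex g) (hv.vertex h) ↔ ¬ v.Within 0 g h ∧ v.Within 1 g h := by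
  rw [tree, SimpleGraph.fromRel_adj, ne_eq, vertex_eq_iff]
  refine and_congr_right fun _ => ⟨?_, ?_⟩
  · rintro (H | H)
    · exact within_of_tree_rel hv H
    · exact (within_of_tree_rel hv H).symm
  · rintro ⟨i, h1, h2⟩
    left
    -- Rescaling the second lattice by `π ^ (-i)` does not change its vertex and nests it between
    -- the first lattice and its multiple by `𝔪_D`.
    have hs : v.MatFil (-i) (v.scal (-i)).val :=
      matFil_scalar fun _ => (v.ord_unif_zpow _).ge
    have hs' : v.MatFil i ((v.scal (-i))⁻¹).val := by
      refine matFil_scalar (i := i) (x := v.unif ^ (- -i)) fun _ => ?_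
      rw [v.ord_unif_zpow, neg_neg]
    have hw : v.Within 0 h (h * v.scal (-i)) :=
      DiscVal.within_of_mul (i := -i) hs (by convert hs' using 1; omega)
    refine ⟨hv.lattice g, hv.lattice (h * v.scal (-i)), isLattice_lattice hv _,
      isLattice_lattice hv _, isEndRing_lattice hv g, ?_, ?_, ?_⟩
    · rw [(vertex_eq_iff hv).2 hw]
      exact isEndRing_lattice hv _
    · rw [lattice_le_lattice_iff]
      have := h1.mul hs
      rw [← Units.val_mul, mul_assoc] at this
      convert this using 1
      omega
    · intro z hz a ha j
      rw [mulVec_mul_right]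
      have h3 := hs'.mul h2
      rw [← Units.val_mul, ← mul_assoc, ← mul_inv_rev, matFil_iff_mulVec] at h3
      have h4 := h3 _ hz j
      rw [Matrix.mulVec_mulVec, ← Units.val_mul, mul_assoc, mul_inv_cancel, mul_one] at h4
      exact DiscVal.mul_mem_fil' (by omega) h4 ((hv.mem_maxIdeal_iff a).1 ha)

end Lattices

/-! ### The graph is a tree -/

section TreeStructure

variable {K : Type*} [Field K] [ValuativeRel K] [TopologicalSpace K]
  [IsNonarchimedeanLocalField K] {D : Type*} [DivisionRing D] [Algebra K D]
  [FiniteDimensional K D] {v : DiscVal D}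

theorem vertex_mul_left (hv : v.IsCompat K) {g h x : (Matrix (Fin 2) (Fin 2) D)ˣ} :
    hv.vertex (x * g) = hv.vertex (x * h) ↔ hv.vertex g = hv.vertex h := by
  rw [vertex_eq_iff, vertex_eq_iff, DiscVal.within_mul_left]

theorem vertex_low_zero (hv : v.IsCompat K) {b : D} (hb : b ∈ v.fil 0)
    (g : (Matrix (Fin 2) (Fin 2) D)ˣ) : hv.vertex (g * v.low b 0) = hv.vertex g :=
  (vertex_eq_iff hv).2 (DiscVal.within_low_zero hb g).symm

theorem vertex_low_eq_iff (hv : v.IsCompat K) {b b' : D} {r : ℕ}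
    (g : (Matrix (Fin 2) (Fin 2) D)ˣ) :
    hv.vertex (g * v.low b r) = hv.vertex (g * v.low b' r) ↔ b - b' ∈ v.fil r := by
  rw [vertex_mul_left, vertex_eq_iff, DiscVal.within_low_iff]

theorem adj_vertex_low (hv : v.IsCompat K) {b : D} (hb : b ∈ v.fil 0)
    (g : (Matrix (Fin 2) (Fin 2) D)ˣ) :
    (tree K D).Adj (hv.vertex g) (hv.vertex (g * v.low b 1)) := by
  refine (tree_adj_iff hv).2 ⟨fun h => ?_, DiscVal.within_low hb g 1⟩
  have := DiscVal.le_of_within_low h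
  omega

theorem adj_vertex_low_succ (hv : v.IsCompat K) (g : (Matrix (Fin 2) (Fin 2) D)ˣ) (b : D) (r : ℕ) :
    (tree K D).Adj (hv.vertex (g * v.low b r)) (hv.vertex (g * v.low b (r + 1))) := by
  rw [← v.low_mul_low_zero, ← mul_assoc]
  exact adj_vertex_low hv (zero_mem _) _

theorem eq_vertex_of_adj (hv : v.IsCompat K) {g : (Matrix (Fin 2) (Fin 2) D)ˣ}
    {Λ : MaximalOrder K D} (h : (tree K D).Adj (hv.vertex g) Λ) :
    (∃ b ∈ v.fil 0, Λ = hv.vertex (g * v.low b 1)) ∨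
      Λ = hv.vertex (g * DiscVal.swap D * v.low 0 1) := by
  obtain ⟨l, rfl⟩ := exists_vertex_eq hv Λ
  rw [tree_adj_iff] at h
  refine (DiscVal.exists_of_within_one h.2 h.1).imp ?_ ?_
  · rintro ⟨b, hb, H⟩
    exact ⟨b, hb, (vertex_eq_iff hv).2 H.symm⟩
  · intro H
    exact (vertex_eq_iff hv).2 H.symm

theorem vertex_swap (hv : v.IsCompat K) (g : (Matrix (Fin 2) (Fin 2) D)ˣ) :
    hv.vertex (g * DiscVal.swap D) = hv.vertex g :=
  (vertex_eq_iff hv).2 (DiscVal.within_swap g).symm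

theorem vertex_back (hv : v.IsCompat K) (g : (Matrix (Fin 2) (Fin 2) D)ˣ) :
    hv.vertex (g * v.low 0 1 * DiscVal.swap D * v.low 0 1) = hv.vertex g :=
  (vertex_eq_iff hv).2 (DiscVal.within_low_swap_low g).symm

theorem within_one_of_eq {s : (Matrix (Fin 2) (Fin 2) D)ˣ} (hs : s = 1 ∨ s = DiscVal.swap D) :
    v.Within 0 1 s := by
  rcases hs with rfl | rfl
  · exact .refl 1
  · simpa using DiscVal.within_swap (v := v) 1

theorem exists_eq_vertex_low (hv : v.IsCompat K) (Λ : MaximalOrder K D) :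
    ∃ s, (s = 1 ∨ s = DiscVal.swap D) ∧ ∃ b ∈ v.fil 0, ∃ r : ℕ, Λ = hv.vertex (s * v.low b r) := by
  obtain ⟨x, rfl⟩ := exists_vertex_eq hv Λ
  rcases DiscVal.exists_within_low (v := v) x with ⟨b, hb, r, h⟩ | ⟨b, hb, r, h⟩
  · exact ⟨1, .inl rfl, b, hb, r, by rw [one_mul, vertex_eq_iff]; exact h.symm⟩
  · exact ⟨DiscVal.swap D, .inr rfl, b, DiscVal.fil_mono zero_le_one hb, r,
      by rw [vertex_eq_iff]; exact h.symm⟩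

/-- The distance from the standard vertex. -/
noncomputable def DiscVal.IsCompat.level (hv : v.IsCompat K) (Λ : MaximalOrder K D) : ℕ :=
  sInf {t : ℕ | ∃ g, hv.vertex g = Λ ∧ v.Within t 1 g}

theorem level_vertex_low (hv : v.IsCompat K) {s : (Matrix (Fin 2) (Fin 2) D)ˣ}
    (hs : v.Within 0 1 s) {b : D} (hb : b ∈ v.fil 0) (r : ℕ) :
    hv.level (hv.vertex (s * v.low b r)) = r := by
  have hr : r ∈ {t : ℕ | ∃ g, hv.vertex g = hv.vertex (s * v.low b r) ∧ v.Within t 1 g} :=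
    ⟨_, rfl, hs.zero_trans (DiscVal.within_low hb s r)⟩
  refine le_antisymm (Nat.sInf_le hr) (le_csInf ⟨r, hr⟩ ?_)
  rintro t ⟨g, hg, h⟩
  have := DiscVal.le_of_within_low ((hs.symm.zero_trans h).trans_zero ((vertex_eq_iff hv).1 hg))
  omega

/-- The neighbours reached by some `low b' 1` lengthen `low b r` to `r + 1`. The only other one
comes from the swap and undoes the last step by `vertex_back`, unless `r = 0`, where it also leads
to level one. -/
theorem level_of_adj (hv : v.IsCompat K) {s : (Matrix (Fin 2) (Fin 2) D)ˣ}
    (hs : v.Within 0 1 s) {b : D} (hb : b ∈ v.fil 0) {r : ℕ} {Λ : MaximalOrder K D}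
    (h : (tree K D).Adj (hv.vertex (s * v.low b r)) Λ) :
    hv.level Λ = r + 1 ∨ ∃ r', r = r' + 1 ∧ Λ = hv.vertex (s * v.low b r') := by
  rcases eq_vertex_of_adj hv h with ⟨b', hb', rfl⟩ | rfl
  · left
    rw [mul_assoc, v.low_mul_low]
    exact level_vertex_low hv hs (add_mem hb (DiscVal.mul_mem_fil' (i := r) (j := 0) (by omega)
      (v.unif_pow_mem r) hb')) _
  · rcases r with _ | r
    · left
      exact level_vertex_low hv ((hs.trans_zero (DiscVal.within_low_zero hb s)).trans_zero
        (DiscVal.within_swap _)) (zero_mem _) 1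
    · right
      refine ⟨r, rfl, ?_⟩
      rw [← v.low_mul_low_zero, ← mul_assoc s]
      exact vertex_back hv _

theorem tree_isAcyclic (hv : v.IsCompat K) : (tree K D).IsAcyclic := by
  refine isAcyclic_of_height hv.level fun Λ Λ₁ Λ₂ h1 h2 hd1 hd2 => ?_
  obtain ⟨s, hs, b, hb, r, rfl⟩ := exists_eq_vertex_low hv Λ
  replace hs := within_one_of_eq (v := v) hs
  rw [level_vertex_low hv hs hb] at hd1 hd2
  rcases level_of_adj hv hs hb h1 with h | ⟨r₁, rfl, rfl⟩
  · omega
  rcases level_of_adj hv hs hb h2 with h | ⟨r₂, h, rfl⟩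
  · omega
  obtain rfl : r₁ = r₂ := by omega
  rfl

/-- Lowering `r` walks back towards the standard vertex, so a set closed under this step joins each
of its members to that vertex. -/
theorem induce_tree_preconnected (hv : v.IsCompat K) {P : Set (MaximalOrder K D)}
    (hP : ∀ s : (Matrix (Fin 2) (Fin 2) D)ˣ, (s = 1 ∨ s = DiscVal.swap D) → ∀ b ∈ v.fil 0, ∀ r : ℕ,
      hv.vertex (s * v.low b (r + 1)) ∈ P → hv.vertex (s * v.low b r) ∈ P) :
    ((tree K D).induce P).Preconnected := by
  have key (s : (Matrix (Fin 2) (Fin 2) D)ˣ) (hs : s = 1 ∨ s = DiscVal.swap D) (b : D)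
      (hb : b ∈ v.fil 0) (r : ℕ) (hr : hv.vertex (s * v.low b r) ∈ P) : ∃ h1 : hv.vertex 1 ∈ P,
        ((tree K D).induce P).Reachable ⟨_, hr⟩ ⟨_, h1⟩ := by
    induction r with
    | zero =>
      have h0 : hv.vertex (s * v.low b 0) = hv.vertex 1 := by
        rw [vertex_low_zero hv hb, vertex_eq_iff]
        exact (within_one_of_eq hs).symm
      have h1 : hv.vertex 1 ∈ P := by rwa [h0] at hr
      refine ⟨h1, ?_⟩
      rw [show (⟨_, hr⟩ : P) = ⟨_, h1⟩ from Subtype.ext h0]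
    | succ r ih =>
      obtain ⟨h1, h⟩ := ih (hP s hs b hb r hr)
      refine ⟨h1, SimpleGraph.Reachable.trans (SimpleGraph.Adj.reachable ?_) h⟩
      exact (adj_vertex_low_succ hv s b r).symm
  rintro ⟨Λ, hΛ⟩ ⟨Λ', hΛ'⟩
  obtain ⟨s, hs, b, hb, r, rfl⟩ := exists_eq_vertex_low hv Λ
  obtain ⟨s', hs', b', hb', r', rfl⟩ := exists_eq_vertex_low hv Λ'
  obtain ⟨_, h⟩ := key s hs b hb r hΛ
  obtain ⟨_, h'⟩ := key s' hs' b' hb' r' hΛ'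
  exact h.trans h'.symm

theorem tree_preconnected (hv : v.IsCompat K) : (tree K D).Preconnected := by
  have := induce_tree_preconnected hv (P := Set.univ) fun _ _ _ _ _ _ => trivial
  exact (SimpleGraph.induceUnivIso (tree K D)).preconnected_iff.1 this

/-- Left multiplication of lattices by `γ`, as an automorphism of the tree. -/
noncomputable def DiscVal.IsCompat.act (hv : v.IsCompat K) (γ : (Matrix (Fin 2) (Fin 2) D)ˣ) :
    MaximalOrder K D → MaximalOrder K D :=
  fun Λ => hv.vertex (γ * (exists_vertex_eq hv Λ).choose)

theorem act_vertex (hv : v.IsCompat K) (γ g : (Matrix (Fin 2) (Fin 2) D)ˣ) :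
    hv.act γ (hv.vertex g) = hv.vertex (γ * g) :=
  (vertex_mul_left hv).2 (exists_vertex_eq hv (hv.vertex g)).choose_spec

theorem act_act_inv (hv : v.IsCompat K) (γ : (Matrix (Fin 2) (Fin 2) D)ˣ) (Λ : MaximalOrder K D) :
    hv.act γ (hv.act γ⁻¹ Λ) = Λ := by
  obtain ⟨g, rfl⟩ := exists_vertex_eq hv Λ
  rw [act_vertex, act_vertex, mul_inv_cancel_left]

/-- The automorphism of an induced subgraph of the tree given by a matrix that stabilizes it. -/
noncomputable def actInduce (hv : v.IsCompat K) (γ : (Matrix (Fin 2) (Fin 2) D)ˣ)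
    {P : Set (MaximalOrder K D)} (h : ∀ Λ ∈ P, hv.act γ Λ ∈ P) (h' : ∀ Λ ∈ P, hv.act γ⁻¹ Λ ∈ P) :
    (tree K D).induce P ≃g (tree K D).induce P where
  toFun Λ := ⟨hv.act γ Λ, h _ Λ.2⟩
  invFun Λ := ⟨hv.act γ⁻¹ Λ, h' _ Λ.2⟩
  left_inv Λ := Subtype.ext (by simpa using act_act_inv hv γ⁻¹ Λ.1)
  right_inv Λ := Subtype.ext (act_act_inv hv γ Λ.1)
  map_rel_iff' {Λ Λ'} := by
    obtain ⟨Λ, hΛ⟩ := Λ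
    obtain ⟨Λ', hΛ'⟩ := Λ'
    obtain ⟨g, rfl⟩ := exists_vertex_eq hv Λ
    obtain ⟨g', rfl⟩ := exists_vertex_eq hv Λ'
    change (tree K D).Adj (hv.act γ _) (hv.act γ _) ↔
      (tree K D).Adj (hv.vertex g) (hv.vertex g')
    rw [act_vertex, act_vertex, tree_adj_iff, tree_adj_iff, DiscVal.within_mul_left,
      DiscVal.within_mul_left]

end TreeStructure

/-! ### Entry bounds for homothetic lattices -/

section Position

variable {D : Type*} [DivisionRing D] (v : DiscVal D)

/-- The orders of the entries of `η` and `η⁻¹` when `η` relates the lattices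
`diag(1, πᵏ) 𝒪²` and `diag(1, πˡ) 𝒪²` up to scaling. -/
def DiscVal.EntryBound (i : ℤ) (k l : ℕ) (η : (Matrix (Fin 2) (Fin 2) D)ˣ) : Prop :=
  (η.val 0 0 ∈ v.fil i ∧ η.val 0 1 ∈ v.fil (i - l) ∧ η.val 1 0 ∈ v.fil (i + k) ∧
    η.val 1 1 ∈ v.fil (i + k - l)) ∧
  (η⁻¹.val 0 0 ∈ v.fil (-i) ∧ η⁻¹.val 0 1 ∈ v.fil (-i - k) ∧ η⁻¹.val 1 0 ∈ v.fil (-i + l) ∧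
    η⁻¹.val 1 1 ∈ v.fil (-i + l - k))

variable {v}

theorem matFil_low_inv_mul_mul_low {i : ℤ} {k l : ℕ} {η : Matrix (Fin 2) (Fin 2) D} :
    v.MatFil i ((v.low 0 k)⁻¹.val * η * (v.low 0 l).val) ↔
      η 0 0 ∈ v.fil i ∧ η 0 1 ∈ v.fil (i - l) ∧ η 1 0 ∈ v.fil (i + k) ∧
        η 1 1 ∈ v.fil (i + k - l) := by
  have : (v.low 0 k)⁻¹.val * η * (v.low 0 l).val = !![η 0 0, η 0 1 * v.unif ^ l;
      (v.unif ^ k)⁻¹ * η 1 0, (v.unif ^ k)⁻¹ * (η 1 1 * v.unif ^ l)] := by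
    rw [DiscVal.coe_low_inv, DiscVal.coe_low]
    conv_lhs => rw [Matrix.eta_fin_two η]
    simp only [Matrix.mul_fin_two]
    simp [mul_assoc]
  rw [this, DiscVal.matFil_mk, v.inv_unif_pow_mul_mem_iff, v.inv_unif_pow_mul_mem_iff,
    v.mul_unif_pow_mem_iff, v.mul_unif_pow_mem_iff]

theorem within_low_low_iff {x y : (Matrix (Fin 2) (Fin 2) D)ˣ} {k l : ℕ} :
    v.Within 0 (x * v.low 0 k) (y * v.low 0 l) ↔ ∃ i, v.EntryBound i k l (x⁻¹ * y) := by
  refine exists_congr fun i => and_congr ?_ ?_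
  · rw [← matFil_low_inv_mul_mul_low, mul_inv_rev, ← Units.val_mul, ← Units.val_mul,
      mul_assoc, mul_assoc, mul_assoc]
  · rw [neg_zero, zero_sub, ← matFil_low_inv_mul_mul_low, mul_inv_rev, mul_inv_rev, inv_inv,
      ← Units.val_mul, ← Units.val_mul, mul_assoc, mul_assoc, mul_assoc]

theorem low_zero_zero : v.low 0 0 = 1 := by
  apply Units.ext
  rw [DiscVal.coe_low, pow_zero, Units.val_one, Matrix.one_fin_two]

theorem within_zero_iff {x y : (Matrix (Fin 2) (Fin 2) D)ˣ} :
    v.Within 0 x y ↔ ∃ i, v.EntryBound i 0 0 (x⁻¹ * y) := by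
  rw [← within_low_low_iff, low_zero_zero, mul_one, mul_one]

theorem within_low_one_iff {x y : (Matrix (Fin 2) (Fin 2) D)ˣ} {k : ℕ} :
    v.Within 0 (x * v.low 0 k) y ↔ ∃ i, v.EntryBound i k 0 (x⁻¹ * y) := by
  rw [← within_low_low_iff, low_zero_zero, mul_one]

theorem within_one_low_iff {x y : (Matrix (Fin 2) (Fin 2) D)ˣ} {l : ℕ} :
    v.Within 0 x (y * v.low 0 l) ↔ ∃ i, v.EntryBound i 0 l (x⁻¹ * y) := by
  rw [← within_low_low_iff, low_zero_zero, mul_one]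

theorem entry_mul_inv (η : (Matrix (Fin 2) (Fin 2) D)ˣ) (a : Fin 2) :
    η.val a 0 * η⁻¹.val 0 a + η.val a 1 * η⁻¹.val 1 a = 1 := by
  have := congrFun (congrFun η.mul_inv a) a
  rwa [Matrix.mul_apply, Fin.sum_univ_two, Matrix.one_apply_eq] at this

theorem entry_inv_mul (η : (Matrix (Fin 2) (Fin 2) D)ˣ) (a : Fin 2) :
    η⁻¹.val a 0 * η.val 0 a + η⁻¹.val a 1 * η.val 1 a = 1 := by
  have := entry_mul_inv η⁻¹ a
  rwa [inv_inv] at this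

theorem notMem_or_notMem_of_add_eq_one {x y : D} (h : x + y = 1) :
    x ∉ v.fil 1 ∨ y ∉ v.fil 1 := by
  by_contra! H
  have := add_mem H.1 H.2
  rw [h, v.one_mem_fil_iff] at this
  omega

end Position

/-! ### Lattices over `C` compared over `B` -/

section Embedding

variable {K : Type*} [Field K] {B C : Type*} [DivisionRing B] [Algebra K B] [DivisionRing C]
  [Algebra K C] {v : DiscVal B} {vC : DiscVal C} {φ : C →ₐ[K] B} {m : ℕ}

variable (φ) in
/-- The map `GL₂(C) → GL₂(B)` induced by `φ`. -/
def glMap : (Matrix (Fin 2) (Fin 2) C)ˣ →* (Matrix (Fin 2) (Fin 2) B)ˣ :=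
  Units.map (φ.toRingHom.mapMatrix (m := Fin 2)).toMonoidHom

theorem glMap_apply (g : (Matrix (Fin 2) (Fin 2) C)ˣ) (a b : Fin 2) :
    (glMap φ g).val a b = φ (g.val a b) := rfl

theorem glMap_inv_apply (g : (Matrix (Fin 2) (Fin 2) C)ˣ) (a b : Fin 2) :
    (glMap φ g)⁻¹.val a b = φ (g⁻¹.val a b) := rfl

theorem glMap_swap : glMap φ (DiscVal.swap C) = DiscVal.swap B := by
  apply Units.ext
  ext a b
  rw [glMap_apply, DiscVal.coe_swap, DiscVal.coe_swap]
  fin_cases a <;> fin_cases b <;> simp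

theorem glMap_inv_mul (g h : (Matrix (Fin 2) (Fin 2) C)ˣ) :
    (glMap φ g)⁻¹ * glMap φ h = glMap φ (g⁻¹ * h) := by
  rw [map_mul, map_inv]

/-- The two lower bounds add up to `0` while the product has order at most `0`, so both bounds are
attained. Orders of elements of `φ(C)` are multiples of `m`. -/
theorem dvd_of_mul_notMem (hφ : ∀ x, x ≠ 0 → v.ord (φ x) = m * vC.ord x) {x y : C} {s t : ℤ}
    (hx : φ x ∈ v.fil s) (hy : φ y ∈ v.fil t) (hst : s + t = 0) (h : x * y ∉ vC.fil 1) :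
    ∃ j : ℤ, s = m * j := by
  have hx0 : x ≠ 0 := by rintro rfl; rw [zero_mul] at h; exact h (zero_mem _)
  have hy0 : y ≠ 0 := by rintro rfl; rw [mul_zero] at h; exact h (zero_mem _)
  rw [vC.mem_fil_of_ne (mul_ne_zero hx0 hy0), vC.ord_mul hx0 hy0] at h
  have hinj := φ.toRingHom.injective
  rw [v.mem_fil_of_ne ((map_ne_zero_iff φ hinj).2 hx0), hφ x hx0] at hx
  rw [v.mem_fil_of_ne ((map_ne_zero_iff φ hinj).2 hy0), hφ y hy0] at hy
  refine ⟨vC.ord x, le_antisymm hx ?_⟩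
  have : (m : ℤ) * (vC.ord x + vC.ord y) ≤ 0 :=
    mul_nonpos_of_nonneg_of_nonpos (by positivity) (by omega)
  linarith

theorem mem_of_map_mem (hφ : ∀ x, x ≠ 0 → v.ord (φ x) = m * vC.ord x) {x : C} {a b : ℤ}
    (hx : φ x ∈ v.fil a) (h : m * (b - 1) < a) : x ∈ vC.fil b := by
  intro hx0
  rw [v.mem_fil_of_ne ((map_ne_zero_iff φ φ.toRingHom.injective).2 hx0), hφ x hx0] at hx
  have := lt_of_mul_lt_mul_left (h.trans_le hx) (by positivity)
  omega

/-- Orders on `φ(C)` are multiples of `m`, so each bound may be rounded up to the next multiple.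
Depending on its sign and on the rounding, an offset between `0` and `m` turns into `0` or `1`. The
three lemmas that follow round in the same way. -/
theorem entryBound_of_glMap (hφ : ∀ x, x ≠ 0 → v.ord (φ x) = m * vC.ord x)
    {η : (Matrix (Fin 2) (Fin 2) C)ˣ} {j : ℤ} {k : ℕ} (hk : k < m)
    (H : v.EntryBound (m * j) k k (glMap φ η)) : vC.EntryBound j 0 0 η := by
  obtain ⟨⟨h00, h01, h10, h11⟩, h00', h01', h10', h11'⟩ := H
  rw [glMap_apply] at h00 h01 h10 h11
  rw [glMap_inv_apply] at h00' h01' h10' h11'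
  have hk' : (k : ℤ) < m := by exact_mod_cast hk
  have hk0 : (0 : ℤ) ≤ k := by positivity
  refine ⟨⟨?_, ?_, ?_, ?_⟩, ?_, ?_, ?_, ?_⟩
  · exact mem_of_map_mem hφ h00 (by linarith)
  · exact mem_of_map_mem hφ h01 (by push_cast; linarith)
  · exact mem_of_map_mem hφ h10 (by push_cast; linarith)
  · exact mem_of_map_mem hφ h11 (by push_cast; linarith)
  · exact mem_of_map_mem hφ h00' (by linarith)
  · exact mem_of_map_mem hφ h01' (by push_cast; linarith)
  · exact mem_of_map_mem hφ h10' (by push_cast; linarith)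
  · exact mem_of_map_mem hφ h11' (by push_cast; linarith)

theorem entryBound_one_of_glMap (hφ : ∀ x, x ≠ 0 → v.ord (φ x) = m * vC.ord x)
    {η : (Matrix (Fin 2) (Fin 2) C)ˣ} {j : ℤ} {k : ℕ} (hkp : 0 < k) (hk : k < m)
    (H : v.EntryBound (m * j) k k (glMap φ η)) : vC.EntryBound j 1 1 η := by
  obtain ⟨⟨h00, h01, h10, h11⟩, h00', h01', h10', h11'⟩ := H
  rw [glMap_apply] at h00 h01 h10 h11
  rw [glMap_inv_apply] at h00' h01' h10' h11'
  have hk' : (k : ℤ) < m := by exact_mod_cast hk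
  have hk0 : (0 : ℤ) < k := by exact_mod_cast hkp
  refine ⟨⟨?_, ?_, ?_, ?_⟩, ?_, ?_, ?_, ?_⟩
  · exact mem_of_map_mem hφ h00 (by linarith)
  · exact mem_of_map_mem hφ h01 (by push_cast; linarith)
  · exact mem_of_map_mem hφ h10 (by push_cast; linarith)
  · exact mem_of_map_mem hφ h11 (by push_cast; linarith)
  · exact mem_of_map_mem hφ h00' (by linarith)
  · exact mem_of_map_mem hφ h01' (by push_cast; linarith)
  · exact mem_of_map_mem hφ h10' (by push_cast; linarith)
  · exact mem_of_map_mem hφ h11' (by push_cast; linarith)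

theorem entryBound_of_glMap_antidiagonal (hφ : ∀ x, x ≠ 0 → v.ord (φ x) = m * vC.ord x)
    {η : (Matrix (Fin 2) (Fin 2) C)ˣ} {j : ℤ} {k l : ℕ} (hk : k < m) (hl : l < m) (hkl : k + l = m)
    (H : v.EntryBound (m * j + l) k l (glMap φ η)) : vC.EntryBound j 1 0 η := by
  obtain ⟨⟨h00, h01, h10, h11⟩, h00', h01', h10', h11'⟩ := H
  rw [glMap_apply] at h00 h01 h10 h11
  rw [glMap_inv_apply] at h00' h01' h10' h11'
  have hk' : (k : ℤ) < m := by exact_mod_cast hk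
  have hl' : (l : ℤ) < m := by exact_mod_cast hl
  have hkl' : (k : ℤ) + l = m := by exact_mod_cast hkl
  refine ⟨⟨?_, ?_, ?_, ?_⟩, ?_, ?_, ?_, ?_⟩
  · exact mem_of_map_mem hφ h00 (by linarith)
  · exact mem_of_map_mem hφ h01 (by push_cast; linarith)
  · exact mem_of_map_mem hφ h10 (by push_cast; linarith)
  · exact mem_of_map_mem hφ h11 (by push_cast; linarith)
  · exact mem_of_map_mem hφ h00' (by linarith)
  · exact mem_of_map_mem hφ h01' (by push_cast; linarith)
  · exact mem_of_map_mem hφ h10' (by push_cast; linarith)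
  · exact mem_of_map_mem hφ h11' (by push_cast; linarith)

theorem entryBound_of_glMap_antidiagonal' (hφ : ∀ x, x ≠ 0 → v.ord (φ x) = m * vC.ord x)
    {η : (Matrix (Fin 2) (Fin 2) C)ˣ} {j : ℤ} {k l : ℕ} (hk : k < m) (hl : l < m) (hkl : k + l = m)
    (H : v.EntryBound (m * j + l) k l (glMap φ η)) : vC.EntryBound (j + 1) 0 1 η := by
  obtain ⟨⟨h00, h01, h10, h11⟩, h00', h01', h10', h11'⟩ := H
  rw [glMap_apply] at h00 h01 h10 h11
  rw [glMap_inv_apply] at h00' h01' h10' h11'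
  have hk' : (k : ℤ) < m := by exact_mod_cast hk
  have hl' : (l : ℤ) < m := by exact_mod_cast hl
  have hkl' : (k : ℤ) + l = m := by exact_mod_cast hkl
  refine ⟨⟨?_, ?_, ?_, ?_⟩, ?_, ?_, ?_, ?_⟩
  · exact mem_of_map_mem hφ h00 (by linarith)
  · exact mem_of_map_mem hφ h01 (by push_cast; linarith)
  · exact mem_of_map_mem hφ h10 (by push_cast; linarith)
  · exact mem_of_map_mem hφ h11 (by push_cast; linarith)
  · exact mem_of_map_mem hφ h00' (by linarith)
  · exact mem_of_map_mem hφ h01' (by push_cast; linarith)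
  · exact mem_of_map_mem hφ h10' (by push_cast; linarith)
  · exact mem_of_map_mem hφ h11' (by push_cast; linarith)

theorem eq_of_dvd_sub {k l m : ℕ} (hk : k < m) (hl : l < m) {j : ℤ} (h : (k : ℤ) - l = m * j) :
    k = l := by
  have hd : (m : ℤ) ∣ k - l := ⟨j, h⟩
  have := Int.eq_zero_of_abs_lt_dvd hd (by rw [abs_lt]; omega)
  omega

theorem add_eq_of_dvd_add {k l m : ℕ} (hk : k < m) (hl : l < m) (h0 : 0 < k + l) {j : ℤ}
    (h : (k : ℤ) + l = m * j) : k + l = m := by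
  have hd : (m : ℤ) ∣ k + l - m := ⟨j - 1, by rw [h]; ring⟩
  have := Int.eq_zero_of_abs_lt_dvd hd (by rw [abs_lt]; omega)
  omega

/-- Points on subdivided edges of the tree of `C` that coincide in the tree of `B`. -/
theorem within_of_within_glMap (hφ : ∀ x, x ≠ 0 → v.ord (φ x) = m * vC.ord x)
    {g h : (Matrix (Fin 2) (Fin 2) C)ˣ} {k l : ℕ} (hk : k < m) (hl : l < m)
    (H : v.Within 0 (glMap φ g * v.low 0 k) (glMap φ h * v.low 0 l)) :
    (k = l ∧ vC.Within 0 g h ∧ (0 < k → vC.Within 0 (g * vC.low 0 1) (h * vC.low 0 1))) ∨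
    (k + l = m ∧ vC.Within 0 (g * vC.low 0 1) h ∧ vC.Within 0 g (h * vC.low 0 1)) := by
  rw [within_low_low_iff, glMap_inv_mul] at H
  rw [within_zero_iff, within_low_low_iff, within_low_one_iff, within_one_low_iff]
  set η := g⁻¹ * h with hη
  obtain ⟨i, H⟩ := H
  obtain ⟨⟨h00, h01, h10, h11⟩, h00', h01', h10', h11'⟩ := id H
  rw [glMap_apply] at h00 h01 h10 h11
  rw [glMap_inv_apply] at h00' h01' h10' h11'
  have d00 := dvd_of_mul_notMem hφ h00 h00' (by omega)
  have d00' := dvd_of_mul_notMem hφ h00' h00 (by omega)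
  have d01 := dvd_of_mul_notMem hφ h01 h10' (by omega)
  have d01' := dvd_of_mul_notMem hφ h10' h01 (by omega)
  have d10 := dvd_of_mul_notMem hφ h10 h01' (by omega)
  have d10' := dvd_of_mul_notMem hφ h01' h10 (by omega)
  have d11 := dvd_of_mul_notMem hφ h11 h11' (by omega)
  have d11' := dvd_of_mul_notMem hφ h11' h11 (by omega)
  have hneg {s t : ℤ} (h : ∃ j : ℤ, s = m * j) (hst : s + t = 0) : ∃ j : ℤ, t = m * j := by
    obtain ⟨j, hj⟩ := h
    exact ⟨-j, by linarith⟩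
  have e1 : (∃ j : ℤ, i = m * j) ∨ ∃ j : ℤ, i - l = m * j :=
    (notMem_or_notMem_of_add_eq_one (entry_mul_inv η 0)).imp d00 d01
  have e2 : (∃ j : ℤ, i + k = m * j) ∨ ∃ j : ℤ, i + k - l = m * j :=
    (notMem_or_notMem_of_add_eq_one (entry_mul_inv η 1)).imp d10 d11
  have e3 : (∃ j : ℤ, i = m * j) ∨ ∃ j : ℤ, i + k = m * j :=
    (notMem_or_notMem_of_add_eq_one (entry_inv_mul η 0)).imp
      (fun h => hneg (d00' h) (by omega)) (fun h => hneg (d10' h) (by omega))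
  have e4 : (∃ j : ℤ, i - l = m * j) ∨ ∃ j : ℤ, i + k - l = m * j :=
    (notMem_or_notMem_of_add_eq_one (entry_inv_mul η 1)).imp
      (fun h => hneg (d01' h) (by omega)) (fun h => hneg (d11' h) (by omega))
  -- As `η * η⁻¹ = 1` and `η⁻¹ * η = 1`, each row and each column of `η` has an entry that attains
  -- its bound. So both diagonal or both antidiagonal bounds are multiples of `m`: the first means
  -- equal positions on the edge, the second opposite ones. The case `k = l = 0` is kept apart,
  -- since there `k + l = m` would fail.
  have hcases : ((∃ j : ℤ, i = m * j) ∧ ∃ j : ℤ, i + k - l = m * j) ∨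
      (0 < k + l ∧ (∃ j : ℤ, i - l = m * j) ∧ ∃ j : ℤ, i + k = m * j) := by
    rcases Nat.eq_zero_or_pos (k + l) with h0 | h0
    · obtain ⟨rfl, rfl⟩ : k = 0 ∧ l = 0 := by omega
      simp only [Nat.cast_zero, add_zero, sub_zero, or_self] at e1 ⊢
      exact Or.inl ⟨e1, e1⟩
    · rcases e1 with e1 | e1
      · rcases e4 with e4 | e4
        · exact e2.elim (fun e2 => .inr ⟨h0, e4, e2⟩) (fun e2 => .inl ⟨e1, e2⟩)
        · exact .inl ⟨e1, e4⟩
      · rcases e3 with e3 | e3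
        · exact e2.elim (fun e2 => .inr ⟨h0, e1, e2⟩) (fun e2 => .inl ⟨e3, e2⟩)
        · exact .inr ⟨h0, e1, e3⟩
  rcases hcases with ⟨⟨j, hj⟩, j', hj'⟩ | ⟨h0, ⟨j, hj⟩, j', hj'⟩
  · obtain rfl : k = l := eq_of_dvd_sub hk hl (j := j' - j) (by linarith)
    rw [hj] at H
    exact Or.inl ⟨rfl, ⟨j, entryBound_of_glMap hφ hk H⟩, fun hk0 =>
      ⟨j, entryBound_one_of_glMap hφ hk0 hk H⟩⟩
  · have hkl : k + l = m := add_eq_of_dvd_add hk hl h0 (j := j' - j) (by linarith)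
    rw [show i = m * j + l by omega] at H
    exact Or.inr ⟨hkl, ⟨j, entryBound_of_glMap_antidiagonal hφ hk hl hkl H⟩,
      ⟨j + 1, entryBound_of_glMap_antidiagonal' hφ hk hl hkl H⟩⟩

theorem map_mem_of_mem (hφ : ∀ x, x ≠ 0 → v.ord (φ x) = m * vC.ord x) {x : C} {a b : ℤ}
    (hx : x ∈ vC.fil b) (h : a ≤ m * b) : φ x ∈ v.fil a := by
  by_cases hx0 : x = 0
  · rw [hx0, map_zero]
    exact zero_mem _
  · intro _
    rw [hφ x hx0]
    exact h.trans (mul_le_mul_of_nonneg_left (hx hx0) (by positivity))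

/-- A point on a subdivided edge depends only on the edge. -/
theorem within_glMap (hφ : ∀ x, x ≠ 0 → v.ord (φ x) = m * vC.ord x)
    {g h : (Matrix (Fin 2) (Fin 2) C)ˣ} (H : vC.Within 0 g h)
    (H' : vC.Within 0 (g * vC.low 0 1) (h * vC.low 0 1)) {k : ℕ} (hk : k ≤ m) :
    v.Within 0 (glMap φ g * v.low 0 k) (glMap φ h * v.low 0 k) := by
  rw [within_zero_iff] at H
  rw [within_low_low_iff] at H' ⊢
  rw [glMap_inv_mul]
  set η := g⁻¹ * h with hη
  obtain ⟨i, ⟨h00, h01, h10, h11⟩, h00', h01', h10', h11'⟩ := H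
  obtain ⟨j, ⟨k00, k01, k10, k11⟩, k00', k01', k10', k11'⟩ := H'
  simp only [Nat.cast_zero, Nat.cast_one, add_zero, sub_zero] at *
  -- Both homotheties use the same `η`, so `η⁻¹ * η = 1` and `η * η⁻¹ = 1` force equal exponents.
  -- Then the sharper bounds of the two can be combined.
  have hji : j ≤ i := by
    have h1 := add_mem (vC.mul_mem_fil' (k := j - i) (by omega) h00' k00)
      (vC.mul_mem_fil' (k := j - i) (by omega) h01' k10)
    rw [entry_inv_mul η 0, vC.one_mem_fil_iff] at h1
    omega
  have hij : i ≤ j := by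
    have h1 := add_mem (vC.mul_mem_fil' (k := i - j) (by omega) h00 k00')
      (vC.mul_mem_fil' (k := i - j) (by omega) h01 k10')
    rw [entry_mul_inv η 0, vC.one_mem_fil_iff] at h1
    omega
  obtain rfl : i = j := le_antisymm hij hji
  have hk' : (k : ℤ) ≤ m := by exact_mod_cast hk
  have hk0 : (0 : ℤ) ≤ k := by positivity
  refine ⟨m * i, ⟨?_, ?_, ?_, ?_⟩, ?_, ?_, ?_, ?_⟩
  · exact map_mem_of_mem hφ h00 (by linarith)
  · exact map_mem_of_mem hφ h01 (by linarith)
  · exact map_mem_of_mem hφ k10 (by linarith)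
  · exact map_mem_of_mem hφ h11 (by linarith)
  · exact map_mem_of_mem hφ h00' (by linarith)
  · exact map_mem_of_mem hφ h01' (by linarith)
  · exact map_mem_of_mem hφ k10' (by linarith)
  · exact map_mem_of_mem hφ h11' (by linarith)

theorem within_glMap_zero (hφ : ∀ x, x ≠ 0 → v.ord (φ x) = m * vC.ord x)
    {g h : (Matrix (Fin 2) (Fin 2) C)ˣ} (H : vC.Within 0 g h) :
    v.Within 0 (glMap φ g) (glMap φ h) := by
  rw [within_zero_iff] at H ⊢
  rw [glMap_inv_mul]
  obtain ⟨i, ⟨h00, h01, h10, h11⟩, h00', h01', h10', h11'⟩ := H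
  simp only [Nat.cast_zero, add_zero, sub_zero] at *
  refine ⟨m * i, ⟨?_, ?_, ?_, ?_⟩, ?_, ?_, ?_, ?_⟩
  · exact map_mem_of_mem hφ h00 (by linarith)
  · exact map_mem_of_mem hφ h01 (by push_cast; linarith)
  · exact map_mem_of_mem hφ h10 (by push_cast; linarith)
  · exact map_mem_of_mem hφ h11 (by push_cast; linarith)
  · exact map_mem_of_mem hφ h00' (by linarith)
  · exact map_mem_of_mem hφ h01' (by push_cast; linarith)
  · exact map_mem_of_mem hφ h10' (by push_cast; linarith)
  · exact map_mem_of_mem hφ h11' (by push_cast; linarith)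

theorem map_unif_pow_mem (hφ : ∀ x, x ≠ 0 → v.ord (φ x) = m * vC.ord x) (r : ℕ) :
    φ (vC.unif ^ r) ∈ v.fil (m * r) := map_mem_of_mem hφ (vC.unif_pow_mem r) le_rfl

theorem map_unif_pow_inv_mem (hφ : ∀ x, x ≠ 0 → v.ord (φ x) = m * vC.ord x) (r : ℕ) :
    φ (vC.unif ^ r)⁻¹ ∈ v.fil (-(m * r)) :=
  map_mem_of_mem hφ (vC.unif_pow_inv_mem r) (by linarith)

/-- The points of a subdivided edge, continued beyond its end. -/
theorem within_glMap_low (hφ : ∀ x, x ≠ 0 → v.ord (φ x) = m * vC.ord x)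
    (g : (Matrix (Fin 2) (Fin 2) C)ˣ) (r k : ℕ) :
    v.Within 0 (glMap φ g * v.low 0 (m * r + k)) (glMap φ (g * vC.low 0 r) * v.low 0 k) := by
  rw [within_low_low_iff, glMap_inv_mul, inv_mul_cancel_left]
  refine ⟨0, ⟨?_, ?_, ?_, ?_⟩, ?_, ?_, ?_, ?_⟩
  · rw [glMap_apply, DiscVal.coe_low]; simpa using v.one_mem_fil
  · rw [glMap_apply, DiscVal.coe_low]; simp
  · rw [glMap_apply, DiscVal.coe_low]; simp
  · rw [glMap_apply, DiscVal.coe_low]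
    exact DiscVal.fil_mono (by push_cast; linarith) (map_unif_pow_mem hφ r)
  · rw [glMap_inv_apply, DiscVal.coe_low_inv]; simpa using v.one_mem_fil
  · rw [glMap_inv_apply, DiscVal.coe_low_inv]; simp
  · rw [glMap_inv_apply, DiscVal.coe_low_inv]; simp
  · rw [glMap_inv_apply, DiscVal.coe_low_inv]
    exact DiscVal.fil_mono (by push_cast; linarith) (map_unif_pow_inv_mem hφ r)

/-- The points of a subdivided edge, with the orientation reversed. -/
theorem within_glMap_swap (hφ : ∀ x, x ≠ 0 → v.ord (φ x) = m * vC.ord x)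
    (g : (Matrix (Fin 2) (Fin 2) C)ˣ) {k : ℕ} (hk : k ≤ m) :
    v.Within 0 (glMap φ g * v.low 0 k)
      (glMap φ (g * vC.low 0 1 * DiscVal.swap C) * v.low 0 (m - k)) := by
  rw [within_low_low_iff, glMap_inv_mul, mul_assoc g, inv_mul_cancel_left]
  have hk' : ((m - k : ℕ) : ℤ) = m - k := by omega
  have h1 : (vC.low 0 1 * DiscVal.swap C : (Matrix (Fin 2) (Fin 2) C)ˣ).val =
      !![0, 1; vC.unif ^ 1, 0] := by
    simp [Units.val_mul, DiscVal.coe_low, DiscVal.coe_swap]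
  have h2 : ((vC.low 0 1 * DiscVal.swap C)⁻¹ : (Matrix (Fin 2) (Fin 2) C)ˣ).val =
      !![0, (vC.unif ^ 1)⁻¹; 1, 0] := by
    simp [mul_inv_rev, Units.val_mul, DiscVal.coe_low_inv, DiscVal.coe_swap_inv]
  refine ⟨m - k, ⟨?_, ?_, ?_, ?_⟩, ?_, ?_, ?_, ?_⟩
  · rw [glMap_apply, h1]; simp
  · rw [glMap_apply, h1, hk']; simpa using v.one_mem_fil
  · rw [glMap_apply, h1]
    exact DiscVal.fil_mono (by push_cast; linarith) (map_unif_pow_mem hφ 1)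
  · rw [glMap_apply, h1]; simp
  · rw [glMap_inv_apply, h2]; simp
  · rw [glMap_inv_apply, h2]
    exact DiscVal.fil_mono (by push_cast; linarith) (map_unif_pow_inv_mem hφ 1)
  · rw [glMap_inv_apply, h2, hk']; simpa using v.one_mem_fil
  · rw [glMap_inv_apply, h2]; simp

end Embedding

/-! ### The subdivided tree of `C` inside the tree of `B` -/

section EdgeMap

variable {K : Type*} [Field K] [ValuativeRel K] [TopologicalSpace K]
  [IsNonarchimedeanLocalField K] {B C : Type*} [DivisionRing B] [Algebra K B]
  [FiniteDimensional K B] [DivisionRing C] [Algebra K C] [FiniteDimensional K C]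
  {v : DiscVal B} {vC : DiscVal C} {φ : C →ₐ[K] B} {m : ℕ}

/-- The oriented edge from `g 𝒪²` to `g diag(1, π) 𝒪²`. -/
def stdDart (hvC : vC.IsCompat K) (g : (Matrix (Fin 2) (Fin 2) C)ˣ) : (tree K C).Dart :=
  ⟨(hvC.vertex g, hvC.vertex (g * vC.low 0 1)), adj_vertex_low hvC (zero_mem _) g⟩

/-- `GL₂(C)` is transitive on oriented edges, so edges can be handled through matrices. -/
theorem exists_stdDart_eq (hvC : vC.IsCompat K) (a : (tree K C).Dart) :
    ∃ g, stdDart hvC g = a := by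
  obtain ⟨⟨Λ, Λ'⟩, h⟩ := a
  obtain ⟨g, rfl⟩ := exists_vertex_eq hvC Λ
  rcases eq_vertex_of_adj hvC h with ⟨b, hb, rfl⟩ | rfl
  · refine ⟨g * vC.low b 0, SimpleGraph.Dart.ext _ _ (Prod.ext ?_ ?_)⟩
    · exact vertex_low_zero hvC hb g
    · change hvC.vertex _ = hvC.vertex _
      rw [mul_assoc, vC.low_mul_low_zero, zero_add]
  · exact ⟨g * DiscVal.swap C, SimpleGraph.Dart.ext _ _ (Prod.ext (vertex_swap hvC g) rfl)⟩

theorem stdDart_eq_iff (hvC : vC.IsCompat K) {g h : (Matrix (Fin 2) (Fin 2) C)ˣ} :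
    stdDart hvC g = stdDart hvC h ↔
      vC.Within 0 g h ∧ vC.Within 0 (g * vC.low 0 1) (h * vC.low 0 1) := by
  rw [SimpleGraph.Dart.ext_iff, Prod.ext_iff]
  exact and_congr (vertex_eq_iff hvC) (vertex_eq_iff hvC)

theorem stdDart_symm (hvC : vC.IsCompat K) (g : (Matrix (Fin 2) (Fin 2) C)ˣ) :
    (stdDart hvC g).symm = stdDart hvC (g * vC.low 0 1 * DiscVal.swap C) :=
  SimpleGraph.Dart.ext _ _ (Prod.ext (vertex_swap hvC _).symm (vertex_back hvC g).symm)

variable (φ) in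
/-- The point at distance `k` from `g 𝒪²` on the subdivided edge from `g 𝒪²` to
`g diag(1, π) 𝒪²`. -/
def edgeVertex (hv : v.IsCompat K) (g : (Matrix (Fin 2) (Fin 2) C)ˣ) (k : ℕ) : MaximalOrder K B :=
  hv.vertex (glMap φ g * v.low 0 k)

theorem edgeVertex_eq_of_stdDart_eq (hv : v.IsCompat K) (hvC : vC.IsCompat K)
    (hφ : ∀ x, x ≠ 0 → v.ord (φ x) = m * vC.ord x) {g h : (Matrix (Fin 2) (Fin 2) C)ˣ}
    (H : stdDart hvC g = stdDart hvC h) {k : ℕ} (hk : k ≤ m) :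
    edgeVertex φ hv g k = edgeVertex φ hv h k := by
  obtain ⟨h1, h2⟩ := (stdDart_eq_iff hvC).1 H
  exact (vertex_eq_iff hv).2 (within_glMap hφ h1 h2 hk)

omit [FiniteDimensional K C] in
theorem edgeVertex_zero (hv : v.IsCompat K) (g : (Matrix (Fin 2) (Fin 2) C)ˣ) :
    edgeVertex φ hv g 0 = hv.vertex (glMap φ g) := by
  rw [edgeVertex, low_zero_zero, mul_one]

omit [FiniteDimensional K C] in
theorem edgeVertex_mul_low (hv : v.IsCompat K)
    (hφ : ∀ x, x ≠ 0 → v.ord (φ x) = m * vC.ord x) (g : (Matrix (Fin 2) (Fin 2) C)ˣ) (r k : ℕ) :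
    edgeVertex φ hv (g * vC.low 0 r) k = edgeVertex φ hv g (m * r + k) :=
  ((vertex_eq_iff hv).2 (within_glMap_low hφ g r k)).symm

theorem vertex_glMap_eq (hv : v.IsCompat K) (hvC : vC.IsCompat K)
    (hφ : ∀ x, x ≠ 0 → v.ord (φ x) = m * vC.ord x) {g h : (Matrix (Fin 2) (Fin 2) C)ˣ}
    (H : hvC.vertex g = hvC.vertex h) : hv.vertex (glMap φ g) = hv.vertex (glMap φ h) :=
  (vertex_eq_iff hv).2 (within_glMap_zero hφ ((vertex_eq_iff hvC).1 H))

/-- The embedding of the subdivided tree of `C` in the tree of `B`. -/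
noncomputable def edgeMap (hv : v.IsCompat K) (hvC : vC.IsCompat K)
    (hφ : ∀ x, x ≠ 0 → v.ord (φ x) = m * vC.ord x) :
    MaximalOrder K C ⊕ InnerVertex (tree K C) m → MaximalOrder K B :=
  Sum.elim (fun Λ => hv.vertex (glMap φ (exists_vertex_eq hvC Λ).choose))
    (Quot.lift (fun p => edgeVertex φ hv (exists_stdDart_eq hvC p.1).choose p.2) (by
      rintro ⟨a, k, hk0, hk⟩ ⟨a', k', hk0', hk'⟩ ⟨h1, h2⟩
      change k + k' = m at h2
      change a' = a.symm at h1
      have ha := (exists_stdDart_eq hvC a).choose_spec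
      have ha' := (exists_stdDart_eq hvC a').choose_spec
      change edgeVertex φ hv (exists_stdDart_eq hvC a).choose k =
        edgeVertex φ hv (exists_stdDart_eq hvC a').choose k'
      rw [edgeVertex, (vertex_eq_iff hv).2 (within_glMap_swap (vC := vC) hφ _ hk.le)]
      obtain rfl : k' = m - k := by omega
      refine edgeVertex_eq_of_stdDart_eq hv hvC hφ ?_ hk'.le
      rw [← stdDart_symm, ha', h1, ha]))

theorem edgeMap_inl (hv : v.IsCompat K) (hvC : vC.IsCompat K)
    (hφ : ∀ x, x ≠ 0 → v.ord (φ x) = m * vC.ord x) (g : (Matrix (Fin 2) (Fin 2) C)ˣ) :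
    edgeMap hv hvC hφ (.inl (hvC.vertex g)) = hv.vertex (glMap φ g) :=
  vertex_glMap_eq hv hvC hφ (exists_vertex_eq hvC _).choose_spec

theorem edgeMap_edgePoint (hv : v.IsCompat K) (hvC : vC.IsCompat K) (hm : 0 < m)
    (hφ : ∀ x, x ≠ 0 → v.ord (φ x) = m * vC.ord x) (g : (Matrix (Fin 2) (Fin 2) C)ˣ) {k : ℕ}
    (hk : k ≤ m) :
    edgeMap hv hvC hφ (edgePoint (tree K C) m (stdDart hvC g) k) = edgeVertex φ hv g k := by
  rcases Nat.eq_zero_or_pos k with rfl | h0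
  · rw [edgePoint_zero, edgeVertex_zero]
    exact edgeMap_inl hv hvC hφ g
  rcases hk.eq_or_lt with rfl | h1
  · rw [edgePoint_self _ hm]
    have := edgeVertex_mul_low hv hφ g 1 0
    rw [edgeVertex_zero, mul_one, add_zero] at this
    rw [← this]
    exact edgeMap_inl hv hvC hφ _
  · rw [edgePoint_of_lt _ _ ⟨h0, h1⟩]
    exact edgeVertex_eq_of_stdDart_eq hv hvC hφ (exists_stdDart_eq hvC _).choose_spec hk

theorem exists_edgePoint_stdDart_eq (hvC : vC.IsCompat K) (hm : 0 < m)
    (z : MaximalOrder K C ⊕ InnerVertex (tree K C) m) :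
    ∃ g k, k < m ∧ z = edgePoint (tree K C) m (stdDart hvC g) k := by
  rcases z with Λ | z
  · obtain ⟨g, rfl⟩ := exists_vertex_eq hvC Λ
    exact ⟨g, 0, hm, (edgePoint_zero (tree K C) (stdDart hvC g)).symm⟩
  · obtain ⟨a, k, hk, rfl⟩ := exists_edgePoint_inr _ z
    obtain ⟨g, rfl⟩ := exists_stdDart_eq hvC a
    exact ⟨g, k, hk.2, (edgePoint_of_lt _ _ hk).symm⟩

theorem edgeMap_injective (hv : v.IsCompat K) (hvC : vC.IsCompat K) (hm : 0 < m)
    (hφ : ∀ x, x ≠ 0 → v.ord (φ x) = m * vC.ord x) :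
    Function.Injective (edgeMap hv hvC hφ) := by
  intro x y hxy
  obtain ⟨g, k, hk, rfl⟩ := exists_edgePoint_stdDart_eq hvC hm x
  obtain ⟨h, l, hl, rfl⟩ := exists_edgePoint_stdDart_eq hvC hm y
  rw [edgeMap_edgePoint hv hvC hm hφ g hk.le, edgeMap_edgePoint hv hvC hm hφ h hl.le] at hxy
  rcases within_of_within_glMap hφ hk hl ((vertex_eq_iff hv).1 hxy) with
    ⟨rfl, h1, h2⟩ | ⟨hkl, h1, h2⟩
  · rcases Nat.eq_zero_or_pos k with rfl | h0
    · rw [edgePoint_zero, edgePoint_zero]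
      exact congrArg _ ((vertex_eq_iff hvC).2 h1)
    · rw [(stdDart_eq_iff hvC).2 ⟨h1, h2 h0⟩]
  · have h3 : stdDart hvC h = (stdDart hvC g).symm :=
      SimpleGraph.Dart.ext _ _ (Prod.ext ((vertex_eq_iff hvC).2 h1.symm)
        ((vertex_eq_iff hvC).2 h2.symm))
    rw [h3, edgePoint_symm _ hm _ hl.le]
    congr 1
    omega

/-- Here `k` is unbounded: beyond `m` the points continue along the ray of the lattices `g diag(1,
πʳ) 𝒪²`, so the quotient of `k` by `m` selects the edge and the remainder the point on it. -/
theorem mem_range_edgeMap_iff (hv : v.IsCompat K) (hvC : vC.IsCompat K) (hm : 0 < m)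
    (hφ : ∀ x, x ≠ 0 → v.ord (φ x) = m * vC.ord x) {Λ : MaximalOrder K B} :
    (∃ z, edgeMap hv hvC hφ z = Λ) ↔ ∃ g k, Λ = edgeVertex φ hv g k := by
  constructor
  · rintro ⟨z, rfl⟩
    obtain ⟨g, k, hk, rfl⟩ := exists_edgePoint_stdDart_eq hvC hm z
    exact ⟨g, k, edgeMap_edgePoint hv hvC hm hφ g hk.le⟩
  · rintro ⟨g, k, rfl⟩
    refine ⟨edgePoint (tree K C) m (stdDart hvC (g * vC.low 0 (k / m))) (k % m), ?_⟩
    rw [edgeMap_edgePoint hv hvC hm hφ _ (Nat.mod_lt _ hm).le, edgeVertex_mul_low hv hφ,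
      Nat.div_add_mod]

theorem edgeMap_adj (hv : v.IsCompat K) (hvC : vC.IsCompat K) (hm : 0 < m)
    (hφ : ∀ x, x ≠ 0 → v.ord (φ x) = m * vC.ord x)
    {x y : MaximalOrder K C ⊕ InnerVertex (tree K C) m} (h : (subdivision (tree K C) m).Adj x y) :
    (tree K B).Adj (edgeMap hv hvC hφ x) (edgeMap hv hvC hφ y) := by
  obtain ⟨a, k, hk, rfl, rfl⟩ := exists_edgePoint_of_subdivision_adj _ hm h
  obtain ⟨g, rfl⟩ := exists_stdDart_eq hvC a
  rw [edgeMap_edgePoint hv hvC hm hφ g hk.le, edgeMap_edgePoint hv hvC hm hφ g hk]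
  exact adj_vertex_low_succ hv _ 0 k

theorem vertex_low_ne_swap (hvC : vC.IsCompat K) {b : C} (g : (Matrix (Fin 2) (Fin 2) C)ˣ) :
    hvC.vertex (g * vC.low b 1) ≠ hvC.vertex (g * DiscVal.swap C * vC.low 0 1) := by
  rw [mul_assoc, ne_eq, vertex_mul_left, vertex_eq_iff]
  rintro ⟨i, h1, h2⟩
  have e1 : ((vC.low b 1)⁻¹ * (DiscVal.swap C * vC.low 0 1)).val =
      !![0, vC.unif; vC.unif⁻¹, -(vC.unif⁻¹ * b * vC.unif)] := by
    simp [Units.val_mul, DiscVal.coe_low_inv, DiscVal.coe_swap, DiscVal.coe_low]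
  have e2 : ((DiscVal.swap C * vC.low 0 1)⁻¹ * vC.low b 1).val =
      !![b, vC.unif; vC.unif⁻¹, 0] := by
    simp [mul_inv_rev, Units.val_mul, DiscVal.coe_low_inv, DiscVal.coe_swap_inv, DiscVal.coe_low]
  rw [e1, DiscVal.matFil_mk] at h1
  rw [e2, DiscVal.matFil_mk] at h2
  have h3 := h1.2.2.1
  have h4 := h2.2.2.1
  rw [vC.mem_fil_of_ne (inv_ne_zero vC.unif_ne_zero), vC.ord_inv vC.unif_ne_zero,
    vC.ord_unif] at h3 h4
  omega

/-- The old vertices of a subdivision of the tree are nodes. -/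
theorem inl_mem_nodes (hvC : vC.IsCompat K) (hm : 0 < m) (Λ : MaximalOrder K C) :
    Sum.inl Λ ∈ nodes (subdivision (tree K C) m) := by
  obtain ⟨g, rfl⟩ := exists_vertex_eq hvC Λ
  have hadj (h : (Matrix (Fin 2) (Fin 2) C)ˣ) (hh : hvC.vertex h = hvC.vertex g) :
      edgePoint (tree K C) m (stdDart hvC h) 1 ∈
        (subdivision (tree K C) m).neighborSet (.inl (hvC.vertex g)) := by
    have := subdivision_adj_edgePoint (tree K C) hm (stdDart hvC h) hm
    rw [edgePoint_zero] at this
    change (subdivision (tree K C) m).Adj _ _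
    rw [← hh]
    exact this
  have hinj (a a' : (tree K C).Dart) (h1 : a.fst = a'.fst) (h2 : a.snd ≠ a'.snd) :
      edgePoint (tree K C) m a 1 ≠ edgePoint (tree K C) m a' 1 := by
    intro H
    -- For `m = 1` the first point on an edge is already its far end.
    rcases (Nat.succ_le_of_lt hm).eq_or_lt with hm1 | hm1
    · have hm2 : m = 1 := hm1.symm
      subst hm2
      rw [edgePoint_self _ one_pos, edgePoint_self _ one_pos] at H
      exact h2 (Sum.inl_injective H)
    · rw [edgePoint_of_lt _ _ ⟨one_pos, hm1⟩, edgePoint_of_lt _ _ ⟨one_pos, hm1⟩] at H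
      rcases eq_or_eq_symm_of_quot_mk_eq _ (Sum.inr_injective H) with h | ⟨h, -⟩
      · exact h2 (congrArg (fun p => p.1.snd) h).symm
      · have h3 : a'.fst = a.snd := congrArg (fun p => p.fst) h
        exact a.fst_ne_snd (h1.trans h3)
  have e0 : hvC.vertex (g * vC.low 1 0) = hvC.vertex g := vertex_low_zero hvC vC.one_mem_fil g
  have e1 : hvC.vertex (g * DiscVal.swap C) = hvC.vertex g := vertex_swap hvC g
  have d01 : hvC.vertex (g * vC.low 0 1) ≠ hvC.vertex (g * vC.low 1 0 * vC.low 0 1) := by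
    rw [mul_assoc, vC.low_mul_low_zero, zero_add, ne_eq, vertex_low_eq_iff, zero_sub, neg_mem_iff,
      vC.one_mem_fil_iff]
    simp
  have d12 : hvC.vertex (g * vC.low 1 0 * vC.low 0 1) ≠
      hvC.vertex (g * DiscVal.swap C * vC.low 0 1) := by
    rw [mul_assoc g, vC.low_mul_low_zero, zero_add]
    exact vertex_low_ne_swap hvC g
  -- Three neighbours suffice; they point towards the residues `0`, `1` and `∞` of the projective
  -- line.
  have hsub : ({edgePoint (tree K C) m (stdDart hvC g) 1,
      edgePoint (tree K C) m (stdDart hvC (g * vC.low 1 0)) 1,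
      edgePoint (tree K C) m (stdDart hvC (g * DiscVal.swap C)) 1} : Set _) ⊆
        (subdivision (tree K C) m).neighborSet (.inl (hvC.vertex g)) := by
    rintro _ (rfl | rfl | rfl)
    · exact hadj _ rfl
    · exact hadj _ e0
    · exact hadj _ e1
  refine le_trans (le_of_eq ?_) (Set.encard_le_encard hsub)
  rw [Set.encard_insert_of_notMem, Set.encard_pair]
  · rfl
  · exact hinj _ _ (e0.trans e1.symm) d12
  · rintro (H | H)
    · exact hinj _ _ e0.symm d01 H
    · exact hinj _ _ e1.symm (vertex_low_ne_swap hvC g) H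

end EdgeMap

/-! ### Depth of the hanging parts -/

section HangingTreeLength

variable {V W : Type*} {S : SimpleGraph V}

theorem exists_walk_offGraph {I : Set V} (u : ℕ → V) {j r : ℕ} (hjr : j ≤ r)
    (hadj : ∀ i < r, S.Adj (u i) (u (i + 1))) (hI : ∀ i, j < i → i ≤ r → u i ∉ I) :
    ∃ q : (offGraph S I).Walk (u j) (u r), q.length = r - j := by
  obtain ⟨t, rfl⟩ := Nat.exists_eq_add_of_le hjr
  clear hjr
  induction t with
  | zero => exact ⟨.nil, by simp⟩
  | succ t ih =>
    obtain ⟨q, hq⟩ := ih (fun i hi => hadj i (by omega)) (fun i hi hi' => hI i hi (by omega))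
    have h : (offGraph S I).Adj (u (j + t)) (u (j + (t + 1))) :=
      ⟨hadj (j + t) (by omega), fun h => hI (j + (t + 1)) (by omega) le_rfl h.2⟩
    exact ⟨q.concat h, by rw [SimpleGraph.Walk.length_concat, hq]; omega⟩

/-- A walk without edges inside the subtree that ends in this hanging part must start at its root.
In an acyclic graph the path between two vertices is unique, so it is no longer than that walk. -/
theorem hangingTree_length_le {G : SimpleGraph W} (hS : S.IsAcyclic) (hG : G.Preconnected)
    (ι : G →g S) (x₀ : W) {d : ℕ}
    (h : ∀ v, ∃ (y : W) (q : (offGraph S (Set.range ι)).Walk (ι y) v), q.length ≤ d)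
    (z : {u // (offGraph S (Set.range ι)).Reachable (ι x₀) u})
    (p : (hangingTree S (Set.range ι) (ι x₀)).Walk ⟨ι x₀, .rfl⟩ z) (hp : p.IsPath) :
    p.length ≤ d := by
  classical
  obtain ⟨y, q, hq⟩ := h z.1
  have hy : ι y = ι x₀ := eq_of_offGraph_reachable hS hG ι (q.reachable.trans z.2.symm)
  have hac : (offGraph S (Set.range ι)).IsAcyclic := hS.anti (offGraph_le S _)
  let F : hangingTree S (Set.range ι) (ι x₀) →g offGraph S (Set.range ι) :=
    ⟨Subtype.val, fun h => h⟩
  have hpF : (p.map F).IsPath := hp.map Subtype.val_injective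
  have h1 := (hac.subsingleton_path _ _).elim ⟨p.map F, hpF⟩ (q.copy hy rfl).toPath
  have h2 : p.length = (q.copy hy rfl).bypass.length := by
    have := congrArg (fun q : (offGraph S (Set.range ι)).Path _ _ => q.1.length) h1
    rwa [SimpleGraph.Walk.length_map] at this
  rw [h2]
  exact ((q.copy hy rfl).length_bypass_le_length).trans (by simpa using hq)

end HangingTreeLength

/-! ### The branch and the subdivided tree in it -/

section Branch

variable {K : Type*} [Field K] {B L C : Type*} [DivisionRing B] [Algebra K B]
  [DivisionRing L] [Algebra K L] [DivisionRing C] [Algebra K C]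

/-- The properties of commuting division algebras `L`, `C` in `B` that determine the branch
of `𝒪_L`. -/
structure IsBranchPair (v : DiscVal B) (vL : DiscVal L) (vC : DiscVal C) (ψ : L →ₐ[K] B)
    (φ : C →ₐ[K] B) (d m : ℕ) : Prop where
  pos : 0 < m
  ord_map : ∀ x, x ≠ 0 → v.ord (φ x) = m * vC.ord x
  map_mem : ∀ l ∈ vL.fil 0, ψ l ∈ v.fil 0
  comm : ∀ l c, ψ l * φ c = φ c * ψ l
  residue_comm : ∀ x ∈ v.fil 0, ∀ y ∈ v.fil 0, x * y - y * x ∈ v.fil 1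
  near : ∀ b ∈ v.fil 0, ∀ s : ℤ, (∀ l ∈ vL.fil 0, ψ l * b - b * ψ l ∈ v.fil s) →
    ∀ j : ℕ, j + d ≤ s → ∃ c ∈ vC.fil 0, b - φ c ∈ v.fil j
  conj : ∀ i : ℕ, 0 < i → i < m →
    ∃ l ∈ vL.fil 0, v.unif ^ i * ψ l * (v.unif ^ i)⁻¹ - ψ l ∉ v.fil 1

variable [ValuativeRel K] [TopologicalSpace K] [IsNonarchimedeanLocalField K]
  [FiniteDimensional K B] [FiniteDimensional K C]
  {v : DiscVal B} {vL : DiscVal L} {vC : DiscVal C} {ψ : L →ₐ[K] B} {φ : C →ₐ[K] B} {d m : ℕ}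
  {P : Set (MaximalOrder K B)}

omit [ValuativeRel K] [TopologicalSpace K] [IsNonarchimedeanLocalField K]
  [FiniteDimensional K B] [FiniteDimensional K C] in
theorem scalar_mul_glMap (hcomm : ∀ l c, ψ l * φ c = φ c * ψ l) (l : L)
    (g : (Matrix (Fin 2) (Fin 2) C)ˣ) :
    Matrix.scalar (Fin 2) (ψ l) * (glMap φ g).val = (glMap φ g).val * Matrix.scalar (Fin 2) (ψ l) := by
  ext a b
  rw [Matrix.scalar_apply, Matrix.diagonal_mul, Matrix.mul_diagonal, glMap_apply, hcomm]

omit [FiniteDimensional K C] in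
theorem scalar_mem_vertex_iff (hv : v.IsCompat K) (hcomm : ∀ l c, ψ l * φ c = φ c * ψ l) (l : L)
    (g : (Matrix (Fin 2) (Fin 2) C)ˣ) (x : (Matrix (Fin 2) (Fin 2) B)ˣ) :
    Matrix.scalar (Fin 2) (ψ l) ∈ (hv.vertex (glMap φ g * x)).1 ↔
      Matrix.scalar (Fin 2) (ψ l) ∈ (hv.vertex x).1 := by
  rw [mem_vertex, mem_vertex, mul_inv_rev, Units.val_mul, Units.val_mul, mul_assoc, mul_assoc,
    ← mul_assoc (Matrix.scalar (Fin 2) (ψ l)), scalar_mul_glMap hcomm, mul_assoc,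
    Units.inv_mul_cancel_left, mul_assoc]

/-- Matrices over `C` commute with the scalar matrix of `ψ l`, so `g` plays no role. Conjugated by
`low b r`, that matrix is lower triangular with integral diagonal and corner `π⁻ʳ (ψ l * b - b * ψ
l)`. -/
theorem vertex_low_mem_iff (hv : v.IsCompat K) (H : IsBranchPair v vL vC ψ φ d m)
    (hP : ∀ Λ, Λ ∈ P ↔ ∀ l ∈ vL.fil 0, Matrix.scalar (Fin 2) (ψ l) ∈ Λ.1)
    (g : (Matrix (Fin 2) (Fin 2) C)ˣ) (b : B) (r : ℕ) :
    hv.vertex (glMap φ g * v.low b r) ∈ P ↔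
      ∀ l ∈ vL.fil 0, ψ l * b - b * ψ l ∈ v.fil r := by
  rw [hP]
  refine forall₂_congr fun l hl => ?_
  rw [scalar_mem_vertex_iff hv H.comm, mem_vertex]
  have h1 : (v.low b r)⁻¹.val * Matrix.scalar (Fin 2) (ψ l) * (v.low b r).val =
      !![ψ l, 0; (v.unif ^ r)⁻¹ * (ψ l * b - b * ψ l), (v.unif ^ r)⁻¹ * (ψ l * v.unif ^ r)] := by
    have : Matrix.scalar (Fin 2) (ψ l) = !![ψ l, 0; 0, ψ l] := by
      ext a b
      fin_cases a <;> fin_cases b <;> simp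
    rw [this, DiscVal.coe_low_inv, DiscVal.coe_low]
    simp only [Matrix.mul_fin_two]
    simp [mul_assoc, mul_add, sub_eq_add_neg, add_comm]
  rw [h1, DiscVal.matFil_mk, v.inv_unif_pow_mul_mem_iff, v.inv_unif_pow_mul_mem_iff,
    v.mul_unif_pow_mem_iff, zero_add, sub_self]
  exact ⟨fun h => h.2.2.1, fun h => ⟨H.map_mem l hl, zero_mem _, h, H.map_mem l hl⟩⟩

theorem glMap_mul_mem_iff (hv : v.IsCompat K) (H : IsBranchPair v vL vC ψ φ d m)
    (hP : ∀ Λ, Λ ∈ P ↔ ∀ l ∈ vL.fil 0, Matrix.scalar (Fin 2) (ψ l) ∈ Λ.1)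
    (g : (Matrix (Fin 2) (Fin 2) C)ˣ) (x : (Matrix (Fin 2) (Fin 2) B)ˣ) :
    hv.vertex (glMap φ g * x) ∈ P ↔ hv.vertex x ∈ P := by
  rw [hP, hP]
  exact forall₂_congr fun l _ => scalar_mem_vertex_iff hv H.comm l g x

theorem edgeVertex_mem (hv : v.IsCompat K) (H : IsBranchPair v vL vC ψ φ d m)
    (hP : ∀ Λ, Λ ∈ P ↔ ∀ l ∈ vL.fil 0, Matrix.scalar (Fin 2) (ψ l) ∈ Λ.1)
    (g : (Matrix (Fin 2) (Fin 2) C)ˣ) (k : ℕ) : edgeVertex φ hv g k ∈ P :=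
  (vertex_low_mem_iff hv H hP g 0 k).2 fun l _ => by
    rw [mul_zero, zero_mul, sub_zero]
    exact zero_mem _

omit [ValuativeRel K] [TopologicalSpace K] [IsNonarchimedeanLocalField K]
  [FiniteDimensional K B] [FiniteDimensional K C] in
theorem exists_glMap_eq {s : (Matrix (Fin 2) (Fin 2) B)ˣ} (hs : s = 1 ∨ s = DiscVal.swap B) :
    ∃ g, glMap φ g = s := by
  rcases hs with rfl | rfl
  · exact ⟨1, map_one _⟩
  · exact ⟨DiscVal.swap C, glMap_swap⟩

theorem induce_preconnected (hv : v.IsCompat K) (H : IsBranchPair v vL vC ψ φ d m)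
    (hP : ∀ Λ, Λ ∈ P ↔ ∀ l ∈ vL.fil 0, Matrix.scalar (Fin 2) (ψ l) ∈ Λ.1) :
    ((tree K B).induce P).Preconnected := by
  refine induce_tree_preconnected hv fun s hs b _ r => ?_
  obtain ⟨g, rfl⟩ := exists_glMap_eq (φ := φ) hs
  rw [vertex_low_mem_iff hv H hP, vertex_low_mem_iff hv H hP]
  exact fun h l hl => DiscVal.fil_mono (by omega) (h l hl)

theorem edgeMap_mem (hv : v.IsCompat K) (hvC : vC.IsCompat K) (H : IsBranchPair v vL vC ψ φ d m)
    (hP : ∀ Λ, Λ ∈ P ↔ ∀ l ∈ vL.fil 0, Matrix.scalar (Fin 2) (ψ l) ∈ Λ.1)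
    (z : MaximalOrder K C ⊕ InnerVertex (tree K C) m) : edgeMap hv hvC H.ord_map z ∈ P := by
  obtain ⟨g, k, hk⟩ := (mem_range_edgeMap_iff hv hvC H.pos H.ord_map).1 ⟨z, rfl⟩
  rw [hk]
  exact edgeVertex_mem hv H hP g k

/-- The embedding of the subdivided tree of `C` in the branch. -/
noncomputable def branchEmbedding (hv : v.IsCompat K) (hvC : vC.IsCompat K)
    (H : IsBranchPair v vL vC ψ φ d m)
    (hP : ∀ Λ, Λ ∈ P ↔ ∀ l ∈ vL.fil 0, Matrix.scalar (Fin 2) (ψ l) ∈ Λ.1) :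
    subdivision (tree K C) m →g (tree K B).induce P where
  toFun z := ⟨edgeMap hv hvC H.ord_map z, edgeMap_mem hv hvC H hP z⟩
  map_rel' h := edgeMap_adj hv hvC H.pos H.ord_map h

theorem branchEmbedding_injective (hv : v.IsCompat K) (hvC : vC.IsCompat K)
    (H : IsBranchPair v vL vC ψ φ d m)
    (hP : ∀ Λ, Λ ∈ P ↔ ∀ l ∈ vL.fil 0, Matrix.scalar (Fin 2) (ψ l) ∈ Λ.1) :
    Function.Injective (branchEmbedding hv hvC H hP) := fun _ _ h =>
  edgeMap_injective hv hvC H.pos H.ord_map (Subtype.ext_iff.1 h)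

theorem mem_range_branchEmbedding_iff (hv : v.IsCompat K) (hvC : vC.IsCompat K)
    (H : IsBranchPair v vL vC ψ φ d m)
    (hP : ∀ Λ, Λ ∈ P ↔ ∀ l ∈ vL.fil 0, Matrix.scalar (Fin 2) (ψ l) ∈ Λ.1) {Λ : P} :
    Λ ∈ Set.range (branchEmbedding hv hvC H hP) ↔ ∃ g k, Λ.1 = edgeVertex φ hv g k := by
  rw [← mem_range_edgeMap_iff hv hvC H.pos H.ord_map]
  exact exists_congr fun z => Subtype.ext_iff

/-- The branch does not leave the subdivided tree of `C` at its new vertices. -/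
theorem mem_range_of_adj_inner (hv : v.IsCompat K) (hvC : vC.IsCompat K)
    (H : IsBranchPair v vL vC ψ φ d m)
    (hP : ∀ Λ, Λ ∈ P ↔ ∀ l ∈ vL.fil 0, Matrix.scalar (Fin 2) (ψ l) ∈ Λ.1)
    {g : (Matrix (Fin 2) (Fin 2) C)ˣ} {k : ℕ} (hk0 : 0 < k) (hk : k < m) {Λ : P}
    (h : (tree K B).Adj (edgeVertex φ hv g k) Λ) :
    Λ ∈ Set.range (branchEmbedding hv hvC H hP) := by
  rw [mem_range_branchEmbedding_iff]
  rcases eq_vertex_of_adj hv h with ⟨b, hb, hΛ⟩ | hΛ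
  · refine ⟨g, k + 1, ?_⟩
    have hmem := Λ.2
    rw [hΛ, mul_assoc, v.low_mul_low, zero_add, vertex_low_mem_iff hv H hP] at hmem
    obtain ⟨l, hl, hl1⟩ := H.conj k hk0 hk
    have hπ := v.unif_pow_ne_zero k
    have h1 := hmem l hl
    -- The commutator has order at least `k + 1`. After division by `πᵏ`, the commutator of `b` with
    -- `ψ l` has positive order because residues commute, so the first term does too. Its factor `Z`
    -- is a unit by the choice of `l`, which leaves `b` of positive order, and `Λ` is the next point
    -- on the same ray.
    have h2 : ψ l * (v.unif ^ k * b) - v.unif ^ k * b * ψ l =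
        v.unif ^ k * (((v.unif ^ k)⁻¹ * (ψ l - v.unif ^ k * ψ l * (v.unif ^ k)⁻¹) * v.unif ^ k) * b -
          (b * ψ l - ψ l * b)) := by
      simp only [mul_sub, sub_mul, mul_assoc, mul_inv_cancel_left₀ hπ, inv_mul_cancel_left₀ hπ,
        inv_mul_cancel₀ hπ, mul_one]
      abel
    rw [h2, v.mul_mem_fil_iff_left hπ, v.ord_unif_pow] at h1
    set Z := ψ l - v.unif ^ k * ψ l * (v.unif ^ k)⁻¹ with hZ
    have hZ1 : Z ∉ v.fil 1 := by rwa [← neg_mem_iff, hZ, neg_sub]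
    have hZ0 : Z ≠ 0 := fun h => hZ1 (by rw [h]; exact zero_mem _)
    have h3 := add_mem (DiscVal.fil_mono (by push_cast; omega) h1)
      (H.residue_comm b hb (ψ l) (H.map_mem l hl))
    rw [sub_add_cancel, v.mul_mem_fil_iff_left (mul_ne_zero (mul_ne_zero (inv_ne_zero hπ) hZ0) hπ),
      v.ord_mul (mul_ne_zero (inv_ne_zero hπ) hZ0) hπ, v.ord_mul (inv_ne_zero hπ) hZ0,
      v.ord_inv hπ] at h3
    rw [v.mem_fil_of_ne hZ0] at hZ1
    rw [hΛ, edgeVertex, ← v.low_mul_low_zero, ← mul_assoc, vertex_low_eq_iff, sub_zero]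
    exact DiscVal.fil_mono (by push_cast; omega) h3
  · refine ⟨g, k - 1, ?_⟩
    rw [hΛ, edgeVertex]
    obtain ⟨k, rfl⟩ := Nat.exists_eq_succ_of_ne_zero hk0.ne'
    rw [Nat.succ_eq_add_one, ← v.low_mul_low_zero, ← mul_assoc]
    exact vertex_back hv _

theorem act_glMap_mem (hv : v.IsCompat K) (H : IsBranchPair v vL vC ψ φ d m)
    (hP : ∀ Λ, Λ ∈ P ↔ ∀ l ∈ vL.fil 0, Matrix.scalar (Fin 2) (ψ l) ∈ Λ.1)
    (g : (Matrix (Fin 2) (Fin 2) C)ˣ) (Λ : MaximalOrder K B) (h : Λ ∈ P) :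
    hv.act (glMap φ g) Λ ∈ P := by
  obtain ⟨x, rfl⟩ := exists_vertex_eq hv Λ
  rwa [act_vertex, glMap_mul_mem_iff hv H hP]

omit [FiniteDimensional K C] in
theorem act_edgeVertex (hv : v.IsCompat K) (g h : (Matrix (Fin 2) (Fin 2) C)ˣ) (k : ℕ) :
    hv.act (glMap φ g) (edgeVertex φ hv h k) = edgeVertex φ hv (g * h) k := by
  rw [edgeVertex, act_vertex, ← mul_assoc, ← map_mul, edgeVertex]

/-- The automorphisms of the branch given by `GL₂(C)`. -/
noncomputable def branchAut (hv : v.IsCompat K) (H : IsBranchPair v vL vC ψ φ d m)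
    (hP : ∀ Λ, Λ ∈ P ↔ ∀ l ∈ vL.fil 0, Matrix.scalar (Fin 2) (ψ l) ∈ Λ.1)
    (g : (Matrix (Fin 2) (Fin 2) C)ˣ) : (tree K B).induce P ≃g (tree K B).induce P :=
  actInduce hv (glMap φ g) (act_glMap_mem hv H hP g)
    (by rw [← map_inv]; exact act_glMap_mem hv H hP g⁻¹)

theorem branchAut_vertex_glMap (hv : v.IsCompat K) (hvC : vC.IsCompat K)
    (H : IsBranchPair v vL vC ψ φ d m)
    (hP : ∀ Λ, Λ ∈ P ↔ ∀ l ∈ vL.fil 0, Matrix.scalar (Fin 2) (ψ l) ∈ Λ.1)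
    (g : (Matrix (Fin 2) (Fin 2) C)ˣ) :
    branchAut hv H hP g (branchEmbedding hv hvC H hP (.inl (hvC.vertex 1))) =
      branchEmbedding hv hvC H hP (.inl (hvC.vertex g)) := by
  refine Subtype.ext ?_
  change hv.act (glMap φ g) (edgeMap hv hvC H.ord_map (.inl (hvC.vertex 1))) =
    edgeMap hv hvC H.ord_map (.inl (hvC.vertex g))
  rw [edgeMap_inl, edgeMap_inl, act_vertex, map_one, mul_one]

theorem branchAut_mem_range_iff (hv : v.IsCompat K) (hvC : vC.IsCompat K)
    (H : IsBranchPair v vL vC ψ φ d m)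
    (hP : ∀ Λ, Λ ∈ P ↔ ∀ l ∈ vL.fil 0, Matrix.scalar (Fin 2) (ψ l) ∈ Λ.1)
    (g : (Matrix (Fin 2) (Fin 2) C)ˣ) (Λ : P) :
    branchAut hv H hP g Λ ∈ Set.range (branchEmbedding hv hvC H hP) ↔
      Λ ∈ Set.range (branchEmbedding hv hvC H hP) := by
  rw [mem_range_branchEmbedding_iff, mem_range_branchEmbedding_iff]
  change (∃ h k, hv.act (glMap φ g) Λ.1 = edgeVertex φ hv h k) ↔ _
  constructor
  · rintro ⟨h, k, hh⟩
    refine ⟨g⁻¹ * h, k, ?_⟩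
    rw [← act_edgeVertex, ← hh, map_inv]
    have := act_act_inv hv (glMap φ g)⁻¹ Λ.1
    rw [inv_inv] at this
    exact this.symm
  · rintro ⟨h, k, hh⟩
    exact ⟨g * h, k, by rw [hh, act_edgeVertex]⟩

/-- Nodes are exactly the old vertices. `GL₂(C)` carries the standard one to each of them and
preserves the branch and the subtree, while nothing hangs at the new vertices. -/
theorem nonempty_iso_attach_branch (hv : v.IsCompat K) (hvC : vC.IsCompat K)
    (H : IsBranchPair v vL vC ψ φ d m)
    (hP : ∀ Λ, Λ ∈ P ↔ ∀ l ∈ vL.fil 0, Matrix.scalar (Fin 2) (ψ l) ∈ Λ.1) :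
    Nonempty ((tree K B).induce P ≃g attach (subdivision (tree K C) m)
      (nodes (subdivision (tree K C) m))
      (hangingTree ((tree K B).induce P) (Set.range (branchEmbedding hv hvC H hP))
        (branchEmbedding hv hvC H hP (.inl (hvC.vertex 1)))) ⟨_, .rfl⟩) := by
  have hg (x : nodes (subdivision (tree K C) m)) : ∃ g, x.1 = .inl (hvC.vertex g) := by
    obtain ⟨Λ | z, hx⟩ := x
    · obtain ⟨g, rfl⟩ := exists_vertex_eq hvC Λ
      exact ⟨g, rfl⟩
    · exact absurd hx (inr_notMem_nodes_subdivision _ H.pos z)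
  choose γ hγ using hg
  refine nonempty_iso_attach ((tree_isAcyclic hv).induce P) (induce_preconnected hv H hP)
    (subdivision_preconnected _ H.pos (tree_preconnected hvC)) _
    (branchEmbedding_injective hv hvC H hP) _ _ ?_ (fun x => branchAut hv H hP (γ x)) ?_
    (fun x Λ => branchAut_mem_range_iff hv hvC H hP (γ x) Λ)
  · intro x hx Λ h
    obtain ⟨g, k, hk, rfl⟩ := exists_edgePoint_stdDart_eq hvC H.pos x
    have hk0 : 0 < k := by
      refine Nat.pos_of_ne_zero fun h0 => hx ?_
      rw [h0, edgePoint_zero]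
      exact inl_mem_nodes hvC H.pos _
    refine mem_range_of_adj_inner hv hvC H hP (g := g) hk0 hk ?_
    rw [← edgeMap_edgePoint hv hvC H.pos H.ord_map g hk.le]
    exact h
  · intro x
    rw [hγ]
    exact branchAut_vertex_glMap hv hvC H hP (γ x)

omit [FiniteDimensional K C] in
theorem edgeVertex_low (hv : v.IsCompat K) (g : (Matrix (Fin 2) (Fin 2) C)ˣ) (c : C) (k : ℕ) :
    edgeVertex φ hv (g * vC.low c 0) k = hv.vertex (glMap φ g * v.low (φ c) k) := by
  have h : glMap φ (vC.low c 0) = v.low (φ c) 0 := by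
    apply Units.ext
    ext a b
    rw [glMap_apply, DiscVal.coe_low, DiscVal.coe_low]
    fin_cases a <;> fin_cases b <;> simp
  rw [edgeVertex, map_mul, h, mul_assoc, v.low_mul_low_zero, zero_add]

/-- The paths that leave the subdivided tree of `C` inside the branch are short. -/
theorem exists_walk_branch (hv : v.IsCompat K) (hvC : vC.IsCompat K)
    (H : IsBranchPair v vL vC ψ φ d m)
    (hP : ∀ Λ, Λ ∈ P ↔ ∀ l ∈ vL.fil 0, Matrix.scalar (Fin 2) (ψ l) ∈ Λ.1) (Λ : P) :
    ∃ (y : _) (q : (offGraph ((tree K B).induce P) (Set.range (branchEmbedding hv hvC H hP))).Walk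
      (branchEmbedding hv hvC H hP y) Λ), q.length ≤ d := by
  classical
  obtain ⟨Λ, hΛ⟩ := Λ
  obtain ⟨s, hs, b, hb, r, rfl⟩ := exists_eq_vertex_low hv Λ
  obtain ⟨g, rfl⟩ := exists_glMap_eq (φ := φ) hs
  have hmem := (vertex_low_mem_iff hv H hP g b r).1 hΛ
  -- The ray from the standard vertex to `Λ`, constant from `r` on.
  let u : ℕ → P := fun i => ⟨hv.vertex (glMap φ g * v.low b (min i r)),
    (vertex_low_mem_iff hv H hP g b _).2 fun l hl => DiscVal.fil_mono (by omega) (hmem l hl)⟩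
  have hur : u r = ⟨_, hΛ⟩ := Subtype.ext (by change hv.vertex _ = _; rw [min_self])
  -- Approximation of `b` by `C` up to order `r - d` puts this point on the subtree. For `r ≤ d` it
  -- is the standard vertex.
  have hnear : u (r - d) ∈ Set.range (branchEmbedding hv hvC H hP) := by
    rw [mem_range_branchEmbedding_iff]
    obtain ⟨c, hc⟩ : ∃ c, b - φ c ∈ v.fil ((r - d : ℕ) : ℤ) := by
      rcases le_total d r with hd | hd
      · obtain ⟨c, -, hc⟩ := H.near b hb r hmem (r - d) (by omega)
        exact ⟨c, hc⟩
      · exact ⟨0, by rw [Nat.sub_eq_zero_of_le hd, map_zero, sub_zero]; exact hb⟩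
    refine ⟨g * vC.low c 0, r - d, ?_⟩
    rw [edgeVertex_low]
    change hv.vertex (glMap φ g * v.low b (min (r - d) r)) = _
    rw [min_eq_left (Nat.sub_le r d), vertex_low_eq_iff]
    exact hc
  -- After the last point on the subtree the ray uses no edge inside it, and at most `d` steps
  -- remain.
  set j := Nat.findGreatest (fun i => u i ∈ Set.range (branchEmbedding hv hvC H hP)) r with hj
  have hj1 : r - d ≤ j := Nat.le_findGreatest (Nat.sub_le r d) hnear
  obtain ⟨y, hy⟩ : u j ∈ Set.range (branchEmbedding hv hvC H hP) :=
    Nat.findGreatest_spec (P := fun i => u i ∈ Set.range (branchEmbedding hv hvC H hP))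
      (Nat.sub_le r d) hnear
  obtain ⟨q, hq⟩ := exists_walk_offGraph (S := (tree K B).induce P)
    (I := Set.range (branchEmbedding hv hvC H hP)) u (Nat.findGreatest_le r : j ≤ r)
    (fun i hi => by
      change (tree K B).Adj (hv.vertex (glMap φ g * v.low b (min i r)))
        (hv.vertex (glMap φ g * v.low b (min (i + 1) r)))
      rw [min_eq_left hi.le, min_eq_left hi]
      exact adj_vertex_low_succ hv _ b i)
    (fun i hi hi' => Nat.findGreatest_is_greatest hi hi')
  refine ⟨y, q.copy hy.symm hur, ?_⟩
  rw [SimpleGraph.Walk.length_copy, hq]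
  omega

end Branch

/-! ### Valency of the center of the rose -/

section Rose

variable {K : Type*} [Field K] [ValuativeRel K] [TopologicalSpace K]
  [IsNonarchimedeanLocalField K] {B L C : Type*} [DivisionRing B] [Algebra K B]
  [FiniteDimensional K B] [DivisionRing L] [Algebra K L] [DivisionRing C] [Algebra K C]
  [FiniteDimensional K C]
  {v : DiscVal B} {vL : DiscVal L} {vC : DiscVal C} {ψ : L →ₐ[K] B} {φ : C →ₐ[K] B} {d m : ℕ}
  {P : Set (MaximalOrder K B)}

/-- Two points of the subtree that are adjacent in the tree of `B` are adjacent in the subdivision,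
by acyclicity. So a neighbour of the standard vertex on the subtree is the first point of an edge of
the tree of `C`, and these edges are given by residues of `C` and the swap. -/
theorem vertex_low_mem_range_iff (hv : v.IsCompat K) (hvC : vC.IsCompat K) (hm : 0 < m)
    (hφ : ∀ x, x ≠ 0 → v.ord (φ x) = m * vC.ord x) {b : B} (hb : b ∈ v.fil 0) :
    (∃ z, edgeMap hv hvC hφ z = hv.vertex (v.low b 1)) ↔ ∃ c ∈ vC.fil 0, b - φ c ∈ v.fil 1 := by
  constructor
  · rintro ⟨z, hz⟩
    let ι : subdivision (tree K C) m →g tree K B :=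
      ⟨edgeMap hv hvC hφ, edgeMap_adj hv hvC hm hφ⟩
    have h1 : (tree K B).Adj (ι (.inl (hvC.vertex 1))) (ι z) := by
      change (tree K B).Adj (edgeMap hv hvC hφ (.inl (hvC.vertex 1))) (edgeMap hv hvC hφ z)
      rw [edgeMap_inl, hz, map_one]
      simpa using adj_vertex_low hv hb 1
    have h2 := adj_of_adj_map (tree_isAcyclic hv)
      (subdivision_preconnected _ hm (tree_preconnected hvC)) ι
      (edgeMap_injective hv hvC hm hφ) h1
    obtain ⟨⟨⟨Λ, Λ'⟩, h⟩, ha, rfl⟩ := exists_edgePoint_one_of_adj_inl _ hm h2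
    obtain rfl : Λ = hvC.vertex 1 := ha
    rcases eq_vertex_of_adj hvC h with ⟨c, hc, rfl⟩ | rfl
    · refine ⟨c, hc, ?_⟩
      have h3 : stdDart hvC (1 * vC.low c 0) = ⟨(hvC.vertex 1, hvC.vertex (1 * vC.low c 1)), h⟩ := by
        refine SimpleGraph.Dart.ext _ _ (Prod.ext (vertex_low_zero hvC hc 1) ?_)
        change hvC.vertex _ = hvC.vertex _
        rw [mul_assoc, vC.low_mul_low_zero, zero_add]
      rw [← h3, edgeMap_edgePoint hv hvC hm hφ _ hm, edgeVertex_low, map_one,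
        ← one_mul (v.low b 1), vertex_low_eq_iff] at hz
      rw [← neg_mem_iff, neg_sub]
      exact hz
    · exfalso
      have h3 : stdDart hvC (1 * DiscVal.swap C) =
          ⟨(hvC.vertex 1, hvC.vertex (1 * DiscVal.swap C * vC.low 0 1)), h⟩ :=
        SimpleGraph.Dart.ext _ _ (Prod.ext (vertex_swap hvC 1) rfl)
      rw [← h3, edgeMap_edgePoint hv hvC hm hφ _ hm, edgeVertex, map_mul, map_one, glMap_swap,
        ← one_mul (v.low b 1)] at hz
      exact vertex_low_ne_swap hv 1 hz.symm
  · rintro ⟨c, -, hc⟩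
    rw [mem_range_edgeMap_iff hv hvC hm hφ]
    refine ⟨1 * vC.low c 0, 1, ?_⟩
    rw [edgeVertex_low, map_one, ← one_mul (v.low b 1), vertex_low_eq_iff]
    exact hc

/-- The neighbours of the standard vertex are one for each residue in `k` and one from the swap. All
lie in the branch, because `k` is commutative. Those on the subtree are the one from the swap and
those with residue in the residue field `F` of `C`. -/
theorem encard_neighborSet_center (hv : v.IsCompat K) (hvC : vC.IsCompat K)
    (H : IsBranchPair v vL vC ψ φ d m)
    (hP : ∀ Λ, Λ ∈ P ↔ ∀ l ∈ vL.fil 0, Matrix.scalar (Fin 2) (ψ l) ∈ Λ.1)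
    {k : Type*} [Field k] (r : v.ResidueMap k) {F : Set k} (hF : ∀ y, y ∈ F ↔
      ∃ (x : C) (hx : φ x ∈ v.integer), x ∈ vC.fil 0 ∧ r.map ⟨φ x, hx⟩ = y) :
    ((hangingTree ((tree K B).induce P) (Set.range (branchEmbedding hv hvC H hP))
      (branchEmbedding hv hvC H hP (.inl (hvC.vertex 1)))).neighborSet ⟨_, .rfl⟩).encard =
        Fᶜ.encard := by
  set S := (tree K B).induce P with hS
  set I := Set.range (branchEmbedding hv hvC H hP) with hI
  set x₀ := branchEmbedding hv hvC H hP (.inl (hvC.vertex 1)) with hx₀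
  have hx₀1 : x₀.1 = hv.vertex 1 := by
    change edgeMap hv hvC H.ord_map (.inl (hvC.vertex 1)) = _
    rw [edgeMap_inl, map_one]
  have hFiff (b : v.integer) : r.map b ∈ F ↔ ∃ c ∈ vC.fil 0, (b : B) - φ c ∈ v.fil 1 := by
    rw [hF]
    constructor
    · rintro ⟨c, hc, hc0, h⟩
      exact ⟨c, hc0, (r.eq_iff).1 h.symm⟩
    · rintro ⟨c, hc0, h⟩
      exact ⟨c, map_mem_of_mem H.ord_map hc0 (by simp), hc0, ((r.eq_iff).2 h).symm⟩
  have hIiff (Λ : P) : Λ ∈ I ↔ ∃ z, edgeMap hv hvC H.ord_map z = Λ.1 :=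
    exists_congr fun z => Subtype.ext_iff
  let t : k → MaximalOrder K B := fun y => hv.vertex (v.low (r.surj y).choose 1)
  have ht (b : v.integer) : t (r.map b) = hv.vertex (v.low b 1) := by
    have h := (r.surj (r.map b)).choose_spec
    rw [r.eq_iff] at h
    have := (vertex_low_eq_iff hv (r := 1) 1).2 h
    rwa [one_mul, one_mul] at this
  have htinj : Function.Injective t := by
    intro y y' h
    obtain ⟨b, rfl⟩ := r.surj y
    obtain ⟨b', rfl⟩ := r.surj y'
    rw [ht, ht, ← one_mul (v.low b 1), ← one_mul (v.low b' 1), vertex_low_eq_iff] at h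
    exact r.eq_iff.2 h
  have hval : Function.Injective fun z : {u // (offGraph S I).Reachable x₀ u} => z.1.1 :=
    Subtype.val_injective.comp Subtype.val_injective
  rw [← htinj.encard_image, ← hval.encard_image]
  congr 1
  ext Λ
  constructor
  · rintro ⟨⟨⟨Λ, hΛ⟩, hz⟩, hadj, rfl⟩
    change (offGraph S I).Adj x₀ ⟨Λ, hΛ⟩ at hadj
    obtain ⟨h1, h2⟩ := hadj
    change (tree K B).Adj x₀.1 Λ at h1
    have hΛI : (⟨Λ, hΛ⟩ : P) ∉ I := fun h => h2 ⟨⟨_, rfl⟩, h⟩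
    rw [hIiff] at hΛI
    change ¬ ∃ z, edgeMap hv hvC H.ord_map z = Λ at hΛI
    change Λ ∈ t '' Fᶜ
    clear hz h2
    rw [hx₀1] at h1
    rcases eq_vertex_of_adj hv h1 with ⟨b, hb, rfl⟩ | rfl
    · rw [one_mul] at hΛI ⊢
      refine ⟨r.map ⟨b, hb⟩, ?_, ht ⟨b, hb⟩⟩
      rw [Set.mem_compl_iff, hFiff]
      rwa [vertex_low_mem_range_iff hv hvC H.pos H.ord_map hb] at hΛI
    · refine absurd ((mem_range_edgeMap_iff hv hvC H.pos H.ord_map).2 ⟨DiscVal.swap C, 1, ?_⟩) hΛI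
      rw [edgeVertex, glMap_swap, one_mul]
  · rintro ⟨y, hy, rfl⟩
    obtain ⟨b, rfl⟩ := r.surj y
    rw [ht]
    rw [Set.mem_compl_iff, hFiff] at hy
    have hmem : hv.vertex (v.low (b : B) 1) ∈ P := by
      have := (vertex_low_mem_iff hv H hP 1 (b : B) 1).2 fun l hl =>
        H.residue_comm _ (H.map_mem l hl) _ b.2
      rwa [map_one, one_mul] at this
    have hadj : (offGraph S I).Adj x₀ ⟨_, hmem⟩ := by
      refine ⟨?_, fun h => hy ?_⟩
      · change (tree K B).Adj x₀.1 (hv.vertex (v.low (b : B) 1))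
        rw [hx₀1]
        simpa using adj_vertex_low hv b.2 1
      · rw [← vertex_low_mem_range_iff hv hvC H.pos H.ord_map b.2]
        exact (hIiff _).1 h.2
    exact ⟨⟨⟨_, hmem⟩, hadj.reachable⟩, hadj, rfl⟩

end Rose

/-! ### Assembly -/

variable {K : Type*} [Field K] [ValuativeRel K] [TopologicalSpace K]
  [IsNonarchimedeanLocalField K] {B : Type u} [DivisionRing B] [Algebra K B]
  [Algebra.IsCentral K B] [FiniteDimensional K B]
  {L C : Type*} [DivisionRing L] [Algebra K L] [FiniteDimensional K L]
  [DivisionRing C] [Algebra K C] [FiniteDimensional K C]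

/-- The structure of the branch of `𝒪_L` in the tree of `B`, where `C` is the centralizer of `L`. -/
theorem exists_rose_iso_attach {n : ℕ} (hn : Module.finrank K B = n ^ 2) {ψ : L →ₐ[K] B}
    {φ : C →ₐ[K] B} (hcomm : ∀ l c, ψ l * φ c = φ c * ψ l)
    (hC : ∀ b, (∀ l, ψ l * b = b * ψ l) → ∃ c, φ c = b) {P : Set (MaximalOrder K B)}
    (hP : ∀ Λ, Λ ∈ P ↔ ∀ l : L, IsIntegral 𝒪[K] l → Matrix.scalar (Fin 2) (ψ l) ∈ Λ.1) :
    ramificationIndex K L ∣ n ∧ ∃ (Z : Type u) (R : SimpleGraph Z) (c : Z),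
      IsRose R c (Nat.card 𝓀[K] ^ n - Nat.card 𝓀[K] ^ (n / ramificationIndex K L))
        (n / ramificationIndex K L) ∧
      Nonempty ((tree K B).induce P ≃g attach (subdivision (tree K C) (residualDegree K L))
        (nodes (subdivision (tree K C) (residualDegree K L))) R c) := by
  obtain ⟨v, hv⟩ := exists_discVal K B
  obtain ⟨vL, hvL⟩ := exists_discVal K L
  obtain ⟨vC, hvC⟩ := exists_discVal K C
  obtain ⟨mL, hmL, hψ⟩ := exists_ord_map_eq_mul hvL hv ψ
  obtain ⟨mC, hmC, hφ⟩ := exists_ord_map_eq_mul hvC hv φ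
  obtain ⟨k, _, _, ⟨r⟩⟩ := v.exists_residueMap (relIndex_fil_ne_zero hv)
  obtain ⟨σ, hσ⟩ := r.exists_conj
  have hσn := orderOf_conj_eq hn hv hσ
  obtain ⟨heB, hfB⟩ := ramificationIndex_eq_and_residualDegree_eq hn hv
  have hk : Nat.card k = Nat.card 𝓀[K] ^ n := by rw [r.natCard, hv.relIndex_eq_card, hfB]
  have hn0 : 0 < n := by
    have : 0 < n ^ 2 := by rw [← hn]; exact Module.finrank_pos
    exact Nat.pos_of_ne_zero fun h => by simp [h] at this
  obtain ⟨hfC, hfL⟩ := residualDegree_centralizer hcomm hC hv hvL hvC hn0 heB hk hσn hσ hmL hψ hmC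
    hφ hn
  have hmul := ramificationIndex_mul hvL hv hψ
  rw [heB] at hmul
  have he0 : 0 < ramificationIndex K L := Nat.pos_of_ne_zero fun h => by simp [h] at hmul; omega
  have hdiv : n / ramificationIndex K L = mL := by
    rw [hmul, Nat.mul_div_cancel _ he0]
  refine ⟨⟨mL, by rw [hmul, mul_comm]⟩, ?_⟩
  rw [hdiv, hfL]
  -- The depth `mL` is `n / e`, and the subdivision `mC = e(B/C)` is the residual degree of `L`.
  have H : IsBranchPair v vL vC ψ φ mL mC :=
    { pos := hmC
      ord_map := hφ
      map_mem := fun l hl => (map_mem_fil_zero_iff hmL hψ).2 hl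
      comm := hcomm
      residue_comm := fun x hx y hy => r.comm ⟨x, hx⟩ ⟨y, hy⟩
      near := fun b hb s hs j hj => exists_near_centralizer hcomm hC hv hvL hvC hn0 heB hk hσn hσ
        hmL hψ hmC hφ hn hb hs j hj
      conj := fun i hi hi' => exists_conj_sub_notMem hcomm hC hv hvL hvC hn0 heB hk hσn hσ
        hmL hψ hmC hφ hn hi hi' }
  have hP' : ∀ Λ, Λ ∈ P ↔ ∀ l ∈ vL.fil 0, Matrix.scalar (Fin 2) (ψ l) ∈ Λ.1 := fun Λ => by
    rw [hP]
    exact forall_congr' fun l => by rw [hvL l]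
  refine ⟨_, _, _, ⟨?_, ?_, ?_⟩, nonempty_iso_attach_branch hv hvC H hP'⟩
  · exact hangingTree_isTree _ _ ((tree_isAcyclic hv).induce P) _
  · obtain ⟨F, hF, hFm⟩ := exists_residueSubfield hmC hφ r
    -- `k` has `q ^ n` elements and the residue field of `C` has `q ^ f(C/K) = q ^ mL`.
    rw [encard_neighborSet_center hv hvC H hP' r hFm, ← Set.Finite.cast_ncard_eq (Set.toFinite _),
      Set.ncard_compl (F : Set k), hk, ← hfC, ← hvC.relIndex_eq_card, ← hF]
    rfl
  · exact hangingTree_length_le ((tree_isAcyclic hv).induce P)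
      (subdivision_preconnected _ hmC (tree_preconnected hvC)) _ _
      (exists_walk_branch hv hvC H hP')

end BranchTree

theorem mainTheorem1 {K : Type v} [Field K] [ValuativeRel K] [TopologicalSpace K]
    [IsNonarchimedeanLocalField K] {B : Type u} [DivisionRing B] [Algebra K B]
    [Algebra.IsCentral K B] [FiniteDimensional K B] (n : ℕ) (hn : Module.finrank K B = n ^ 2)
    (q : ℕ) (hq : q = Nat.card 𝓀[K]) (L : Subalgebra K B) [IsSimpleRing L]
    (e : ℕ) (he : e = BranchTree.ramificationIndex K L)
    (e' : ℕ) (he' : e' = n / e)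
    (f : ℕ) (hf : f = BranchTree.residualDegree K L)
    (C : Subalgebra K B) (hC : C = Subalgebra.centralizer K (L : Set B)) :
    e ∣ n ∧
    ∃ (Z : Type u) (R : SimpleGraph Z) (c : Z),
      BranchTree.IsRose R c (q ^ n - q ^ e') e' ∧
      Nonempty (BranchTree.branch K B (BranchTree.scalarIntegers K L) ≃g
        BranchTree.attach (BranchTree.subdivision (BranchTree.tree K C) f)
          (BranchTree.nodes (BranchTree.subdivision (BranchTree.tree K C) f)) R c) := by
  -- Subalgebras of `B` are finite-dimensional domains, hence division rings with the same
  -- underlying ring.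
  let : DivisionRing L := divisionRingOfFiniteDimensional K L
  let : DivisionRing C := divisionRingOfFiniteDimensional K C
  subst hq he he' hf
  refine BranchTree.exists_rose_iso_attach hn (ψ := L.val) (φ := C.val) ?_ ?_ ?_
  · rintro l ⟨c, hc⟩
    rw [hC, Subalgebra.mem_centralizer_iff] at hc
    exact hc l l.2
  · intro b hb
    refine ⟨⟨b, ?_⟩, rfl⟩
    rw [hC, Subalgebra.mem_centralizer_iff]
    exact fun l hl => hb ⟨l, hl⟩
  · intro Λ
    constructor
    · exact fun h l hl => h ⟨l, hl, rfl⟩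
    · rintro h _ ⟨l, hl, rfl⟩
      exact h l hl
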